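/- A mixed Hodge structure is a finitely generated abelian group $H_{\rm et}$ with a finite increasing filtration $W$ of $H_{\mathbb Q}=H_{\rm et}\otimes\mathbb Q$ and a finite decreasing filtration $F$ of $H_{\mathbb C}=H_{\rm et}\otimes\mathbb C$ such that $F$ induces a pure Hodge structure of weight $k$ on $\mathrm{gr}^W_k$ for every $k$; it has level $\le n$ if all its Hodge types $(p,q)$ satisfy $0\le p,q\le n$. Let $\mathsf{MHS}$ be the category of mixed Hodge structures. Let $n>0$. The category $\mathsf{FHS}_n$ of formal Hodge structures of level $\le n$ has as objects $(H,V)$ the data of: a formal group $H=H^o\times H_{\rm et}$, where $H^o$ is a finite dimensional $\mathbb C$-vector space and $H_{\rm et}$ is a mixed Hodge structure of level $\le n$; finite dimensional $\mathbb C$-vector spaces and linear maps $V_n\to V_{n-1}\to\cdots\to V_1$; a homomorphism $h_{\rm et}:H_{\rm et}\to V_n$ and a $\mathbb C$-linear map $h^o:H^o\to V_n$; $\mathbb C$-linear maps $\pi_i:V_i\to H_{\mathbb C}/F^i$ $(1\le i\le n)$ commuting with $V_{i+1}\to V_i$ and the projections $H_{\mathbb C}/F^{i+1}\to H_{\mathbb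 C}/F^{i}$, and such that $\pi_n\circ h_{\rm et}$ is the canonical map $H_{\rm et}\to H_{\mathbb C}/F^n$. Morphisms are families consisting of a morphism of mixed Hodge structures $H_{\rm et}\to H'_{\rm et}$ and $\mathbb C$-linear maps $H^o\to H'^o$, $V_i\to V'_i$, compatible with all these maps. $\mathsf{MHS}$ and $\mathsf{FHS}_n$ are abelian. Put $V_i^o=\ker\pi_i$, let $(H,V/V^o)$ be the object with spaces $V_i/V_i^o$ and the induced maps, and let $(H^o,0)$ be the object with zero étale part and zero spaces. A mixed Hodge structure $H_{\rm et}$ of level $\le n$ is regarded as the object of $\mathsf{FHS}_n$ with $H^o=0$, $V_i=H_{\mathbb C}/F^i$ and $\pi_i=\mathrm{id}$. **Proposition.** Let $H_{\rm et}$ be a mixed Hodge structure of level $\le n$ and let $(H',V')\in\mathsf{FHS}_n$. Then: (i) there is a canonical isomorphism of abelian groups $$\mathrm{Ext}^1_{\mathsf{MHS}}(H_{\rm et},H'_{\rm et})\cong \mathrm{Ext}^1_{\mathsf{FHS}_n}(H_{\rm et},(H',V'/V'^o)),$$ whose inverse is induced by the exact forgetful functor $\mathsf{FHS}_n\to\mathsf{MHS}$,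 $(H,V)\mapsto H_{\rm et}$; (ii) for every $i\ge 2$ there is a canonical isomorphism of abelian groups $$\mathrm{Ext}^i_{\mathsf{FHS}_n}(H_{\rm et},(H',V'/V'^o))\cong \mathrm{Ext}^i_{\mathsf{FHS}_n}(H_{\rm et},(H'^o,0)),$$ induced by the canonical projection $(H',V'/V'^o)\to(H'^o,0)$. -/

import Mathlib

open CategoryTheory CategoryTheory.Limits
open scoped TensorProduct

universe u

namespace FormalHodge

/-! ### Three opposed filtrations on a module -/

/-- Three filtrations `W` (increasing), `F`, `G` (decreasing) of a module, all finite, such that `F`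
and `G` induce `k`-opposed filtrations on each `W k / W (k - 1)`; stated elementwise. -/
structure Opposed {R M : Type*} [Ring R] [AddCommGroup M] [Module R M]
    (W F G : ℤ → Submodule R M) : Prop where
  monoW : Monotone W
  antiF : Antitone F
  antiG : Antitone G
  botW : ∃ a, W a = ⊥
  topW : ∃ a, W a = ⊤
  topF : ∃ a, F a = ⊤
  botF : ∃ a, F a = ⊥
  topG : ∃ a, G a = ⊤
  botG : ∃ a, G a = ⊥
  span : ∀ p q k : ℤ, p + q = k + 1 → ∀ x ∈ W k,
    ∃ u v w, u ∈ F p ∧ u ∈ W k ∧ v ∈ G q ∧ v ∈ W k ∧ w ∈ W (k - 1) ∧ x = u + v + w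
  inter : ∀ p q k : ℤ, p + q = k + 1 → ∀ u v, u ∈ F p → u ∈ W k → v ∈ G q → v ∈ W k →
    u - v ∈ W (k - 1) → u ∈ W (k - 1)

namespace Opposed

section one

variable {R M : Type*} [Ring R] [AddCommGroup M] [Module R M] {W F G : ℤ → Submodule R M}

theorem swap (h : Opposed W F G) : Opposed W G F where
  monoW := h.monoW
  antiF := h.antiG
  antiG := h.antiF
  botW := h.botW
  topW := h.topW
  topF := h.topG
  botF := h.botG
  topG := h.topF
  botG := h.botF
  span p q k hk x hx := by
    obtain ⟨u, v, w, hu, hu', hv, hv', hw, e⟩ := h.span q p k (by omega) x hx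
    exact ⟨v, u, w, hv, hv', hu, hu', hw, by rw [e]; abel⟩
  inter p q k hk u v hu hu' hv hv' huv := by
    have h1 := h.inter q p k (by omega) v u hv hv' hu hu'
      (by rw [← neg_sub u v]; exact neg_mem huv)
    have := add_mem huv h1
    simpa using this

/-- The canonical complement of `F p ⊓ W m` in `W m`. -/
def compl (W G : ℤ → Submodule R M) (p m : ℤ) : Submodule R M :=
  ⨆ l : {l : ℤ // l ≤ m}, G (l.1 + 1 - p) ⊓ W l.1

theorem compl_step (W G : ℤ → Submodule R M) (p m : ℤ) :
    compl W G p m = (G (m + 1 - p) ⊓ W m) ⊔ compl W G p (m - 1) := by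
  apply le_antisymm
  · refine iSup_le fun ⟨l, hl⟩ => ?_
    rcases eq_or_lt_of_le hl with rfl | hl
    · exact le_sup_left
    · exact le_trans (le_iSup (fun l : {l : ℤ // l ≤ m - 1} => G (l.1 + 1 - p) ⊓ W l.1)
        ⟨l, by omega⟩) le_sup_right
  · refine sup_le (le_iSup (fun l : {l : ℤ // l ≤ m} => G (l.1 + 1 - p) ⊓ W l.1) ⟨m, le_rfl⟩) ?_
    exact iSup_le fun ⟨l, hl⟩ =>
      le_iSup (fun l : {l : ℤ // l ≤ m} => G (l.1 + 1 - p) ⊓ W l.1) ⟨l, by omega⟩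

theorem compl_le (h : Opposed W F G) (p m : ℤ) : compl W G p m ≤ W m :=
  iSup_le fun l => inf_le_right.trans (h.monoW l.2)

theorem compl_mono_p (h : Opposed W F G) (p m : ℤ) : compl W G p m ≤ compl W G (p + 1) m :=
  iSup_mono fun l => inf_le_inf_right _ (h.antiG (by omega))

theorem ind (h : Opposed W F G) (P : ℤ → Prop) (h0 : ∀ m, W m = ⊥ → P m)
    (h1 : ∀ m, P (m - 1) → P m) (m : ℤ) : P m := by
  obtain ⟨a, ha⟩ := h.botW
  rcases le_total m a with hm | hm
  · exact h0 m (le_bot_iff.1 (ha ▸ h.monoW hm))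
  · induction m, hm using Int.leInduction with
    | base => exact h0 a ha
    | succ n hn ih => exact h1 _ (by simpa using ih)

theorem exists_dec (h : Opposed W F G) (p m : ℤ) :
    ∀ x ∈ W m, ∃ u v, u ∈ F p ∧ u ∈ W m ∧ v ∈ compl W G p m ∧ x = u + v := by
  refine h.ind (fun m => ∀ x ∈ W m, ∃ u v, u ∈ F p ∧ u ∈ W m ∧ v ∈ compl W G p m ∧ x = u + v)
    ?_ ?_ m
  · intro m hm x hx
    rw [hm, Submodule.mem_bot] at hx
    exact ⟨0, 0, zero_mem _, zero_mem _, zero_mem _, by simp [hx]⟩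
  · intro m ih x hx
    obtain ⟨u, v, w, hu, hu', hv, hv', hw, e⟩ := h.span p (m + 1 - p) m (by omega) x hx
    obtain ⟨u2, v2, hu2, hu2', hv2, e2⟩ := ih w hw
    have hle : W (m - 1) ≤ W m := h.monoW (by omega)
    refine ⟨u + u2, v + v2, add_mem hu hu2, add_mem hu' (hle hu2'), ?_, by rw [e, e2]; abel⟩
    rw [compl_step]
    exact Submodule.add_mem_sup ⟨hv, hv'⟩ hv2

theorem compl_disj (h : Opposed W F G) (p m : ℤ) :
    ∀ x ∈ F p, x ∈ compl W G p m → x = 0 := by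
  refine h.ind (fun m => ∀ x ∈ F p, x ∈ compl W G p m → x = 0) ?_ ?_ m
  · intro m hm x _ hx
    simpa [hm] using h.compl_le p m hx
  · intro m ih x hx hx'
    have hxW := h.compl_le p m hx'
    rw [compl_step] at hx'
    obtain ⟨g, hg, r, hr, rfl⟩ := Submodule.mem_sup.1 hx'
    have hr' := h.compl_le p _ hr
    have h1 : g + r ∈ W (m - 1) := h.inter p (m + 1 - p) m (by omega) _ g hx hxW hg.1 hg.2
      (by simpa using hr')
    have h2 : g ∈ W (m - 1) := by simpa using sub_mem h1 hr'
    refine ih _ hx (add_mem ?_ hr)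
    rw [compl_step]
    exact Submodule.mem_sup_left ⟨h.antiG (by omega) hg.1, h2⟩

theorem dec_unique (h : Opposed W F G) (p m : ℤ) {u u' v v' : M} (hu : u ∈ F p) (hu' : u' ∈ F p)
    (hv : v ∈ compl W G p m) (hv' : v' ∈ compl W G p m) (e : u + v = u' + v') :
    u = u' ∧ v = v' := by
  have e1 : u - u' = v' - v := by
    rw [sub_eq_sub_iff_add_eq_add, e, add_comm]
  have := h.compl_disj p m _ (sub_mem hu hu') (by rw [e1]; exact sub_mem hv' hv)
  have hu : u = u' := sub_eq_zero.1 this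
  exact ⟨hu, by simpa [hu] using e⟩

theorem compl_mono_m (p : ℤ) {m m' : ℤ} (hm : m ≤ m') : compl W G p m ≤ compl W G p m' :=
  iSup_le fun l => le_iSup (fun l : {l : ℤ // l ≤ m'} => G (l.1 + 1 - p) ⊓ W l.1)
    ⟨l.1, l.2.trans hm⟩

/-- Deligne's canonical bigrading piece of type `(p, m - p)`. -/
def piece (W F G : ℤ → Submodule R M) (p m : ℤ) : Submodule R M :=
  F p ⊓ ((G (m - p) ⊓ W m) ⊔ compl W G p (m - 2))

theorem piece_disj (h : Opposed W F G) (p m : ℤ) :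
    ∀ x ∈ piece W F G p m, x ∈ W (m - 1) → x = 0 := by
  rintro x ⟨hx, hx'⟩ hxW
  obtain ⟨g, hg, r, hr, rfl⟩ := Submodule.mem_sup.1 hx'
  have hr' : r ∈ W (m - 1) := h.monoW (by omega) (h.compl_le p _ hr)
  have h2 : g ∈ W (m - 1) := by simpa using sub_mem hxW hr'
  refine h.compl_disj p (m - 1) _ hx ?_
  rw [compl_step]
  rw [show m - 1 + 1 - p = m - p by omega, show m - 1 - 1 = m - 2 by omega]
  exact Submodule.add_mem_sup ⟨hg.1, h2⟩ hr

theorem exists_piece (h : Opposed W F G) (p m : ℤ) (x y : M) (hx : x ∈ F p)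
    (hy : y ∈ G (m - p)) (hy' : y ∈ W m) (hxy : x - y ∈ W (m - 1)) :
    ∃ z ∈ piece W F G p m, x - z ∈ W (m - 1) ∧ x - z ∈ F p := by
  obtain ⟨u, v, hu, hu', hv, e⟩ := h.exists_dec p (m - 1) _ hxy
  refine ⟨x - u, ⟨sub_mem hx hu, ?_⟩, by simpa using hu', by simpa using hu⟩
  have : x - u = y + v := by
    have : x = (u + v) + y := by rw [← e]; abel
    rw [this]; abel
  rw [this]
  rw [compl_step] at hv
  obtain ⟨g, hg, r, hr, rfl⟩ := Submodule.mem_sup.1 hv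
  rw [show m - 1 + 1 - p = m - p by omega] at hg
  rw [show m - 1 - 1 = m - 2 by omega] at hr
  rw [← add_assoc]
  exact Submodule.add_mem_sup ⟨add_mem hy hg.1, add_mem hy' (h.monoW (by omega) hg.2)⟩ hr

end one

section two

variable {R M N : Type*} [Ring R] [AddCommGroup M] [Module R M] [AddCommGroup N] [Module R N]
  {W F G : ℤ → Submodule R M} {W' F' G' : ℤ → Submodule R N} (f : M →ₗ[R] N)

theorem map_compl (hW : ∀ k x, x ∈ W k → f x ∈ W' k) (hG : ∀ k x, x ∈ G k → f x ∈ G' k)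
    (p m : ℤ) (x : M) (hx : x ∈ compl W G p m) : f x ∈ compl W' G' p m := by
  have : (compl W G p m) ≤ (compl W' G' p m).comap f := by
    refine iSup_le fun l => ?_
    intro y hy
    exact le_iSup (fun l : {l : ℤ // l ≤ m} => G' (l.1 + 1 - p) ⊓ W' l.1) l
      ⟨hG _ _ hy.1, hW _ _ hy.2⟩
  exact this hx

theorem map_piece (hW : ∀ k x, x ∈ W k → f x ∈ W' k) (hF : ∀ k x, x ∈ F k → f x ∈ F' k)
    (hG : ∀ k x, x ∈ G k → f x ∈ G' k)
    (p m : ℤ) (x : M) (hx : x ∈ piece W F G p m) : f x ∈ piece W' F' G' p m := by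
  obtain ⟨hx1, hx2⟩ := hx
  obtain ⟨g, hg, r, hr, rfl⟩ := Submodule.mem_sup.1 hx2
  refine ⟨hF _ _ hx1, ?_⟩
  rw [map_add]
  exact Submodule.add_mem_sup ⟨hG _ _ hg.1, hW _ _ hg.2⟩ (map_compl f hW hG _ _ _ hr)

theorem strictF
    (h : Opposed W F G) (h' : Opposed W' F' G')
    (hW : ∀ k x, x ∈ W k → f x ∈ W' k) (hF : ∀ k x, x ∈ F k → f x ∈ F' k)
    (hG : ∀ k x, x ∈ G k → f x ∈ G' k)
    (p m : ℤ) (a : M) (ha : a ∈ W m) (hfa : f a ∈ F' p) :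
    ∃ a', a' ∈ F p ∧ a' ∈ W m ∧ f a' = f a := by
  obtain ⟨u, v, hu, hu', hv, rfl⟩ := h.exists_dec p m _ ha
  refine ⟨u, hu, hu', ?_⟩
  have h1 : f v ∈ F' p := by simpa using sub_mem hfa (hF _ _ hu)
  simp [h'.compl_disj p m _ h1 (map_compl f hW hG _ _ _ hv)]

theorem strictFW_step
    (h : Opposed W F G) (h' : Opposed W' F' G')
    (hW : ∀ k x, x ∈ W k → f x ∈ W' k) (hF : ∀ k x, x ∈ F k → f x ∈ F' k)
    (hG : ∀ k x, x ∈ G k → f x ∈ G' k)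
    (m p : ℤ) : ∀ a, a ∈ F p → a ∈ W m → f a ∈ W' (m - 1) →
    ∃ a', a' ∈ F p ∧ a' ∈ W (m - 1) ∧ f a' = f a := by
  obtain ⟨b, hb⟩ := h.botF
  rcases le_total b p with hp | hp
  · intro a ha _ _
    have : a = 0 := by simpa [hb] using h.antiF hp ha
    exact ⟨0, zero_mem _, zero_mem _, by rw [this]⟩
  · induction p, hp using Int.leInductionDown with
    | base =>
      intro a ha _ _
      have : a = 0 := by simpa [hb] using ha
      exact ⟨0, zero_mem _, zero_mem _, by rw [this]⟩
    | pred p _ ih =>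
      intro a ha haW hfa
      have hle : F p ≤ F (p - 1) := h.antiF (by omega)
      obtain ⟨a1, a2, h1, h1', h2, rfl⟩ := h.exists_dec p m _ haW
      obtain ⟨b1, b2, k1, k1', k2, e⟩ := h'.exists_dec p (m - 1) _ hfa
      rw [map_add] at e
      obtain ⟨e1, e2⟩ := h'.dec_unique p m (hF _ _ h1) k1 (map_compl f hW hG _ _ _ h2)
        (compl_mono_m p (by omega) k2) e
      obtain ⟨a1', c1, c2, c3⟩ := ih a1 h1 h1' (e1 ▸ k1')
      have h2F : a2 ∈ F (p - 1) := by simpa using sub_mem ha (hle h1)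
      rw [compl_step] at h2
      obtain ⟨g, hg, r, hr, rfl⟩ := Submodule.mem_sup.1 h2
      obtain ⟨z, hz, hz1, hz2⟩ := h.exists_piece (p - 1) m (g + r) g h2F
        (by rw [show m - (p - 1) = m + 1 - p by omega]; exact hg.1) hg.2 (by simpa using h.compl_le p _ hr)
      have h3 : f (g + r) ∈ W' (m - 1) := e2 ▸ h'.compl_le p _ k2
      have h4 : f z ∈ W' (m - 1) := by
        have := sub_mem h3 (hW _ _ hz1)
        simpa using this
      have h5 := h'.piece_disj (p - 1) m _ (map_piece f hW hF hG _ _ _ hz) h4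
      refine ⟨a1' + (g + r - z), add_mem (hle c1) hz2, add_mem c2 hz1, ?_⟩
      rw [map_add, map_add, map_sub, c3, h5, sub_zero]

theorem strictFW
    (h : Opposed W F G) (h' : Opposed W' F' G')
    (hW : ∀ k x, x ∈ W k → f x ∈ W' k) (hF : ∀ k x, x ∈ F k → f x ∈ F' k)
    (hG : ∀ k x, x ∈ G k → f x ∈ G' k)
    (k p : ℤ) (a : M) (ha : a ∈ F p) (hfa : f a ∈ W' k) :
    ∃ a', a' ∈ F p ∧ a' ∈ W k ∧ f a' = f a := by
  obtain ⟨t, ht⟩ := h.topW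
  have key : ∀ m, k ≤ m → ∀ a, a ∈ F p → a ∈ W m → f a ∈ W' k →
      ∃ a', a' ∈ F p ∧ a' ∈ W k ∧ f a' = f a := by
    intro m hm
    induction m, hm using Int.leInduction with
    | base => exact fun a ha ha' _ => ⟨a, ha, ha', rfl⟩
    | succ n hn ih =>
      intro a ha ha' hfa
      obtain ⟨a', h1, h2, h3⟩ := strictFW_step f h h' hW hF hG (n + 1) p a ha ha'
        (h'.monoW (by omega) hfa)
      obtain ⟨a'', k1, k2, k3⟩ := ih a' h1 (by simpa using h2) (h3 ▸ hfa)
      exact ⟨a'', k1, k2, k3.trans h3⟩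
  exact key (max k t) (le_max_left _ _) a ha
    (h.monoW (le_max_right _ _) (ht ▸ Submodule.mem_top)) hfa

theorem strictW
    (h : Opposed W F G) (h' : Opposed W' F' G')
    (hW : ∀ k x, x ∈ W k → f x ∈ W' k) (hF : ∀ k x, x ∈ F k → f x ∈ F' k)
    (hG : ∀ k x, x ∈ G k → f x ∈ G' k)
    (k : ℤ) (a : M) (hfa : f a ∈ W' k) : ∃ a', a' ∈ W k ∧ f a' = f a := by
  obtain ⟨t, ht⟩ := h.topF
  obtain ⟨a', _, h2, h3⟩ := strictFW f h h' hW hF hG k t a (ht ▸ Submodule.mem_top) hfa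
  exact ⟨a', h2, h3⟩

theorem strictF'
    (h : Opposed W F G) (h' : Opposed W' F' G')
    (hW : ∀ k x, x ∈ W k → f x ∈ W' k) (hF : ∀ k x, x ∈ F k → f x ∈ F' k)
    (hG : ∀ k x, x ∈ G k → f x ∈ G' k)
    (p : ℤ) (a : M) (hfa : f a ∈ F' p) : ∃ a', a' ∈ F p ∧ f a' = f a := by
  obtain ⟨t, ht⟩ := h.topW
  obtain ⟨a', h1, _, h3⟩ := strictF f h h' hW hF hG p t a (ht ▸ Submodule.mem_top) hfa
  exact ⟨a', h1, h3⟩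

/-- The kernel of a morphism, with the induced filtrations. -/
theorem ker
    (h : Opposed W F G) (h' : Opposed W' F' G')
    (hW : ∀ k x, x ∈ W k → f x ∈ W' k) (hF : ∀ k x, x ∈ F k → f x ∈ F' k)
    (hG : ∀ k x, x ∈ G k → f x ∈ G' k)
    {K : Type*} [AddCommGroup K] [Module R K] (i : K →ₗ[R] M)
    (hi : Function.Injective i) (hex : ∀ x, f x = 0 ↔ ∃ y, i y = x) :
    Opposed (fun k => (W k).comap i) (fun k => (F k).comap i) (fun k => (G k).comap i) where
  monoW _ _ hab := Submodule.comap_mono (h.monoW hab)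
  antiF _ _ hab := Submodule.comap_mono (h.antiF hab)
  antiG _ _ hab := Submodule.comap_mono (h.antiG hab)
  botW := h.botW.imp fun a ha => by
    simp only [ha]; rw [← LinearMap.ker, LinearMap.ker_eq_bot.2 hi]
  botF := h.botF.imp fun a ha => by
    simp only [ha]; rw [← LinearMap.ker, LinearMap.ker_eq_bot.2 hi]
  botG := h.botG.imp fun a ha => by
    simp only [ha]; rw [← LinearMap.ker, LinearMap.ker_eq_bot.2 hi]
  topW := h.topW.imp fun a ha => by simp [ha]
  topF := h.topF.imp fun a ha => by simp [ha]
  topG := h.topG.imp fun a ha => by simp [ha]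
  inter p q k hpq u v hu hu' hv hv' huv :=
    h.inter p q k hpq (i u) (i v) hu hu' hv hv' (by simpa using huv)
  span p q k hpq x hx := by
    obtain ⟨u, v, hu, hu', hv, e⟩ := h.exists_dec p k _ hx
    have hfx : f (i x) = 0 := (hex _).2 ⟨x, rfl⟩
    have hfuv : f u + f v = 0 + 0 := by rw [← map_add, ← e, hfx, add_zero]
    obtain ⟨fu, fv⟩ := h'.dec_unique p k (hF _ _ hu) (zero_mem _)
      (map_compl f hW hG _ _ _ hv) (zero_mem _) hfuv
    rw [compl_step] at hv
    obtain ⟨g, hg, r, hr, rfl⟩ := Submodule.mem_sup.1 hv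
    have hr' := h.compl_le p _ hr
    have hfg : f g ∈ W' (k - 1) := by
      rw [map_add] at fv
      rw [eq_neg_of_add_eq_zero_left fv]
      exact neg_mem (hW _ _ hr')
    obtain ⟨g', c1, c2, c3⟩ := strictFW f h.swap h'.swap hW hG hF (k - 1) _ g hg.1 hfg
    have hq : k + 1 - p = q := by omega
    rw [hq] at c1 hg
    obtain ⟨yu, hyu⟩ := (hex u).1 fu
    obtain ⟨yv, hyv⟩ := (hex (g - g')).1 (by rw [map_sub, c3, sub_self])
    obtain ⟨yw, hyw⟩ := (hex (r + g')).1 (by rw [map_add, c3, add_comm, ← map_add, fv])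
    refine ⟨yu, yv, yw, ?_, ?_, ?_, ?_, ?_, hi ?_⟩
    · simpa [hyu] using hu
    · simpa [hyu] using hu'
    · simpa [hyv] using sub_mem hg.1 c1
    · simpa [hyv] using sub_mem hg.2 (h.monoW (by omega) c2)
    · simpa [hyw] using add_mem hr' c2
    · rw [map_add, map_add, hyu, hyv, hyw, e]; abel

theorem coker_aux
    (h : Opposed W F G) (h' : Opposed W' F' G')
    (hW : ∀ k x, x ∈ W k → f x ∈ W' k) (hF : ∀ k x, x ∈ F k → f x ∈ F' k)
    (hG : ∀ k x, x ∈ G k → f x ∈ G' k)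
    {C : Type*} [AddCommGroup C] [Module R C] (g : N →ₗ[R] C)
    (hex : ∀ x, g x = 0 ↔ ∃ y, f y = x) (p q k : ℤ) (hpq : p + q = k + 1) (q' : ℤ) (hq : q' ≤ q)
    (hint : ∀ u v, u ∈ F' p → u ∈ W' k → v ∈ G' q' → v ∈ W' k → u - v ∈ W' (k - 1) →
      u ∈ W' (k - 1)) (u v : N)
    (hu : u ∈ F' p) (hu' : u ∈ W' k) (hv : v ∈ G' q') (hv' : v ∈ W' k) (w : N)
    (hw : w ∈ W' (k - 1)) (e : g (u - v) = g w) : ∃ y ∈ W' (k - 1), g y = g u := by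
  have hle : W' (k - 1) ≤ W' k := h'.monoW (by omega)
  obtain ⟨a, ha⟩ := (hex (u - v - w)).1 (by rw [map_sub, e, sub_self])
  obtain ⟨a, haW, ha'⟩ := strictW f h h' hW hF hG k a
    (by rw [ha]; exact sub_mem (sub_mem hu' hv') (hle hw))
  rw [ha] at ha'
  obtain ⟨a1, a2, a3, h1, h1', h2, h2', h3, rfl⟩ := h.span p q k hpq a haW
  rw [map_add, map_add] at ha'
  have := hint (u - f a1) (v + f a2) (sub_mem hu (hF _ _ h1)) (sub_mem hu' (hW _ _ h1'))
    (add_mem hv (h'.antiG hq (hG _ _ h2))) (add_mem hv' (hW _ _ h2')) (by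
      have : u - f a1 - (v + f a2) = w + f a3 := by
        have : u = f a1 + f a2 + f a3 + w + v := by rw [ha']; abel
        rw [this]; abel
      rw [this]
      exact add_mem hw (hW _ _ h3))
  refine ⟨_, this, ?_⟩
  rw [map_sub, (hex (f a1)).2 ⟨a1, rfl⟩, sub_zero]

/-- In a cokernel, the image of `F ⊓ W` is the intersection of the images. -/
theorem coker_FW
    (h : Opposed W F G) (h' : Opposed W' F' G')
    (hW : ∀ k x, x ∈ W k → f x ∈ W' k) (hF : ∀ k x, x ∈ F k → f x ∈ F' k)
    (hG : ∀ k x, x ∈ G k → f x ∈ G' k)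
    {C : Type*} [AddCommGroup C] [Module R C] (g : N →ₗ[R] C)
    (hex : ∀ x, g x = 0 ↔ ∃ y, f y = x) (p k : ℤ) (x : C) (hx : x ∈ (F' p).map g)
    (hx' : x ∈ (W' k).map g) : ∃ u, u ∈ F' p ∧ u ∈ W' k ∧ g u = x := by
  obtain ⟨b1, hb1, rfl⟩ := hx
  obtain ⟨b2, hb2, e⟩ := hx'
  obtain ⟨m, hm, hkm⟩ : ∃ m, W m = ⊤ ∧ k ≤ m := by
    obtain ⟨t, ht⟩ := h.topW
    exact ⟨max t k, top_le_iff.1 (ht ▸ h.monoW (le_max_left _ _)), le_max_right _ _⟩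
  obtain ⟨u, v, hu, hu', hv, rfl⟩ := h'.exists_dec p k _ hb2
  obtain ⟨a, ha⟩ := (hex (b1 - (u + v))).1 (by rw [map_sub, e, sub_self])
  obtain ⟨a1, a2, h1, _, h2, rfl⟩ := h.exists_dec p m a (hm ▸ Submodule.mem_top)
  rw [map_add] at ha
  obtain ⟨e1, -⟩ := h'.dec_unique p m (sub_mem hb1 (hF _ _ h1)) hu
    (neg_mem (compl_mono_m p hkm hv)) (map_compl f hW hG _ _ _ h2) (by
      have : b1 = f a1 + f a2 + (u + v) := by rw [ha]; abel
      rw [this]; abel)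
  refine ⟨u, hu, hu', ?_⟩
  rw [← e1, map_sub, (hex (f a1)).2 ⟨a1, rfl⟩, sub_zero]

/-- The cokernel of a morphism, with the quotient filtrations. -/
theorem coker
    (h : Opposed W F G) (h' : Opposed W' F' G')
    (hW : ∀ k x, x ∈ W k → f x ∈ W' k) (hF : ∀ k x, x ∈ F k → f x ∈ F' k)
    (hG : ∀ k x, x ∈ G k → f x ∈ G' k)
    {C : Type*} [AddCommGroup C] [Module R C] (g : N →ₗ[R] C)
    (hg : Function.Surjective g) (hex : ∀ x, g x = 0 ↔ ∃ y, f y = x) :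
    Opposed (fun k => (W' k).map g) (fun k => (F' k).map g) (fun k => (G' k).map g) where
  monoW _ _ hab := Submodule.map_mono (h'.monoW hab)
  antiF _ _ hab := Submodule.map_mono (h'.antiF hab)
  antiG _ _ hab := Submodule.map_mono (h'.antiG hab)
  botW := h'.botW.imp fun a ha => by simp [ha]
  botF := h'.botF.imp fun a ha => by simp [ha]
  botG := h'.botG.imp fun a ha => by simp [ha]
  topW := h'.topW.imp fun a ha => by simp [ha, LinearMap.range_eq_top.2 hg]
  topF := h'.topF.imp fun a ha => by simp [ha, LinearMap.range_eq_top.2 hg]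
  topG := h'.topG.imp fun a ha => by simp [ha, LinearMap.range_eq_top.2 hg]
  inter p q k hpq u v hu hu' hv hv' huv := by
    obtain ⟨u0, hu0, hu0', rfl⟩ := coker_FW f h h' hW hF hG g hex p k u hu hu'
    obtain ⟨v0, hv0, hv0', rfl⟩ := coker_FW f h.swap h'.swap hW hG hF g hex q k v hv hv'
    obtain ⟨w, hw, e⟩ := huv
    exact coker_aux f h h' hW hF hG g hex p q k hpq q le_rfl (h'.inter p q k hpq) u0 v0 hu0 hu0'
      hv0 hv0' w hw (by rw [map_sub, e])
  span p q k hpq x hx := by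
    obtain ⟨x, hx, rfl⟩ := hx
    obtain ⟨u, v, w, hu, hu', hv, hv', hw, rfl⟩ := h'.span p q k hpq x hx
    exact ⟨g u, g v, g w, ⟨u, hu, rfl⟩, ⟨u, hu', rfl⟩, ⟨v, hv, rfl⟩, ⟨v, hv', rfl⟩, ⟨w, hw, rfl⟩,
      by simp⟩

end two

end Opposed

/-! ### Rational and complex extensions of an abelian group -/

section Extension

variable (H : Type*) [AddCommGroup H]

/-- The canonical map `H_ℚ → H_ℂ`. -/
noncomputable def ratToComplex : ℚ ⊗[ℤ] H →ₗ[ℤ] ℂ ⊗[ℤ] H :=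
  LinearMap.rTensor H (algebraMap ℚ ℂ).toAddMonoidHom.toIntLinearMap

/-- Complex conjugation on `H_ℂ = ℂ ⊗ H`, that is `z ⊗ x ↦ conj z ⊗ x`. -/
noncomputable def conjC : ℂ ⊗[ℤ] H →ₗ[ℤ] ℂ ⊗[ℤ] H :=
  LinearMap.rTensor H (starRingEnd ℂ).toAddMonoidHom.toIntLinearMap

variable {H}

@[simp] theorem ratToComplex_tmul (q : ℚ) (x : H) :
    ratToComplex H (q ⊗ₜ x) = (q : ℂ) ⊗ₜ x := by
  change (algebraMap ℚ ℂ q) ⊗ₜ[ℤ] x = _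
  rw [eq_ratCast]

@[simp] theorem conjC_tmul (z : ℂ) (x : H) :
    conjC H (z ⊗ₜ x) = (starRingEnd ℂ z) ⊗ₜ x := rfl

theorem conjC_smul (c : ℂ) (x : ℂ ⊗[ℤ] H) : conjC H (c • x) = starRingEnd ℂ c • conjC H x := by
  induction x with
  | zero => simp
  | add x y hx hy => simp [hx, hy]
  | tmul z x => simp [TensorProduct.smul_tmul']

/-- The complexification `U_ℂ ⊆ H_ℂ` of a rational subspace `U ⊆ H_ℚ`. -/
noncomputable def complexify (U : Submodule ℚ (ℚ ⊗[ℤ] H)) : Submodule ℂ (ℂ ⊗[ℤ] H) :=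
  Submodule.span ℂ (ratToComplex H '' U)

/-- The complex conjugate `{x | conj x ∈ U}` of a complex subspace `U ⊆ H_ℂ`. -/
noncomputable def conjSub (U : Submodule ℂ (ℂ ⊗[ℤ] H)) : Submodule ℂ (ℂ ⊗[ℤ] H) where
  carrier := {x | conjC H x ∈ U}
  zero_mem' := by simp
  add_mem' {x y} hx hy := by
    simp only [Set.mem_ofPred_eq, map_add] at *
    exact add_mem hx hy
  smul_mem' c x hx := by
    simp only [Set.mem_ofPred_eq, conjC_smul] at *
    exact U.smul_mem _ hx

@[simp] theorem mem_conjSub {U : Submodule ℂ (ℂ ⊗[ℤ] H)} {x : ℂ ⊗[ℤ] H} :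
    x ∈ conjSub U ↔ conjC H x ∈ U := Iff.rfl

theorem conjC_conjC (x : ℂ ⊗[ℤ] H) : conjC H (conjC H x) = x := by
  induction x with
  | zero => simp
  | add x y hx hy => simp [hx, hy]
  | tmul z x => simp

/-- The `ℚ`-linear coordinate `φ ⊗ id : H_ℂ → H_ℚ` attached to a `ℚ`-linear form on `ℂ`. -/
noncomputable def coordC (H : Type*) [AddCommGroup H] (φ : ℂ →ₗ[ℚ] ℚ) :
    ℂ ⊗[ℤ] H →ₗ[ℤ] ℚ ⊗[ℤ] H :=
  LinearMap.rTensor H (φ.restrictScalars ℤ)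

@[simp] theorem coordC_tmul (φ : ℂ →ₗ[ℚ] ℚ) (z : ℂ) (x : H) :
    coordC H φ (z ⊗ₜ x) = (φ z) ⊗ₜ x := rfl

theorem coordC_smul (φ : ℂ →ₗ[ℚ] ℚ) (c : ℂ) (x : ℂ ⊗[ℤ] H) :
    coordC H φ (c • x) = coordC H (φ ∘ₗ LinearMap.mulLeft ℚ c) x := by
  induction x with
  | zero => simp
  | add x y hx hy => simp [hx, hy]
  | tmul z x => simp [TensorProduct.smul_tmul']

theorem coordC_smul_rat (φ : ℂ →ₗ[ℚ] ℚ) (c : ℂ) (y : ℚ ⊗[ℤ] H) :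
    coordC H φ (c • ratToComplex H y) = φ c • y := by
  induction y with
  | zero => simp
  | add x y hx hy => simp [hx, hy]
  | tmul q x =>
    have : c * (q : ℂ) = q • c := by rw [mul_comm, Algebra.smul_def]; rfl
    simp [TensorProduct.smul_tmul', this, mul_comm]

theorem exists_coord (z : ℂ ⊗[ℤ] H) : ∃ s : Finset (Module.Basis.ofVectorSpaceIndex ℚ ℂ),
    ∀ t, s ⊆ t → z = ∑ i ∈ t, (Module.Basis.ofVectorSpace ℚ ℂ i) •
      ratToComplex H (coordC H ((Module.Basis.ofVectorSpace ℚ ℂ).coord i) z) := by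
  classical
  induction z with
  | zero => exact ⟨∅, fun t _ => by simp⟩
  | add x y hx hy =>
    obtain ⟨s, hs⟩ := hx
    obtain ⟨t, ht⟩ := hy
    refine ⟨s ∪ t, fun w hw => ?_⟩
    conv_lhs => rw [hs w (Finset.union_subset_left hw), ht w (Finset.union_subset_right hw)]
    simp [Finset.sum_add_distrib]
  | tmul z x =>
    refine ⟨((Module.Basis.ofVectorSpace ℚ ℂ).repr z).support, fun t ht => ?_⟩
    conv_lhs => rw [← (Module.Basis.ofVectorSpace ℚ ℂ).linearCombination_repr z,
      Finsupp.linearCombination_apply, Finsupp.sum_of_support_subset _ ht _ (by simp)]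
    rw [TensorProduct.sum_tmul]
    refine Finset.sum_congr rfl fun i _ => ?_
    rw [coordC_tmul, ratToComplex_tmul, TensorProduct.smul_tmul', Module.Basis.coord_apply,
      Algebra.smul_def, smul_eq_mul, mul_comm]
    rfl

theorem mem_complexify {U : Submodule ℚ (ℚ ⊗[ℤ] H)} {z : ℂ ⊗[ℤ] H} :
    z ∈ complexify U ↔ ∀ φ : ℂ →ₗ[ℚ] ℚ, coordC H φ z ∈ U := by
  constructor
  · intro hz φ
    have key : ∀ z ∈ complexify U, ∀ φ : ℂ →ₗ[ℚ] ℚ, coordC H φ z ∈ U := by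
      intro z hz
      refine Submodule.span_induction (p := fun z _ => ∀ φ : ℂ →ₗ[ℚ] ℚ, coordC H φ z ∈ U)
        ?_ ?_ ?_ ?_ hz
      · rintro _ ⟨y, hy, rfl⟩ φ
        rw [← one_smul ℂ (ratToComplex H y), coordC_smul_rat]
        exact U.smul_mem _ hy
      · intro φ; simp
      · intro x y _ _ hx hy φ
        rw [map_add]; exact add_mem (hx φ) (hy φ)
      · intro c x _ hx φ
        rw [coordC_smul]; exact hx _
    exact key z hz φ
  · intro h
    obtain ⟨s, hs⟩ := exists_coord z
    rw [hs s subset_rfl]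
    exact Submodule.sum_mem _ fun i _ =>
      Submodule.smul_mem _ _ (Submodule.subset_span ⟨_, h _, rfl⟩)

theorem ratToComplex_mem_complexify {U : Submodule ℚ (ℚ ⊗[ℤ] H)} {y : ℚ ⊗[ℤ] H} :
    ratToComplex H y ∈ complexify U ↔ y ∈ U := by
  refine ⟨fun h => ?_, fun h => Submodule.subset_span ⟨y, h, rfl⟩⟩
  obtain ⟨φ, hφ⟩ : ∃ φ : ℂ →ₗ[ℚ] ℚ, φ 1 = 1 := by
    obtain ⟨φ, hφ⟩ := LinearMap.exists_leftInverse_of_injective (Algebra.linearMap ℚ ℂ)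
      (LinearMap.ker_eq_bot.2 (algebraMap ℚ ℂ).injective)
    exact ⟨φ, by simpa using LinearMap.congr_fun hφ 1⟩
  have := mem_complexify.1 h φ
  rwa [← one_smul ℂ (ratToComplex H y), coordC_smul_rat, hφ, one_smul] at this

theorem complexify_mono {U V : Submodule ℚ (ℚ ⊗[ℤ] H)} (h : U ≤ V) :
    complexify U ≤ complexify V := Submodule.span_mono (Set.image_mono h)

theorem complexify_bot : complexify (⊥ : Submodule ℚ (ℚ ⊗[ℤ] H)) = ⊥ := by
  simp [complexify]

theorem complexify_top : complexify (⊤ : Submodule ℚ (ℚ ⊗[ℤ] H)) = ⊤ :=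
  top_le_iff.1 fun _ _ => mem_complexify.2 fun _ => Submodule.mem_top

section maps

variable {H' : Type*} [AddCommGroup H'] (f : H →ₗ[ℤ] H')

theorem baseChange_conjC (x : ℂ ⊗[ℤ] H) :
    f.baseChange ℂ (conjC H x) = conjC H' (f.baseChange ℂ x) := by
  induction x with
  | zero => simp
  | add x y hx hy => simp [hx, hy]
  | tmul z x => simp

theorem baseChange_coordC (φ : ℂ →ₗ[ℚ] ℚ) (x : ℂ ⊗[ℤ] H) :
    f.baseChange ℚ (coordC H φ x) = coordC H' φ (f.baseChange ℂ x) := by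
  induction x with
  | zero => simp
  | add x y hx hy => simp [hx, hy]
  | tmul z x => simp

theorem baseChange_ratToComplex (x : ℚ ⊗[ℤ] H) :
    f.baseChange ℂ (ratToComplex H x) = ratToComplex H' (f.baseChange ℚ x) := by
  induction x with
  | zero => simp
  | add x y hx hy => simp [hx, hy]
  | tmul z x => simp

theorem complexify_comap (U : Submodule ℚ (ℚ ⊗[ℤ] H')) :
    complexify (U.comap (f.baseChange ℚ)) = (complexify U).comap (f.baseChange ℂ) := by
  ext z
  simp [mem_complexify, baseChange_coordC]

theorem complexify_map (U : Submodule ℚ (ℚ ⊗[ℤ] H)) :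
    complexify (U.map (f.baseChange ℚ)) = (complexify U).map (f.baseChange ℂ) := by
  rw [complexify, complexify, Submodule.map_span]
  congr 1
  ext z
  constructor
  · rintro ⟨_, ⟨y, hy, rfl⟩, rfl⟩
    exact ⟨_, ⟨y, hy, rfl⟩, baseChange_ratToComplex f y⟩
  · rintro ⟨_, ⟨y, hy, rfl⟩, rfl⟩
    exact ⟨_, ⟨y, hy, rfl⟩, (baseChange_ratToComplex f y).symm⟩

theorem complexify_inf (U V : Submodule ℚ (ℚ ⊗[ℤ] H)) :
    complexify (U ⊓ V) = complexify U ⊓ complexify V := by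
  ext z
  simp [mem_complexify, forall_and]

theorem conjSub_comap (U : Submodule ℂ (ℂ ⊗[ℤ] H')) :
    conjSub (U.comap (f.baseChange ℂ)) = (conjSub U).comap (f.baseChange ℂ) := by
  ext z
  simp [baseChange_conjC]

theorem conjSub_map (U : Submodule ℂ (ℂ ⊗[ℤ] H)) :
    conjSub (U.map (f.baseChange ℂ)) = (conjSub U).map (f.baseChange ℂ) := by
  ext z
  constructor
  · rintro ⟨y, hy, e⟩
    refine ⟨conjC H y, by simpa [conjC_conjC] using hy, ?_⟩
    rw [baseChange_conjC, e, conjC_conjC]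
  · rintro ⟨y, hy, rfl⟩
    exact ⟨conjC H y, hy, baseChange_conjC f y⟩

variable {f}

theorem baseChange_exact {H'' : Type*} [AddCommGroup H''] {g : H' →ₗ[ℤ] H''}
    (A : Type*) [CommRing A] (hA : Module.Flat ℤ A)
    (hex : ∀ x, g x = 0 ↔ ∃ y, f y = x) (x : A ⊗[ℤ] H') :
    g.baseChange A x = 0 ↔ ∃ y, f.baseChange A y = x :=
  Module.Flat.lTensor_exact (R := ℤ) A (f := f) (g := g) hex x

theorem baseChange_injective (A : Type*) [CommRing A] (hA : Module.Flat ℤ A)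
    (hf : Function.Injective f) : Function.Injective (f.baseChange A) :=
  Module.Flat.lTensor_preserves_injective_linearMap (M := A) f hf

theorem baseChange_surjective (A : Type*) [CommRing A]
    (hf : Function.Surjective f) : Function.Surjective (f.baseChange A) :=
  LinearMap.lTensor_surjective A hf

theorem flatC : Module.Flat ℤ ℂ := inferInstance
theorem flatQ : Module.Flat ℤ ℚ := inferInstance

end maps

end Extension

/-! ### Mixed Hodge structures -/

section Graded

variable {M : Type*} [AddCommGroup M] [Module ℂ M] (W : ℤ → Submodule ℂ M)

/-- The graded piece `W_k / W_{k-1}`. -/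
abbrev Gr (k : ℤ) : Type _ := ↥(W k) ⧸ (W (k - 1)).submoduleOf (W k)

/-- The subspace of `W_k / W_{k-1}` induced by a subspace `U`, i.e. the image of `U ∩ W_k`. -/
def grSub (U : Submodule ℂ M) (k : ℤ) : Submodule ℂ (Gr W k) :=
  (U.submoduleOf (W k)).map ((W (k - 1)).submoduleOf (W k)).mkQ

variable {W}

theorem mem_grSub {U : Submodule ℂ M} {k : ℤ} (x : W k) :
    ((W (k - 1)).submoduleOf (W k)).mkQ x ∈ grSub W U k ↔
      ∃ u : W k, u.1 ∈ U ∧ x.1 - u.1 ∈ W (k - 1) := by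
  constructor
  · rintro ⟨u, hu, e⟩
    exact ⟨u, hu, (Submodule.Quotient.eq ((W (k - 1)).submoduleOf (W k))).1 e.symm⟩
  · rintro ⟨u, hu, e⟩
    exact ⟨u, hu, ((Submodule.Quotient.eq ((W (k - 1)).submoduleOf (W k))).2 e).symm⟩

theorem grSub_disjoint {U V : Submodule ℂ M} {k : ℤ} :
    grSub W U k ⊓ grSub W V k = ⊥ ↔ ∀ u v, u ∈ U → u ∈ W k → v ∈ V → v ∈ W k →
      u - v ∈ W (k - 1) → u ∈ W (k - 1) := by
  rw [← le_bot_iff]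
  constructor
  · intro h u v hu hu' hv hv' huv
    have : ((W (k - 1)).submoduleOf (W k)).mkQ ⟨u, hu'⟩ ∈ grSub W U k ⊓ grSub W V k :=
      ⟨⟨⟨u, hu'⟩, hu, rfl⟩, (mem_grSub _).2 ⟨⟨v, hv'⟩, hv, huv⟩⟩
    exact (Submodule.Quotient.mk_eq_zero ((W (k - 1)).submoduleOf (W k))).1 (h this)
  · rintro h _ ⟨⟨⟨u, hu'⟩, hu, rfl⟩, hv⟩
    obtain ⟨v, hv, huv⟩ := (mem_grSub ⟨u, hu'⟩).1 hv
    exact (Submodule.Quotient.mk_eq_zero ((W (k - 1)).submoduleOf (W k))).2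
      (h u v hu hu' hv v.2 huv)

theorem grSub_span {U V : Submodule ℂ M} {k : ℤ} :
    grSub W U k ⊔ grSub W V k = ⊤ ↔ ∀ x ∈ W k,
    ∃ u v w, u ∈ U ∧ u ∈ W k ∧ v ∈ V ∧ v ∈ W k ∧ w ∈ W (k - 1) ∧ x = u + v + w := by
  rw [← top_le_iff, grSub, grSub, ← Submodule.map_sup]
  constructor
  · intro h x hx
    obtain ⟨y, hy, e⟩ := h (x := ((W (k - 1)).submoduleOf (W k)).mkQ ⟨x, hx⟩) Submodule.mem_top
    obtain ⟨u, hu, v, hv, rfl⟩ := Submodule.mem_sup.1 hy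
    have e' : x - (u.1 + v.1) ∈ W (k - 1) :=
      (Submodule.Quotient.eq ((W (k - 1)).submoduleOf (W k))).1 e.symm
    exact ⟨u, v, _, hu, u.2, hv, v.2, e', by abel⟩
  · intro h x _
    obtain ⟨⟨x, hx⟩, rfl⟩ := Submodule.mkQ_surjective _ x
    obtain ⟨u, v, w, hu, hu', hv, hv', hw, rfl⟩ := h x hx
    refine ⟨⟨u, hu'⟩ + ⟨v, hv'⟩, Submodule.add_mem_sup hu hv, Eq.symm ?_⟩
    refine (Submodule.Quotient.eq ((W (k - 1)).submoduleOf (W k))).2 ?_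
    change u + v + w - (u + v) ∈ W (k - 1)
    rwa [add_sub_cancel_left]

end Graded

/-- A (Deligne) mixed Hodge structure: a finitely generated abelian group `H`, a finite increasing
filtration `W` of `H_ℚ` (weight) and a finite decreasing filtration `F` of `H_ℂ` (Hodge) such that,
for every `k`, the filtration induced by `F` on `gr^W_k H_ℂ` is `k`-opposed to its complex
conjugate, i.e. defines a pure Hodge structure of weight `k`. -/
structure MHS : Type (u + 1) where
  carrier : Type u
  [addCommGroup : AddCommGroup carrier]
  [finite : Module.Finite ℤ carrier]
  W : ℤ → Submodule ℚ (ℚ ⊗[ℤ] carrier)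
  F : ℤ → Submodule ℂ (ℂ ⊗[ℤ] carrier)
  monotone_W : Monotone W
  antitone_F : Antitone F
  exists_W_bot : ∃ a, W a = ⊥
  exists_W_top : ∃ a, W a = ⊤
  exists_F_top : ∃ a, F a = ⊤
  exists_F_bot : ∃ a, F a = ⊥
  pure : ∀ p q k : ℤ, p + q = k + 1 →
    IsCompl (grSub (fun m => complexify (W m)) (F p) k)
      (grSub (fun m => complexify (W m)) (conjSub (F q)) k)

attribute [instance] MHS.addCommGroup MHS.finite

namespace MHS

/-- The complex weight filtration `W_k H_ℂ`. -/
noncomputable def WC (A : MHS.{u}) (k : ℤ) : Submodule ℂ (ℂ ⊗[ℤ] A.carrier) := complexify (A.W k)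

/-- The conjugate of the Hodge filtration. -/
noncomputable def Fbar (A : MHS.{u}) (q : ℤ) : Submodule ℂ (ℂ ⊗[ℤ] A.carrier) := conjSub (A.F q)

/-- The component `H^{p,q} = F^p ∩ conj F^q` of `gr^W_{p+q} H_ℂ`. -/
noncomputable def hodgePiece (A : MHS.{u}) (p q : ℤ) : Submodule ℂ (Gr A.WC (p + q)) :=
  grSub A.WC (A.F p) (p + q) ⊓ grSub A.WC (A.Fbar q) (p + q)

/-- `A` is of level `≤ n`: its Hodge types `(p, q)` all satisfy `0 ≤ p, q ≤ n`. -/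
def IsOfLevel (A : MHS.{u}) (n : ℕ) : Prop :=
  ∀ p q : ℤ, A.hodgePiece p q ≠ ⊥ → (0 ≤ p ∧ p ≤ n) ∧ (0 ≤ q ∧ q ≤ n)

theorem opposed (A : MHS.{u}) : Opposed A.WC A.F A.Fbar where
  monoW _ _ h := complexify_mono (A.monotone_W h)
  antiF := A.antitone_F
  antiG _ _ h _ hx := A.antitone_F h hx
  botW := A.exists_W_bot.imp fun a ha => by rw [WC, ha, complexify_bot]
  topW := A.exists_W_top.imp fun a ha => by rw [WC, ha, complexify_top]
  topF := A.exists_F_top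
  botF := A.exists_F_bot
  topG := A.exists_F_top.imp fun a ha => by ext; simp [Fbar, ha]
  botG := A.exists_F_bot.imp fun a ha => by
    ext x
    simp only [Fbar, ha, mem_conjSub, Submodule.mem_bot]
    exact ⟨fun h => by rw [← conjC_conjC x, h, map_zero], fun h => by rw [h, map_zero]⟩
  span p q k h := grSub_span.1
    (codisjoint_iff.1 (A.pure p q k h).codisjoint)
  inter p q k h := grSub_disjoint.1 (disjoint_iff.1 (A.pure p q k h).disjoint)

theorem isOfLevel_iff (A : MHS.{u}) (n : ℕ) : A.IsOfLevel n ↔ ∀ p q k : ℤ, p + q = k →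
    ¬ ((0 ≤ p ∧ p ≤ n) ∧ (0 ≤ q ∧ q ≤ n)) → ∀ u v, u ∈ A.F p → u ∈ A.WC k →
      v ∈ A.Fbar q → v ∈ A.WC k → u - v ∈ A.WC (k - 1) → u ∈ A.WC (k - 1) := by
  constructor
  · rintro h p q _ rfl hn
    exact grSub_disjoint.1 (by_contra fun h' => hn (h p q h'))
  · intro h p q hpq
    by_contra hn
    exact hpq (grSub_disjoint.2 (h p q _ rfl hn))

/-- Construct a mixed Hodge structure from three opposed filtrations. -/
def mk' (H : Type u) [AddCommGroup H] [Module.Finite ℤ H] (W : ℤ → Submodule ℚ (ℚ ⊗[ℤ] H))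
    (F : ℤ → Submodule ℂ (ℂ ⊗[ℤ] H))
    (h : Opposed (fun k => complexify (W k)) F (fun k => conjSub (F k))) : MHS.{u} where
  carrier := H
  W := W
  F := F
  monotone_W _ _ hab x hx :=
    ratToComplex_mem_complexify.1 (h.monoW hab (ratToComplex_mem_complexify.2 hx))
  antitone_F := h.antiF
  exists_W_bot := h.botW.imp fun a ha => le_bot_iff.1 fun x hx => by
    have : ratToComplex H x ∈ complexify (W a) := ratToComplex_mem_complexify.2 hx
    have ha : complexify (W a) = ⊥ := ha
    rw [ha, ← complexify_bot] at this
    exact ratToComplex_mem_complexify.1 this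
  exists_W_top := h.topW.imp fun a ha => top_le_iff.1 fun x _ =>
    ratToComplex_mem_complexify.1 (by
      have : complexify (W a) = ⊤ := ha
      rw [this]; exact Submodule.mem_top)
  exists_F_top := h.topF
  exists_F_bot := h.botF
  pure p q k hk := ⟨disjoint_iff.2 (grSub_disjoint.2 (h.inter p q k hk)),
    codisjoint_iff.2 (grSub_span.2 (h.span p q k hk))⟩

/-- A morphism of mixed Hodge structures: a homomorphism compatible with both filtrations. -/
@[ext]
structure Hom (A B : MHS.{u}) where
  toLin : A.carrier →ₗ[ℤ] B.carrier
  map_W : ∀ k, ∀ x ∈ A.W k, toLin.baseChange ℚ x ∈ B.W k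
  map_F : ∀ p, ∀ x ∈ A.F p, toLin.baseChange ℂ x ∈ B.F p

instance : Category MHS.{u} where
  Hom := Hom
  id A := ⟨LinearMap.id, by simp, by simp⟩
  comp f g := ⟨g.toLin ∘ₗ f.toLin,
    fun k x hx => by simpa [LinearMap.baseChange_comp] using g.map_W k _ (f.map_W k x hx),
    fun k x hx => by simpa [LinearMap.baseChange_comp] using g.map_F k _ (f.map_F k x hx)⟩

variable {A B C X : MHS.{u}}

@[ext] theorem hom_ext {f g : A ⟶ B} (h : f.toLin = g.toLin) : f = g := Hom.ext h

@[simp] theorem id_toLin : Hom.toLin (𝟙 A) = LinearMap.id := rfl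
@[simp] theorem comp_toLin (f : A ⟶ B) (g : B ⟶ C) : (f ≫ g).toLin = g.toLin ∘ₗ f.toLin := rfl

instance : Zero (A ⟶ B) := ⟨⟨0, by simp, by simp⟩⟩
instance : Add (A ⟶ B) := ⟨fun f g => ⟨f.toLin + g.toLin,
  fun k x hx => by
    rw [LinearMap.baseChange_add]; exact add_mem (f.map_W k x hx) (g.map_W k x hx),
  fun k x hx => by
    rw [LinearMap.baseChange_add]; exact add_mem (f.map_F k x hx) (g.map_F k x hx)⟩⟩
instance : Neg (A ⟶ B) := ⟨fun f => ⟨-f.toLin,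
  fun k x hx => by
    rw [LinearMap.baseChange_neg]; exact neg_mem (f.map_W k x hx),
  fun k x hx => by
    rw [LinearMap.baseChange_neg]; exact neg_mem (f.map_F k x hx)⟩⟩

@[simp] theorem zero_toLin : Hom.toLin (0 : A ⟶ B) = 0 := rfl
@[simp] theorem add_toLin (f g : A ⟶ B) : (f + g).toLin = f.toLin + g.toLin := rfl
@[simp] theorem neg_toLin (f : A ⟶ B) : (-f).toLin = -f.toLin := rfl

instance : AddCommGroup (A ⟶ B) where
  add_assoc f g h := hom_ext (add_assoc _ _ _)
  zero_add f := hom_ext (zero_add _)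
  add_zero f := hom_ext (add_zero _)
  neg_add_cancel f := hom_ext (neg_add_cancel _)
  add_comm f g := hom_ext (add_comm _ _)
  nsmul := nsmulRec
  zsmul := zsmulRec

instance : Preadditive MHS.{u} where
  add_comp _ _ _ f f' g := by ext; simp
  comp_add _ _ _ f g g' := by ext; simp

/-- The induced map `H_ℂ → H'_ℂ`. -/
noncomputable def Hom.toC (f : A ⟶ B) : ℂ ⊗[ℤ] A.carrier →ₗ[ℂ] ℂ ⊗[ℤ] B.carrier :=
  f.toLin.baseChange ℂ

@[simp] theorem id_toC : Hom.toC (𝟙 A) = LinearMap.id := by simp [Hom.toC]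
theorem comp_toC (f : A ⟶ B) (g : B ⟶ C) : Hom.toC (f ≫ g) = Hom.toC g ∘ₗ Hom.toC f := by
  simp [Hom.toC, LinearMap.baseChange_comp]

theorem map_WC (f : A ⟶ B) (k : ℤ) (x : ℂ ⊗[ℤ] A.carrier) (hx : x ∈ A.WC k) :
    Hom.toC f x ∈ B.WC k := by
  have : A.WC k ≤ (B.WC k).comap (Hom.toC f) := by
    refine (complexify_mono (V := (B.W k).comap (f.toLin.baseChange ℚ)) (f.map_W k)).trans ?_
    rw [complexify_comap]; rfl
  exact this hx

theorem map_Fbar (f : A ⟶ B) (k : ℤ) (x : ℂ ⊗[ℤ] A.carrier) (hx : x ∈ A.Fbar k) :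
    Hom.toC f x ∈ B.Fbar k := by
  have := f.map_F k _ hx
  rwa [baseChange_conjC] at this

theorem toC_injective (f : A ⟶ B) (hf : Function.Injective f.toLin) :
    Function.Injective (Hom.toC f) := baseChange_injective ℂ flatC hf

theorem W_of_injective (f : A ⟶ B) (hf : Function.Injective f.toLin) (k : ℤ)
    (x : ℚ ⊗[ℤ] A.carrier) (hx : f.toLin.baseChange ℚ x ∈ B.W k) : x ∈ A.W k := by
  have h1 : Hom.toC f (ratToComplex _ x) ∈ B.WC k := by
    rw [Hom.toC, baseChange_ratToComplex]; exact ratToComplex_mem_complexify.2 hx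
  obtain ⟨a, ha, e⟩ := Opposed.strictW (Hom.toC f) A.opposed B.opposed (map_WC f) f.map_F
    (map_Fbar f) k _ h1
  exact ratToComplex_mem_complexify.1 (toC_injective f hf e ▸ ha)

theorem F_of_injective (f : A ⟶ B) (hf : Function.Injective f.toLin) (k : ℤ)
    (x : ℂ ⊗[ℤ] A.carrier) (hx : Hom.toC f x ∈ B.F k) : x ∈ A.F k := by
  obtain ⟨a, ha, e⟩ := Opposed.strictF' (Hom.toC f) A.opposed B.opposed (map_WC f) f.map_F
    (map_Fbar f) k _ hx
  exact toC_injective f hf e ▸ ha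

theorem F_of_surjective (f : A ⟶ B) (hf : Function.Surjective f.toLin) (k : ℤ)
    (y : ℂ ⊗[ℤ] B.carrier) (hy : y ∈ B.F k) : ∃ x ∈ A.F k, Hom.toC f x = y := by
  obtain ⟨y, rfl⟩ := baseChange_surjective ℂ hf y
  exact Opposed.strictF' (Hom.toC f) A.opposed B.opposed (map_WC f) f.map_F
    (map_Fbar f) k _ hy

theorem W_of_surjective (f : A ⟶ B) (hf : Function.Surjective f.toLin) (k : ℤ)
    (y : ℚ ⊗[ℤ] B.carrier) (hy : y ∈ B.W k) : ∃ x ∈ A.W k, f.toLin.baseChange ℚ x = y := by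
  obtain ⟨y, rfl⟩ := baseChange_surjective ℚ hf y
  have h1 : Hom.toC f (ratToComplex _ y) ∈ B.WC k := by
    rw [Hom.toC, baseChange_ratToComplex]; exact ratToComplex_mem_complexify.2 hy
  obtain ⟨a, ha, e⟩ := Opposed.strictW (Hom.toC f) A.opposed B.opposed (map_WC f) f.map_F
    (map_Fbar f) k _ h1
  have h2 : ratToComplex _ (f.toLin.baseChange ℚ y) ∈
      complexify ((A.W k).map (f.toLin.baseChange ℚ)) := by
    rw [complexify_map, ← baseChange_ratToComplex]; exact ⟨a, ha, e⟩
  exact ratToComplex_mem_complexify.1 h2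

/-- The kernel of a morphism, with the induced filtrations. -/
noncomputable def kernelObj (f : A ⟶ B) : MHS.{u} :=
  mk' (LinearMap.ker f.toLin)
    (fun k => (A.W k).comap ((LinearMap.ker f.toLin).subtype.baseChange ℚ))
    (fun p => (A.F p).comap ((LinearMap.ker f.toLin).subtype.baseChange ℂ)) (by
      simp only [complexify_comap, conjSub_comap]
      refine Opposed.ker (Hom.toC f) A.opposed B.opposed (map_WC f) f.map_F (map_Fbar f)
        ((LinearMap.ker f.toLin).subtype.baseChange ℂ)
        (baseChange_injective ℂ flatC (Submodule.subtype_injective _)) ?_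
      exact baseChange_exact ℂ flatC fun x => ⟨fun h => ⟨⟨x, h⟩, rfl⟩, by rintro ⟨y, rfl⟩; exact y.2⟩)

/-- The inclusion of the kernel. -/
noncomputable def kernelι (f : A ⟶ B) : kernelObj f ⟶ A :=
  ⟨(LinearMap.ker f.toLin).subtype, fun _ _ h => h, fun _ _ h => h⟩

/-- The cokernel of a morphism, with the quotient filtrations. -/
noncomputable def cokernelObj (f : A ⟶ B) : MHS.{u} :=
  mk' (B.carrier ⧸ LinearMap.range f.toLin)
    (fun k => (B.W k).map ((LinearMap.range f.toLin).mkQ.baseChange ℚ))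
    (fun p => (B.F p).map ((LinearMap.range f.toLin).mkQ.baseChange ℂ)) (by
      simp only [complexify_map, conjSub_map]
      refine Opposed.coker (Hom.toC f) A.opposed B.opposed (map_WC f) f.map_F (map_Fbar f)
        ((LinearMap.range f.toLin).mkQ.baseChange ℂ)
        (baseChange_surjective ℂ (Submodule.mkQ_surjective _)) ?_
      exact baseChange_exact ℂ flatC fun x => by simp)

/-- The projection onto the cokernel. -/
noncomputable def cokernelπ (f : A ⟶ B) : B ⟶ cokernelObj f :=
  ⟨(LinearMap.range f.toLin).mkQ, fun _ x h => ⟨x, h, rfl⟩, fun _ x h => ⟨x, h, rfl⟩⟩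

theorem mono_of_injective (f : A ⟶ B) (hf : Function.Injective f.toLin) : Mono f where
  right_cancellation g h e := by
    ext x
    exact hf (LinearMap.congr_fun (congrArg Hom.toLin e) x)

theorem epi_of_surjective (f : A ⟶ B) (hf : Function.Surjective f.toLin) : Epi f where
  left_cancellation g h e := by
    ext x
    obtain ⟨x, rfl⟩ := hf x
    exact LinearMap.congr_fun (congrArg Hom.toLin e) x

theorem injective_of_mono (f : A ⟶ B) [Mono f] : Function.Injective f.toLin := by
  have h : kernelι f = 0 := by
    rw [← cancel_mono f, zero_comp]
    ext x; exact x.2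
  refine (injective_iff_map_eq_zero _).2 fun x hx => ?_
  exact LinearMap.congr_fun (congrArg Hom.toLin h) ⟨x, hx⟩

theorem surjective_of_epi (f : A ⟶ B) [Epi f] : Function.Surjective f.toLin := by
  have h : cokernelπ f = 0 := by
    rw [← cancel_epi f, comp_zero]
    ext x
    exact (Submodule.Quotient.mk_eq_zero _).2 ⟨x, rfl⟩
  intro y
  exact (Submodule.Quotient.mk_eq_zero _).1 (LinearMap.congr_fun (congrArg Hom.toLin h) y)

theorem exists_lift (f : A ⟶ B) (hf : Function.Injective f.toLin) (k : X ⟶ B)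
    (hk : ∀ x, ∃ y, f.toLin y = k.toLin x) : ∃ l : X ⟶ A, l ≫ f = k := by
  let l := LinearMap.codRestrictOfInjective k.toLin f.toLin hf hk
  have hl : f.toLin ∘ₗ l = k.toLin := LinearMap.codRestrictOfInjective_comp _ _ _ _
  refine ⟨⟨l, fun m x hx => W_of_injective f hf m _ ?_, fun m x hx => F_of_injective f hf m _ ?_⟩,
    hom_ext hl⟩
  · rw [← LinearMap.comp_apply, ← LinearMap.baseChange_comp, hl]; exact k.map_W m x hx
  · rw [Hom.toC, ← LinearMap.comp_apply, ← LinearMap.baseChange_comp, hl]; exact k.map_F m x hx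

theorem exists_desc (g : B ⟶ C) (hg : Function.Surjective g.toLin) (k : B ⟶ X)
    (hk : ∀ x, g.toLin x = 0 → k.toLin x = 0) : ∃ l : C ⟶ X, g ≫ l = k := by
  let l := (LinearMap.ker g.toLin).liftQ k.toLin hk ∘ₗ
    (g.toLin.quotKerEquivOfSurjective hg).symm.toLinearMap
  have hl : l ∘ₗ g.toLin = k.toLin := by
    ext x
    have : (g.toLin.quotKerEquivOfSurjective hg).symm (g.toLin x) =
        (LinearMap.ker g.toLin).mkQ x := by
      rw [LinearEquiv.symm_apply_eq]; rfl
    change (LinearMap.ker g.toLin).liftQ k.toLin hk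
      ((g.toLin.quotKerEquivOfSurjective hg).symm (g.toLin x)) = _
    rw [this]; rfl
  refine ⟨⟨l, fun m x hx => ?_, fun m x hx => ?_⟩, hom_ext hl⟩
  · obtain ⟨y, hy, rfl⟩ := W_of_surjective g hg m x hx
    rw [← LinearMap.comp_apply, ← LinearMap.baseChange_comp, hl]; exact k.map_W m y hy
  · obtain ⟨y, hy, rfl⟩ := F_of_surjective g hg m x hx
    rw [Hom.toC, ← LinearMap.comp_apply, ← LinearMap.baseChange_comp, hl]; exact k.map_F m y hy

/-- An injection with image the kernel of `g` is a kernel of `g`. -/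
noncomputable def isKernel (f : A ⟶ B) (g : B ⟶ C) (w : f ≫ g = 0)
    (hf : Function.Injective f.toLin) (hex : ∀ x, g.toLin x = 0 → ∃ y, f.toLin y = x) :
    IsLimit (KernelFork.ofι f w) :=
  haveI := mono_of_injective f hf
  KernelFork.IsLimit.ofι' f w fun k hk =>
    let h := exists_lift f hf k fun x => hex _ (LinearMap.congr_fun (congrArg Hom.toLin hk) x)
    ⟨h.choose, h.choose_spec⟩

/-- A surjection with kernel the image of `f` is a cokernel of `f`. -/
noncomputable def isCokernel (f : A ⟶ B) (g : B ⟶ C) (w : f ≫ g = 0)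
    (hg : Function.Surjective g.toLin) (hex : ∀ x, g.toLin x = 0 → ∃ y, f.toLin y = x) :
    IsColimit (CokernelCofork.ofπ g w) :=
  haveI := epi_of_surjective g hg
  CokernelCofork.IsColimit.ofπ' g w fun k hk =>
    let h := exists_desc g hg k fun x hx => by
      obtain ⟨y, rfl⟩ := hex x hx
      exact LinearMap.congr_fun (congrArg Hom.toLin hk) y
    ⟨h.choose, h.choose_spec⟩

theorem kernelι_comp (f : A ⟶ B) : kernelι f ≫ f = 0 := by
  ext x; exact x.2

theorem comp_cokernelπ (f : A ⟶ B) : f ≫ cokernelπ f = 0 := by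
  ext x; exact (Submodule.Quotient.mk_eq_zero _).2 ⟨x, rfl⟩

instance : HasKernels MHS.{u} where
  has_limit f := ⟨⟨_, isKernel (kernelι f) f (kernelι_comp f) (Submodule.subtype_injective _)
    fun x hx => ⟨⟨x, hx⟩, rfl⟩⟩⟩

instance : HasCokernels MHS.{u} where
  has_colimit f := ⟨⟨_, isCokernel f (cokernelπ f) (comp_cokernelπ f)
    (Submodule.mkQ_surjective _) fun _ hx => (Submodule.Quotient.mk_eq_zero _).1 hx⟩⟩

instance : IsNormalMonoCategory MHS.{u} where
  normalMonoOfMono f _ := ⟨⟨_, cokernelπ f, comp_cokernelπ f,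
    isKernel _ _ _ (injective_of_mono f) fun _ hx => (Submodule.Quotient.mk_eq_zero _).1 hx⟩⟩

instance : IsNormalEpiCategory MHS.{u} where
  normalEpiOfEpi f _ := ⟨⟨_, kernelι f, kernelι_comp f,
    isCokernel _ _ _ (surjective_of_epi f) fun x hx => ⟨⟨x, hx⟩, rfl⟩⟩⟩

/-- The zero mixed Hodge structure. -/
noncomputable def zeroObj : MHS.{u} :=
  mk' PUnit (fun _ => ⊥) (fun _ => ⊥) (by
    have hs : ∀ x y : ℂ ⊗[ℤ] PUnit.{u + 1}, x = y := fun x y => by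
      have : ∀ x : ℂ ⊗[ℤ] PUnit.{u + 1}, x = 0 := fun x => by
        induction x with
        | zero => rfl
        | add x y hx hy => rw [hx, hy, add_zero]
        | tmul z x => rw [show x = 0 from rfl, TensorProduct.tmul_zero]
      rw [this x, this y]
    have ht : ∀ U : Submodule ℂ (ℂ ⊗[ℤ] PUnit.{u + 1}), U = ⊤ := fun U =>
      top_le_iff.1 fun x _ => by rw [hs x 0]; exact zero_mem _
    have hb : ∀ U : Submodule ℂ (ℂ ⊗[ℤ] PUnit.{u + 1}), U = ⊥ := fun U =>
      le_bot_iff.1 fun x _ => by rw [hs x 0]; exact zero_mem _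
    exact {
      monoW := fun a b _ => le_of_eq ((ht _).trans (ht _).symm)
      antiF := fun a b _ => le_of_eq ((ht _).trans (ht _).symm)
      antiG := fun a b _ => le_of_eq ((ht _).trans (ht _).symm)
      botW := ⟨0, hb _⟩
      topW := ⟨0, ht _⟩
      botF := ⟨0, hb _⟩
      topF := ⟨0, ht _⟩
      botG := ⟨0, hb _⟩
      topG := ⟨0, ht _⟩
      span := fun p q k _ x _ => ⟨0, 0, 0, zero_mem _, zero_mem _, zero_mem _, zero_mem _,
        zero_mem _, hs _ _⟩
      inter := fun p q k _ u v _ _ _ _ _ => by rw [hs u 0]; exact zero_mem _ })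

instance : HasZeroObject MHS.{u} where
  zero := ⟨zeroObj, {
    unique_to := fun X => ⟨⟨⟨0⟩, fun f => by
      ext x; rw [show x = 0 from rfl, map_zero, map_zero]⟩⟩
    unique_from := fun X => ⟨⟨⟨0⟩, fun f => by ext x; rfl⟩⟩ }⟩

theorem _root_.FormalHodge.Opposed.prod {R M N P : Type*} [Ring R] [AddCommGroup M] [Module R M]
    [AddCommGroup N] [Module R N] [AddCommGroup P] [Module R P]
    {W F G : ℤ → Submodule R M} {W' F' G' : ℤ → Submodule R N}
    (h : Opposed W F G) (h' : Opposed W' F' G') (p₁ : P →ₗ[R] M) (p₂ : P →ₗ[R] N)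
    (hp : Function.Bijective (p₁.prod p₂)) :
    Opposed (fun k => (W k).comap p₁ ⊓ (W' k).comap p₂)
      (fun k => (F k).comap p₁ ⊓ (F' k).comap p₂)
      (fun k => (G k).comap p₁ ⊓ (G' k).comap p₂) := by
  have bot : ∀ {U : ℤ → Submodule R M} {V : ℤ → Submodule R N} (c : ℤ), U c = ⊥ → V c = ⊥ →
      (U c).comap p₁ ⊓ (V c).comap p₂ = ⊥ := by
    intro U V c hU hV
    refine le_bot_iff.1 fun x hx => hp.1 ?_
    rw [hU, hV] at hx
    exact (Prod.ext hx.1 hx.2 : (p₁ x, p₂ x) = (0, 0)).trans (by simp)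
  have top : ∀ {U : ℤ → Submodule R M} {V : ℤ → Submodule R N} (c : ℤ), U c = ⊤ → V c = ⊤ →
      (U c).comap p₁ ⊓ (V c).comap p₂ = ⊤ := by
    intro U V c hU hV
    simp [hU, hV]
  have anti : ∀ {U : ℤ → Submodule R M} {V : ℤ → Submodule R N}, Antitone U → Antitone V →
      (∃ a, U a = ⊥) → (∃ a, V a = ⊥) → (∃ a, U a = ⊤) → (∃ a, V a = ⊤) →
      (∃ a, (U a).comap p₁ ⊓ (V a).comap p₂ = ⊥) ∧ (∃ a, (U a).comap p₁ ⊓ (V a).comap p₂ = ⊤) := by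
    rintro U V hU hV ⟨a, ha⟩ ⟨b, hb⟩ ⟨c, hc⟩ ⟨d, hd⟩
    exact ⟨⟨max a b, bot _ (le_bot_iff.1 (ha ▸ hU (le_max_left _ _)))
      (le_bot_iff.1 (hb ▸ hV (le_max_right _ _)))⟩, ⟨min c d, top _
      (top_le_iff.1 (hc ▸ hU (min_le_left _ _))) (top_le_iff.1 (hd ▸ hV (min_le_right _ _)))⟩⟩
  refine {
    monoW := fun a b hab => inf_le_inf (Submodule.comap_mono (h.monoW hab))
      (Submodule.comap_mono (h'.monoW hab))
    antiF := fun a b hab => inf_le_inf (Submodule.comap_mono (h.antiF hab))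
      (Submodule.comap_mono (h'.antiF hab))
    antiG := fun a b hab => inf_le_inf (Submodule.comap_mono (h.antiG hab))
      (Submodule.comap_mono (h'.antiG hab))
    botW := ?_
    topW := ?_
    botF := (anti h.antiF h'.antiF h.botF h'.botF h.topF h'.topF).1
    topF := (anti h.antiF h'.antiF h.botF h'.botF h.topF h'.topF).2
    botG := (anti h.antiG h'.antiG h.botG h'.botG h.topG h'.topG).1
    topG := (anti h.antiG h'.antiG h.botG h'.botG h.topG h'.topG).2
    span := ?_
    inter := ?_ }
  · obtain ⟨a, ha⟩ := h.botW
    obtain ⟨b, hb⟩ := h'.botW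
    exact ⟨min a b, bot _ (le_bot_iff.1 (ha ▸ h.monoW (min_le_left _ _)))
      (le_bot_iff.1 (hb ▸ h'.monoW (min_le_right _ _)))⟩
  · obtain ⟨a, ha⟩ := h.topW
    obtain ⟨b, hb⟩ := h'.topW
    exact ⟨max a b, top _ (top_le_iff.1 (ha ▸ h.monoW (le_max_left _ _)))
      (top_le_iff.1 (hb ▸ h'.monoW (le_max_right _ _)))⟩
  · rintro p q k hpq x ⟨hx, hx'⟩
    obtain ⟨u, v, w, hu, hu', hv, hv', hw, e⟩ := h.span p q k hpq _ hx
    obtain ⟨u2, v2, w2, hu2, hu2', hv2, hv2', hw2, e2⟩ := h'.span p q k hpq _ hx'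
    obtain ⟨a, ha⟩ := hp.2 (u, u2)
    obtain ⟨b, hb⟩ := hp.2 (v, v2)
    obtain ⟨c, hc⟩ := hp.2 (w, w2)
    have ha1 : p₁ a = u := congrArg Prod.fst ha
    have ha2 : p₂ a = u2 := congrArg Prod.snd ha
    have hb1 : p₁ b = v := congrArg Prod.fst hb
    have hb2 : p₂ b = v2 := congrArg Prod.snd hb
    have hc1 : p₁ c = w := congrArg Prod.fst hc
    have hc2 : p₂ c = w2 := congrArg Prod.snd hc
    subst ha1 ha2 hb1 hb2 hc1 hc2
    refine ⟨a, b, c, ⟨hu, hu2⟩, ⟨hu', hu2'⟩, ⟨hv, hv2⟩, ⟨hv', hv2'⟩, ⟨hw, hw2⟩, hp.1 ?_⟩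
    exact Prod.ext (by simpa using e) (by simpa using e2)
  · rintro p q k hpq u v ⟨hu1, hu2⟩ ⟨hu1', hu2'⟩ ⟨hv1, hv2⟩ ⟨hv1', hv2'⟩ ⟨huv1, huv2⟩
    exact ⟨h.inter p q k hpq _ _ hu1 hu1' hv1 hv1' (by simpa using huv1),
      h'.inter p q k hpq _ _ hu2 hu2' hv2 hv2' (by simpa using huv2)⟩

theorem baseChange_prod_bijective (R A B : Type*) [CommRing R] [AddCommGroup A] [AddCommGroup B] :
    Function.Bijective (((LinearMap.fst ℤ A B).baseChange R).prod
      ((LinearMap.snd ℤ A B).baseChange R)) := by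
  have h1 : ∀ x, (LinearMap.inl ℤ A B).baseChange R ((LinearMap.fst ℤ A B).baseChange R x) +
      (LinearMap.inr ℤ A B).baseChange R ((LinearMap.snd ℤ A B).baseChange R x) = x := by
    intro x
    induction x with
    | zero => simp
    | add x y hx hy =>
      conv_rhs => rw [← hx, ← hy]
      simp only [map_add]; abel
    | tmul z x => simp [← TensorProduct.tmul_add]
  have h2 : ∀ a b, ((LinearMap.fst ℤ A B).baseChange R) ((LinearMap.inl ℤ A B).baseChange R a +
      (LinearMap.inr ℤ A B).baseChange R b) = a := by
    intro a b
    rw [map_add, ← LinearMap.comp_apply, ← LinearMap.baseChange_comp, ← LinearMap.comp_apply,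
      ← LinearMap.baseChange_comp]
    simp
  have h3 : ∀ a b, ((LinearMap.snd ℤ A B).baseChange R) ((LinearMap.inl ℤ A B).baseChange R a +
      (LinearMap.inr ℤ A B).baseChange R b) = b := by
    intro a b
    rw [map_add, ← LinearMap.comp_apply, ← LinearMap.baseChange_comp, ← LinearMap.comp_apply,
      ← LinearMap.baseChange_comp]
    simp
  constructor
  · intro x y e
    have e1 : (LinearMap.fst ℤ A B).baseChange R x = (LinearMap.fst ℤ A B).baseChange R y :=
      congrArg Prod.fst e
    have e2 : (LinearMap.snd ℤ A B).baseChange R x = (LinearMap.snd ℤ A B).baseChange R y :=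
      congrArg Prod.snd e
    rw [← h1 x, ← h1 y, e1, e2]
  · rintro ⟨a, b⟩
    exact ⟨_, Prod.ext (h2 a b) (h3 a b)⟩

/-- The direct sum of two mixed Hodge structures. -/
noncomputable def prodObj (A B : MHS.{u}) : MHS.{u} :=
  mk' (A.carrier × B.carrier)
    (fun k => (A.W k).comap ((LinearMap.fst ℤ _ _).baseChange ℚ) ⊓
      (B.W k).comap ((LinearMap.snd ℤ _ _).baseChange ℚ))
    (fun k => (A.F k).comap ((LinearMap.fst ℤ _ _).baseChange ℂ) ⊓
      (B.F k).comap ((LinearMap.snd ℤ _ _).baseChange ℂ)) (by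
    have := A.opposed.prod B.opposed _ _
      (baseChange_prod_bijective ℂ A.carrier B.carrier)
    have hG : ∀ k, conjSub ((A.F k).comap ((LinearMap.fst ℤ A.carrier B.carrier).baseChange ℂ) ⊓
        (B.F k).comap ((LinearMap.snd ℤ A.carrier B.carrier).baseChange ℂ)) =
        (A.Fbar k).comap ((LinearMap.fst ℤ A.carrier B.carrier).baseChange ℂ) ⊓
        (B.Fbar k).comap ((LinearMap.snd ℤ A.carrier B.carrier).baseChange ℂ) := fun k => by
      rw [Fbar, Fbar, ← conjSub_comap, ← conjSub_comap]; rfl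
    simp only [complexify_inf, complexify_comap, hG]
    exact this)

/-- The first projection. -/
noncomputable def fst (A B : MHS.{u}) : prodObj A B ⟶ A :=
  ⟨LinearMap.fst ℤ _ _, fun _ _ h => h.1, fun _ _ h => h.1⟩

/-- The second projection. -/
noncomputable def snd (A B : MHS.{u}) : prodObj A B ⟶ B :=
  ⟨LinearMap.snd ℤ _ _, fun _ _ h => h.2, fun _ _ h => h.2⟩

theorem baseChange_aux {R A B D : Type*} [CommRing R] [AddCommGroup A] [AddCommGroup B]
    [AddCommGroup D] (f : A →ₗ[ℤ] B) (g : B →ₗ[ℤ] D) (h : A →ₗ[ℤ] D) (e : g ∘ₗ f = h)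
    (x : R ⊗[ℤ] A) : g.baseChange R (f.baseChange R x) = h.baseChange R x := by
  rw [← e, LinearMap.baseChange_comp]; rfl

theorem inl_mem {R A B : Type*} [CommRing R] [AddCommGroup A] [AddCommGroup B]
    (U : Submodule R (R ⊗[ℤ] A)) (V : Submodule R (R ⊗[ℤ] B)) (x : R ⊗[ℤ] A) (hx : x ∈ U) :
    (LinearMap.inl ℤ A B).baseChange R x ∈ U.comap ((LinearMap.fst ℤ A B).baseChange R) ⊓
      V.comap ((LinearMap.snd ℤ A B).baseChange R) := by
  rw [Submodule.mem_inf, Submodule.mem_comap, Submodule.mem_comap,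
    baseChange_aux _ _ _ (LinearMap.fst_comp_inl ℤ A B),
    baseChange_aux _ _ _ (LinearMap.snd_comp_inl ℤ A B)]
  exact ⟨by simpa using hx, by simp⟩

theorem inr_mem {R A B : Type*} [CommRing R] [AddCommGroup A] [AddCommGroup B]
    (U : Submodule R (R ⊗[ℤ] A)) (V : Submodule R (R ⊗[ℤ] B)) (x : R ⊗[ℤ] B) (hx : x ∈ V) :
    (LinearMap.inr ℤ A B).baseChange R x ∈ U.comap ((LinearMap.fst ℤ A B).baseChange R) ⊓
      V.comap ((LinearMap.snd ℤ A B).baseChange R) := by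
  rw [Submodule.mem_inf, Submodule.mem_comap, Submodule.mem_comap,
    baseChange_aux _ _ _ (LinearMap.fst_comp_inr ℤ A B),
    baseChange_aux _ _ _ (LinearMap.snd_comp_inr ℤ A B)]
  exact ⟨by simp, by simpa using hx⟩

/-- The first inclusion. -/
noncomputable def inl (A B : MHS.{u}) : A ⟶ prodObj A B :=
  ⟨LinearMap.inl ℤ _ _, fun k x h => inl_mem (A.W k) (B.W k) x h,
    fun k x h => inl_mem (A.F k) (B.F k) x h⟩

/-- The second inclusion. -/
noncomputable def inr (A B : MHS.{u}) : B ⟶ prodObj A B :=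
  ⟨LinearMap.inr ℤ _ _, fun k x h => inr_mem (A.W k) (B.W k) x h,
    fun k x h => inr_mem (A.F k) (B.F k) x h⟩

theorem inl_fst (A B : MHS.{u}) : inl A B ≫ fst A B = 𝟙 A := hom_ext (LinearMap.fst_comp_inl _ _ _)
theorem inl_snd (A B : MHS.{u}) : inl A B ≫ snd A B = 0 := hom_ext (LinearMap.snd_comp_inl _ _ _)
theorem inr_fst (A B : MHS.{u}) : inr A B ≫ fst A B = 0 := hom_ext (LinearMap.fst_comp_inr _ _ _)
theorem inr_snd (A B : MHS.{u}) : inr A B ≫ snd A B = 𝟙 B := hom_ext (LinearMap.snd_comp_inr _ _ _)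

instance : HasBinaryBiproducts MHS.{u} where
  has_binary_biproduct A B := hasBinaryBiproduct_of_total
    { pt := prodObj A B
      fst := fst A B
      snd := snd A B
      inl := inl A B
      inr := inr A B
      inl_fst := inl_fst A B
      inl_snd := inl_snd A B
      inr_fst := inr_fst A B
      inr_snd := inr_snd A B }
    (hom_ext (LinearMap.ext fun x => Prod.ext (add_zero x.1) (zero_add x.2)))

instance : HasFiniteProducts MHS.{u} :=
  haveI : HasTerminal MHS.{u} := HasZeroObject.hasTerminal
  hasFiniteProducts_of_has_binary_and_terminal

noncomputable instance : Abelian MHS.{u} where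

instance : HasExt.{u + 1} MHS.{u} := HasExt.standard _


/-! ### Levels and quotients by the Hodge filtration -/

theorem WC_of_injective (f : A ⟶ B) (hf : Function.Injective f.toLin) (k : ℤ)
    (x : ℂ ⊗[ℤ] A.carrier) (hx : Hom.toC f x ∈ B.WC k) : x ∈ A.WC k := by
  obtain ⟨a, ha, e⟩ := Opposed.strictW (Hom.toC f) A.opposed B.opposed (map_WC f) f.map_F
    (map_Fbar f) k _ hx
  exact toC_injective f hf e ▸ ha

theorem IsOfLevel.of_injective {n : ℕ} (hB : B.IsOfLevel n) (f : A ⟶ B)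
    (hf : Function.Injective f.toLin) : A.IsOfLevel n := by
  rw [isOfLevel_iff] at hB ⊢
  intro p q k hpq hn u v hu hu' hv hv' huv
  refine WC_of_injective f hf _ _ (hB p q k hpq hn _ (Hom.toC f v) (f.map_F _ _ hu)
    (map_WC f _ _ hu') (map_Fbar f _ _ hv) (map_WC f _ _ hv') ?_)
  rw [← map_sub]
  exact map_WC f _ _ huv

theorem IsOfLevel.of_surjective {n : ℕ} (hA : A.IsOfLevel n) (g : A ⟶ B)
    (hg : Function.Surjective g.toLin) : B.IsOfLevel n := by
  rw [isOfLevel_iff] at hA ⊢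
  intro p q k hpq hn u v hu hu' hv hv' huv
  have hsurj : Function.Surjective (Hom.toC g) := baseChange_surjective ℂ hg
  have hex : ∀ x, Hom.toC g x = 0 ↔ ∃ y, Hom.toC (kernelι g) y = x :=
    baseChange_exact ℂ flatC fun x => ⟨fun h => ⟨⟨x, h⟩, rfl⟩, by rintro ⟨y, rfl⟩; exact y.2⟩
  have sW : ∀ (k : ℤ) (y : ℂ ⊗[ℤ] B.carrier), y ∈ B.WC k → y ∈ (A.WC k).map (Hom.toC g) := by
    intro k y hy
    obtain ⟨y, rfl⟩ := hsurj y
    exact Opposed.strictW (Hom.toC g) A.opposed B.opposed (map_WC g) g.map_F (map_Fbar g) k y hy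
  have sF : ∀ (k : ℤ) (y : ℂ ⊗[ℤ] B.carrier), y ∈ B.F k → y ∈ (A.F k).map (Hom.toC g) :=
    fun k y hy => F_of_surjective g hg k y hy
  have sG : ∀ (k : ℤ) (y : ℂ ⊗[ℤ] B.carrier), y ∈ B.Fbar k →
      y ∈ (A.Fbar k).map (Hom.toC g) := by
    intro k y hy
    obtain ⟨y, rfl⟩ := hsurj y
    exact Opposed.strictF' (Hom.toC g) A.opposed.swap B.opposed.swap (map_WC g) (map_Fbar g)
      g.map_F k y hy
  obtain ⟨u0, hu0, hu0', rfl⟩ := Opposed.coker_FW (Hom.toC (kernelι g)) (kernelObj g).opposed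
    A.opposed (map_WC _) (kernelι g).map_F (map_Fbar _) (Hom.toC g) hex p k u (sF _ _ hu)
    (sW _ _ hu')
  obtain ⟨v0, hv0, hv0', rfl⟩ := Opposed.coker_FW (Hom.toC (kernelι g)) (kernelObj g).opposed.swap
    A.opposed.swap (map_WC _) (map_Fbar _) (kernelι g).map_F (Hom.toC g) hex q k v (sG _ _ hv)
    (sW _ _ hv')
  obtain ⟨w, hw, e⟩ := sW _ _ huv
  obtain ⟨y, hy, e⟩ := Opposed.coker_aux (Hom.toC (kernelι g)) (kernelObj g).opposed A.opposed
    (map_WC _) (kernelι g).map_F (map_Fbar _) (Hom.toC g) hex p (q + 1) k (by omega) q (by omega)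
    (hA p q k hpq hn) u0 v0 hu0 hu0' hv0 hv0' w hw (by rw [map_sub, e])
  exact e ▸ map_WC g _ _ hy

theorem IsOfLevel.prodObj {n : ℕ} (hA : A.IsOfLevel n) (hB : B.IsOfLevel n) :
    (prodObj A B).IsOfLevel n := by
  rw [isOfLevel_iff] at hA hB ⊢
  intro p q k hpq hn u v hu hu' hv hv' huv
  have h1 := hA p q k hpq hn _ (Hom.toC (fst A B) v) ((fst A B).map_F _ _ hu)
    (map_WC (fst A B) _ _ hu') (map_Fbar (fst A B) _ _ hv) (map_WC (fst A B) _ _ hv')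
    (by have := map_WC (fst A B) _ _ huv
        rwa [map_sub] at this)
  have h2 := hB p q k hpq hn _ (Hom.toC (snd A B) v) ((snd A B).map_F _ _ hu)
    (map_WC (snd A B) _ _ hu') (map_Fbar (snd A B) _ _ hv) (map_WC (snd A B) _ _ hv')
    (by have := map_WC (snd A B) _ _ huv
        rwa [map_sub] at this)
  have : (MHS.prodObj A B).WC (k - 1) = (A.WC (k - 1)).comap (Hom.toC (fst A B)) ⊓
      (B.WC (k - 1)).comap (Hom.toC (snd A B)) := by
    have key : ∀ (U : Submodule ℚ (ℚ ⊗[ℤ] A.carrier)) (V : Submodule ℚ (ℚ ⊗[ℤ] B.carrier)),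
        complexify (U.comap ((LinearMap.fst ℤ A.carrier B.carrier).baseChange ℚ) ⊓
          V.comap ((LinearMap.snd ℤ A.carrier B.carrier).baseChange ℚ)) =
        (complexify U).comap ((LinearMap.fst ℤ A.carrier B.carrier).baseChange ℂ) ⊓
          (complexify V).comap ((LinearMap.snd ℤ A.carrier B.carrier).baseChange ℂ) :=
      fun U V => by rw [complexify_inf, complexify_comap, complexify_comap]
    exact key _ _
  rw [this]
  exact ⟨h1, h2⟩

theorem isOfLevel_zeroObj (n : ℕ) : zeroObj.{u}.IsOfLevel n := by
  rw [isOfLevel_iff]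
  intro p q k _ _ u v hu _ _ _ _
  have hu : u = 0 := hu
  rw [hu]; exact zero_mem _

/-- The quotient `H_ℂ / F^p`. -/
abbrev HodgeQuot (A : MHS.{u}) (p : ℤ) : Type u := (ℂ ⊗[ℤ] A.carrier) ⧸ A.F p

/-- The canonical map `H → H_ℂ / F^p`. -/
noncomputable def toHodgeQuot (A : MHS.{u}) (p : ℤ) : A.carrier →+ A.HodgeQuot p :=
  (A.F p).mkQ.toAddMonoidHom.comp (TensorProduct.mk ℤ ℂ A.carrier 1).toAddMonoidHom

/-- The canonical projection `H_ℂ / F^p → H_ℂ / F^q` for `q ≤ p`. -/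
noncomputable def hodgeProj (A : MHS.{u}) {q p : ℤ} (h : q ≤ p) :
    A.HodgeQuot p →ₗ[ℂ] A.HodgeQuot q :=
  (A.F p).mapQ (A.F q) LinearMap.id (A.antitone_F h)

/-- The map `H_ℂ / F^p → H'_ℂ / F^p` induced by a morphism. -/
noncomputable def Hom.quot (f : A ⟶ B) (p : ℤ) : A.HodgeQuot p →ₗ[ℂ] B.HodgeQuot p :=
  (A.F p).mapQ (B.F p) (Hom.toC f) (f.map_F p)

theorem quot_id (p : ℤ) (x : A.HodgeQuot p) : Hom.quot (𝟙 A) p x = x := by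
  obtain ⟨x, rfl⟩ := Submodule.mkQ_surjective _ x
  simp [Hom.quot]

theorem quot_comp (f : A ⟶ B) (g : B ⟶ C) (p : ℤ) (x : A.HodgeQuot p) :
    Hom.quot (f ≫ g) p x = Hom.quot g p (Hom.quot f p x) := by
  obtain ⟨x, rfl⟩ := Submodule.mkQ_surjective _ x
  change (C.F p).mkQ (Hom.toC (f ≫ g) x) = (C.F p).mkQ (Hom.toC g (Hom.toC f x))
  rw [comp_toC]; rfl

theorem quot_zero (p : ℤ) (x : A.HodgeQuot p) : Hom.quot (0 : A ⟶ B) p x = 0 := by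
  obtain ⟨x, rfl⟩ := Submodule.mkQ_surjective _ x
  simp [Hom.quot, Hom.toC]

theorem quot_add (f g : A ⟶ B) (p : ℤ) (x : A.HodgeQuot p) :
    Hom.quot (f + g) p x = Hom.quot f p x + Hom.quot g p x := by
  obtain ⟨x, rfl⟩ := Submodule.mkQ_surjective _ x
  simp [Hom.quot, Hom.toC, LinearMap.baseChange_add]

theorem quot_neg (f : A ⟶ B) (p : ℤ) (x : A.HodgeQuot p) :
    Hom.quot (-f) p x = -Hom.quot f p x := by
  obtain ⟨x, rfl⟩ := Submodule.mkQ_surjective _ x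
  simp [Hom.quot, Hom.toC, LinearMap.baseChange_neg]

theorem quot_toHodgeQuot (f : A ⟶ B) (p : ℤ) (x : A.carrier) :
    Hom.quot f p (A.toHodgeQuot p x) = B.toHodgeQuot p (f.toLin x) := by
  change (B.F p).mkQ (f.toLin.baseChange ℂ (1 ⊗ₜ x)) = (B.F p).mkQ (1 ⊗ₜ f.toLin x)
  simp

theorem quot_hodgeProj (f : A ⟶ B) {q p : ℤ} (h : q ≤ p) (x : A.HodgeQuot p) :
    Hom.quot f q (A.hodgeProj h x) = B.hodgeProj h (Hom.quot f p x) := by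
  obtain ⟨x, rfl⟩ := Submodule.mkQ_surjective _ x
  rfl

theorem hodgeProj_toHodgeQuot {q p : ℤ} (h : q ≤ p) (x : A.carrier) :
    A.hodgeProj h (A.toHodgeQuot p x) = A.toHodgeQuot q x := rfl

theorem quot_injective (f : A ⟶ B) (hf : Function.Injective f.toLin) (p : ℤ) :
    Function.Injective (Hom.quot f p) := by
  refine (injective_iff_map_eq_zero _).2 fun x hx => ?_
  obtain ⟨x, rfl⟩ := Submodule.mkQ_surjective _ x
  exact (Submodule.Quotient.mk_eq_zero _).2
    (F_of_injective f hf p x ((Submodule.Quotient.mk_eq_zero _).1 hx))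

theorem quot_surjective (f : A ⟶ B) (hf : Function.Surjective f.toLin) (p : ℤ) :
    Function.Surjective (Hom.quot f p) := by
  intro y
  obtain ⟨y, rfl⟩ := Submodule.mkQ_surjective _ y
  obtain ⟨x, rfl⟩ := baseChange_surjective ℂ hf y
  exact ⟨(A.F p).mkQ x, rfl⟩

theorem kernelι_injective (f : A ⟶ B) : Function.Injective (kernelι f).toLin :=
  Submodule.subtype_injective _

theorem quot_exact (f : A ⟶ B) (p : ℤ) (x : A.HodgeQuot p) (hx : Hom.quot f p x = 0) :
    ∃ y, Hom.quot (kernelι f) p y = x := by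
  obtain ⟨x, rfl⟩ := Submodule.mkQ_surjective _ x
  obtain ⟨a, ha, e⟩ := Opposed.strictF' (Hom.toC f) A.opposed B.opposed (map_WC f) f.map_F
    (map_Fbar f) p x ((Submodule.Quotient.mk_eq_zero _).1 hx)
  obtain ⟨y, hy⟩ := (baseChange_exact (f := (kernelι f).toLin) (g := f.toLin) ℂ flatC
    (fun x => ⟨fun h => ⟨⟨x, h⟩, rfl⟩, by rintro ⟨y, rfl⟩; exact y.2⟩) (x - a)).1
    (by rw [map_sub]; exact sub_eq_zero.2 e.symm)
  refine ⟨((kernelObj f).F p).mkQ y, ?_⟩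
  change (A.F p).mkQ ((kernelι f).toLin.baseChange ℂ y) = _
  rw [hy, map_sub, sub_eq_self]
  exact (Submodule.Quotient.mk_eq_zero _).2 ha

end MHS

/-! ### Formal Hodge structures -/

/-- The largest index of `Fin n`. -/
def topIdx (n : ℕ) [NeZero n] : Fin n := ⟨n - 1, Nat.sub_one_lt (NeZero.ne n)⟩

/-- A formal Hodge structure `(H, V, h, π)` of level `≤ n`, for `n > 0`. The formal group is
`H = H^o × H_et` with `H^o = conn` and `H_et = et`. The index `i : Fin n` stands for `i + 1`, so
`V i` is the space `V_{i+1}` and `V (topIdx n)` is `V_n`. -/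
structure FHS (n : ℕ) [NeZero n] : Type (u + 1) where
  et : MHS.{u}
  level : et.IsOfLevel n
  conn : Type u
  [connGroup : AddCommGroup conn]
  [connModule : Module ℂ conn]
  [connFinite : FiniteDimensional ℂ conn]
  V : Fin n → Type u
  [VGroup : ∀ i, AddCommGroup (V i)]
  [VModule : ∀ i, Module ℂ (V i)]
  [VFinite : ∀ i, FiniteDimensional ℂ (V i)]
  /-- the maps `V_{i+1} → V_i` -/
  v : ∀ i j : Fin n, i.1 = j.1 + 1 → (V i →ₗ[ℂ] V j)
  hEt : et.carrier →+ V (topIdx n)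
  hConn : conn →ₗ[ℂ] V (topIdx n)
  π : ∀ i : Fin n, V i →ₗ[ℂ] et.HodgeQuot (i.1 + 1)
  π_hEt : ∀ x, π (topIdx n) (hEt x) = et.toHodgeQuot _ x
  π_v : ∀ (i j : Fin n) (h : i.1 = j.1 + 1) (x : V i),
    π j (v i j h x) = et.hodgeProj (by omega) (π i x)

attribute [instance] FHS.connGroup FHS.connModule FHS.connFinite FHS.VGroup FHS.VModule
  FHS.VFinite

namespace FHS

variable {n : ℕ} [NeZero n]

/-- A morphism of formal Hodge structures. -/
@[ext]
structure Hom (X Y : FHS.{u} n) where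
  et : X.et ⟶ Y.et
  conn : X.conn →ₗ[ℂ] Y.conn
  V : ∀ i, X.V i →ₗ[ℂ] Y.V i
  comm_v : ∀ (i j : Fin n) (h : i.1 = j.1 + 1) (x : X.V i), V j (X.v i j h x) = Y.v i j h (V i x)
  comm_hEt : ∀ x, V (topIdx n) (X.hEt x) = Y.hEt (et.toLin x)
  comm_hConn : ∀ x, V (topIdx n) (X.hConn x) = Y.hConn (conn x)
  comm_π : ∀ i x, Y.π i (V i x) = MHS.Hom.quot et _ (X.π i x)

instance : Category (FHS.{u} n) where
  Hom := Hom
  id X :=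
    { et := 𝟙 _
      conn := LinearMap.id
      V := fun _ => LinearMap.id
      comm_v := fun _ _ _ _ => rfl
      comm_hEt := fun _ => rfl
      comm_hConn := fun _ => rfl
      comm_π := fun _ _ => (MHS.quot_id _ _).symm }
  comp f g :=
    { et := f.et ≫ g.et
      conn := g.conn ∘ₗ f.conn
      V := fun i => g.V i ∘ₗ f.V i
      comm_v := fun i j h x => by simp [f.comm_v i j h, g.comm_v i j h]
      comm_hEt := fun x => by simp [f.comm_hEt, g.comm_hEt]
      comm_hConn := fun x => by simp [f.comm_hConn, g.comm_hConn]
      comm_π := fun i x => by simp [f.comm_π, g.comm_π, MHS.quot_comp] }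

variable {X Y Z T : FHS.{u} n}

@[ext] theorem hom_ext {f g : X ⟶ Y} (h₁ : f.et = g.et) (h₂ : f.conn = g.conn)
    (h₃ : ∀ i, f.V i = g.V i) : f = g := Hom.ext h₁ h₂ (funext h₃)

@[simp] theorem id_et : Hom.et (𝟙 X) = 𝟙 _ := rfl
@[simp] theorem id_conn : Hom.conn (𝟙 X) = LinearMap.id := rfl
@[simp] theorem id_V (i : Fin n) : Hom.V (𝟙 X) i = LinearMap.id := rfl
@[simp] theorem comp_et (f : X ⟶ Y) (g : Y ⟶ Z) : (f ≫ g).et = f.et ≫ g.et := rfl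
@[simp] theorem comp_conn (f : X ⟶ Y) (g : Y ⟶ Z) : (f ≫ g).conn = g.conn ∘ₗ f.conn := rfl
@[simp] theorem comp_V (f : X ⟶ Y) (g : Y ⟶ Z) (i : Fin n) : (f ≫ g).V i = g.V i ∘ₗ f.V i := rfl

instance : Zero (X ⟶ Y) := ⟨
    { et := 0
      conn := 0
      V := fun _ => 0
      comm_v := fun _ _ _ _ => by simp
      comm_hEt := fun _ => by simp
      comm_hConn := fun _ => by simp
      comm_π := fun _ _ => by simp [MHS.quot_zero] }⟩
instance : Add (X ⟶ Y) := ⟨fun f g =>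
    { et := f.et + g.et
      conn := f.conn + g.conn
      V := fun i => f.V i + g.V i
      comm_v := fun i j h x => by simp [f.comm_v i j h, g.comm_v i j h]
      comm_hEt := fun x => by simp [f.comm_hEt, g.comm_hEt]
      comm_hConn := fun x => by simp [f.comm_hConn, g.comm_hConn]
      comm_π := fun i x => by simp [f.comm_π, g.comm_π, MHS.quot_add] }⟩
instance : Neg (X ⟶ Y) := ⟨fun f =>
    { et := -f.et
      conn := -f.conn
      V := fun i => -f.V i
      comm_v := fun i j h x => by simp [f.comm_v i j h]
      comm_hEt := fun x => by simp [f.comm_hEt]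
      comm_hConn := fun x => by simp [f.comm_hConn]
      comm_π := fun i x => by simp [f.comm_π, MHS.quot_neg] }⟩

@[simp] theorem zero_et : Hom.et (0 : X ⟶ Y) = 0 := rfl
@[simp] theorem zero_conn : Hom.conn (0 : X ⟶ Y) = 0 := rfl
@[simp] theorem zero_V (i : Fin n) : Hom.V (0 : X ⟶ Y) i = 0 := rfl
@[simp] theorem add_et (f g : X ⟶ Y) : (f + g).et = f.et + g.et := rfl
@[simp] theorem add_conn (f g : X ⟶ Y) : (f + g).conn = f.conn + g.conn := rfl
@[simp] theorem add_V (f g : X ⟶ Y) (i : Fin n) : (f + g).V i = f.V i + g.V i := rfl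

instance : AddCommGroup (X ⟶ Y) where
  add_assoc f g h := hom_ext (add_assoc _ _ _) (add_assoc _ _ _) fun _ => add_assoc _ _ _
  zero_add f := hom_ext (zero_add _) (zero_add _) fun _ => zero_add _
  add_zero f := hom_ext (add_zero _) (add_zero _) fun _ => add_zero _
  neg_add_cancel f := hom_ext (neg_add_cancel _) (neg_add_cancel _) fun _ => neg_add_cancel _
  add_comm f g := hom_ext (add_comm _ _) (add_comm _ _) fun _ => add_comm _ _
  nsmul := nsmulRec
  zsmul := zsmulRec

instance : Preadditive (FHS.{u} n) where
  add_comp _ _ _ f f' g := hom_ext (by simp) (by ext; simp) fun i => by ext; simp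
  comp_add _ _ _ f g g' := hom_ext (by simp) (by ext; simp) fun i => by ext; simp

/-- All components are injective. -/
def Inj (f : X ⟶ Y) : Prop :=
  Function.Injective f.et.toLin ∧ Function.Injective f.conn ∧ ∀ i, Function.Injective (f.V i)

/-- All components are surjective. -/
def Surj (f : X ⟶ Y) : Prop :=
  Function.Surjective f.et.toLin ∧ Function.Surjective f.conn ∧ ∀ i, Function.Surjective (f.V i)

/-- All components are exact at the middle (kernel contained in image). -/
def Ex (f : X ⟶ Y) (g : Y ⟶ Z) : Prop :=
  (∀ x, g.et.toLin x = 0 → ∃ y, f.et.toLin y = x) ∧ (∀ x, g.conn x = 0 → ∃ y, f.conn y = x) ∧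
    ∀ i x, g.V i x = 0 → ∃ y, f.V i y = x

/-- The map `π_i` of the kernel. -/
noncomputable def kernelπ (f : X ⟶ Y) (i : Fin n) :
    LinearMap.ker (f.V i) →ₗ[ℂ] (MHS.kernelObj f.et).HodgeQuot (i.1 + 1) :=
  LinearMap.codRestrictOfInjective (X.π i ∘ₗ (LinearMap.ker (f.V i)).subtype)
    (MHS.Hom.quot (MHS.kernelι f.et) _)
    (MHS.quot_injective _ (MHS.kernelι_injective _) _)
    fun x => MHS.quot_exact f.et _ _ (by
      rw [LinearMap.comp_apply, ← f.comm_π]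
      exact (congrArg _ x.2).trans (map_zero _))

theorem kernelπ_spec (f : X ⟶ Y) (i : Fin n) (x : LinearMap.ker (f.V i)) :
    MHS.Hom.quot (MHS.kernelι f.et) _ (kernelπ f i x) = X.π i x.1 :=
  LinearMap.codRestrictOfInjective_comp_apply _ _ _ _ _

/-- The kernel of a morphism, computed componentwise. -/
noncomputable def kernelObj (f : X ⟶ Y) : FHS.{u} n where
  et := MHS.kernelObj f.et
  level := X.level.of_injective (MHS.kernelι f.et) (Submodule.subtype_injective _)
  conn := LinearMap.ker f.conn
  V i := LinearMap.ker (f.V i)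
  v i j h := (X.v i j h).restrict fun x hx => by
    rw [LinearMap.mem_ker] at hx ⊢
    rw [f.comm_v i j h, hx, map_zero]
  hEt :=
    { toFun := fun x => ⟨X.hEt ((MHS.kernelι f.et).toLin x), by
        rw [LinearMap.mem_ker, f.comm_hEt, show f.et.toLin ((MHS.kernelι f.et).toLin x) = 0 from x.2,
          map_zero]⟩
      map_zero' := Subtype.ext (by simp)
      map_add' := fun x y => Subtype.ext (by simp) }
  hConn := X.hConn.restrict fun x hx => by
    rw [LinearMap.mem_ker] at hx ⊢
    rw [f.comm_hConn, hx, map_zero]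
  π := kernelπ f
  π_hEt x := by
    apply MHS.quot_injective (MHS.kernelι f.et) (MHS.kernelι_injective _)
    refine (kernelπ_spec f _ _).trans (Eq.trans ?_ (MHS.quot_toHodgeQuot _ _ _).symm)
    exact X.π_hEt _
  π_v i j h x := by
    apply MHS.quot_injective (MHS.kernelι f.et) (MHS.kernelι_injective _)
    refine (kernelπ_spec f _ _).trans (Eq.trans ?_ (MHS.quot_hodgeProj _ _ _).symm)
    rw [kernelπ_spec]
    exact X.π_v i j h _

/-- The inclusion of the kernel. -/
noncomputable def kernelι (f : X ⟶ Y) : kernelObj f ⟶ X where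
  et := MHS.kernelι f.et
  conn := (LinearMap.ker f.conn).subtype
  V i := (LinearMap.ker (f.V i)).subtype
  comm_v _ _ _ _ := rfl
  comm_hEt _ := rfl
  comm_hConn _ := rfl
  comm_π _ _ := (kernelπ_spec f _ _).symm

/-- The cokernel of a morphism, computed componentwise. -/
noncomputable def cokernelObj (f : X ⟶ Y) : FHS.{u} n where
  et := MHS.cokernelObj f.et
  level := Y.level.of_surjective (MHS.cokernelπ f.et) (Submodule.mkQ_surjective _)
  conn := Y.conn ⧸ LinearMap.range f.conn
  V i := Y.V i ⧸ LinearMap.range (f.V i)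
  v i j h := Submodule.mapQ _ _ (Y.v i j h) (by
    rintro _ ⟨x, rfl⟩
    exact ⟨X.v i j h x, f.comm_v i j h x⟩)
  hEt := QuotientAddGroup.lift (LinearMap.range f.et.toLin).toAddSubgroup
    ((LinearMap.range (f.V (topIdx n))).mkQ.toAddMonoidHom.comp Y.hEt) (by
      rintro _ ⟨x, rfl⟩
      exact (Submodule.Quotient.mk_eq_zero _).2 ⟨X.hEt x, f.comm_hEt x⟩)
  hConn := Submodule.mapQ _ _ Y.hConn (by
    rintro _ ⟨x, rfl⟩
    exact ⟨X.hConn x, f.comm_hConn x⟩)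
  π i := Submodule.liftQ _ (MHS.Hom.quot (MHS.cokernelπ f.et) _ ∘ₗ Y.π i) (by
    rintro _ ⟨x, rfl⟩
    rw [LinearMap.mem_ker, LinearMap.comp_apply, f.comm_π, ← MHS.quot_comp, MHS.comp_cokernelπ,
      MHS.quot_zero])
  π_hEt x := by
    obtain ⟨x, rfl⟩ := Submodule.mkQ_surjective _ x
    refine Eq.trans ?_ (MHS.quot_toHodgeQuot (MHS.cokernelπ f.et) _ x)
    exact congrArg _ (Y.π_hEt x)
  π_v i j h x := by
    obtain ⟨x, rfl⟩ := Submodule.mkQ_surjective _ x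
    refine Eq.trans ?_ (MHS.quot_hodgeProj (MHS.cokernelπ f.et) (by omega) (Y.π i x))
    exact congrArg _ (Y.π_v i j h x)

/-- The projection onto the cokernel. -/
noncomputable def cokernelπ (f : X ⟶ Y) : Y ⟶ cokernelObj f where
  et := MHS.cokernelπ f.et
  conn := (LinearMap.range f.conn).mkQ
  V i := (LinearMap.range (f.V i)).mkQ
  comm_v _ _ _ _ := rfl
  comm_hEt _ := rfl
  comm_hConn _ := rfl
  comm_π _ _ := rfl

theorem kernelι_comp (f : X ⟶ Y) : kernelι f ≫ f = 0 :=
  hom_ext (MHS.kernelι_comp f.et) (LinearMap.ext fun x => x.2)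
    fun _ => LinearMap.ext fun x => x.2

theorem comp_cokernelπ (f : X ⟶ Y) : f ≫ cokernelπ f = 0 :=
  hom_ext (MHS.comp_cokernelπ f.et)
    (LinearMap.ext fun x => (Submodule.Quotient.mk_eq_zero _).2 ⟨x, rfl⟩)
    fun _ => LinearMap.ext fun x => (Submodule.Quotient.mk_eq_zero _).2 ⟨x, rfl⟩

theorem kernelι_inj (f : X ⟶ Y) : Inj (kernelι f) :=
  ⟨Submodule.subtype_injective _, Submodule.subtype_injective _,
    fun _ => Submodule.subtype_injective _⟩

theorem cokernelπ_surj (f : X ⟶ Y) : Surj (cokernelπ f) :=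
  ⟨Submodule.mkQ_surjective _, Submodule.mkQ_surjective _, fun _ => Submodule.mkQ_surjective _⟩

theorem kernelι_ex (f : X ⟶ Y) : Ex (kernelι f) f :=
  ⟨fun x h => ⟨⟨x, h⟩, rfl⟩, fun x h => ⟨⟨x, h⟩, rfl⟩, fun _ x h => ⟨⟨x, h⟩, rfl⟩⟩

theorem cokernelπ_ex (f : X ⟶ Y) : Ex f (cokernelπ f) :=
  ⟨fun _ h => (Submodule.Quotient.mk_eq_zero _).1 h,
    fun _ h => (Submodule.Quotient.mk_eq_zero _).1 h,
    fun _ _ h => (Submodule.Quotient.mk_eq_zero _).1 h⟩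

theorem mono_of_inj (f : X ⟶ Y) (hf : Inj f) : Mono f where
  right_cancellation g h e := by
    have := MHS.mono_of_injective f.et hf.1
    refine hom_ext ((cancel_mono f.et).1 (congrArg Hom.et e)) ?_ fun i => ?_
    · exact LinearMap.ext fun x => hf.2.1 (LinearMap.congr_fun (congrArg Hom.conn e) x)
    · exact LinearMap.ext fun x =>
        hf.2.2 i (LinearMap.congr_fun (congrArg (fun k => Hom.V k i) e) x)

theorem epi_of_surj (f : X ⟶ Y) (hf : Surj f) : Epi f where
  left_cancellation g h e := by
    have := MHS.epi_of_surjective f.et hf.1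
    refine hom_ext ((cancel_epi f.et).1 (congrArg Hom.et e)) ?_ fun i => ?_
    · refine LinearMap.ext fun x => ?_
      obtain ⟨x, rfl⟩ := hf.2.1 x
      exact LinearMap.congr_fun (congrArg Hom.conn e) x
    · refine LinearMap.ext fun x => ?_
      obtain ⟨x, rfl⟩ := hf.2.2 i x
      exact LinearMap.congr_fun (congrArg (fun k => Hom.V k i) e) x

theorem inj_of_mono (f : X ⟶ Y) [Mono f] : Inj f := by
  have h : kernelι f = 0 := by rw [← cancel_mono f, zero_comp, kernelι_comp]
  refine ⟨(injective_iff_map_eq_zero _).2 fun x hx => ?_,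
    (injective_iff_map_eq_zero _).2 fun x hx => ?_,
    fun i => (injective_iff_map_eq_zero _).2 fun x hx => ?_⟩
  · exact LinearMap.congr_fun (congrArg (fun k => MHS.Hom.toLin (Hom.et k)) h) ⟨x, hx⟩
  · exact LinearMap.congr_fun (congrArg Hom.conn h) ⟨x, hx⟩
  · exact LinearMap.congr_fun (congrArg (fun k => Hom.V k i) h) ⟨x, hx⟩

theorem surj_of_epi (f : X ⟶ Y) [Epi f] : Surj f := by
  have h : cokernelπ f = 0 := by rw [← cancel_epi f, comp_zero, comp_cokernelπ]
  refine ⟨fun y => ?_, fun y => ?_, fun i y => ?_⟩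
  · exact (Submodule.Quotient.mk_eq_zero _).1
      (LinearMap.congr_fun (congrArg (fun k => MHS.Hom.toLin (Hom.et k)) h) y)
  · exact (Submodule.Quotient.mk_eq_zero _).1 (LinearMap.congr_fun (congrArg Hom.conn h) y)
  · exact (Submodule.Quotient.mk_eq_zero _).1
      (LinearMap.congr_fun (congrArg (fun k => Hom.V k i) h) y)

theorem exists_lift (f : X ⟶ Y) (hf : Inj f) (k : T ⟶ Y)
    (h₁ : ∀ x, ∃ y, f.et.toLin y = k.et.toLin x) (h₂ : ∀ x, ∃ y, f.conn y = k.conn x)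
    (h₃ : ∀ i x, ∃ y, f.V i y = k.V i x) : ∃ l : T ⟶ X, l ≫ f = k := by
  obtain ⟨l, hl⟩ := MHS.exists_lift f.et hf.1 k.et h₁
  let lc := LinearMap.codRestrictOfInjective k.conn f.conn hf.2.1 h₂
  have hlc : ∀ x, f.conn (lc x) = k.conn x :=
    LinearMap.codRestrictOfInjective_comp_apply _ _ _ _
  let lV := fun i => LinearMap.codRestrictOfInjective (k.V i) (f.V i) (hf.2.2 i) (h₃ i)
  have hlV : ∀ i x, f.V i (lV i x) = k.V i x := fun i =>
    LinearMap.codRestrictOfInjective_comp_apply _ _ _ _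
  have hl' : ∀ x, f.et.toLin (l.toLin x) = k.et.toLin x := fun x =>
    LinearMap.congr_fun (congrArg MHS.Hom.toLin hl) x
  refine ⟨⟨l, lc, lV, ?_, ?_, ?_, ?_⟩, hom_ext hl (LinearMap.ext hlc) fun i => LinearMap.ext (hlV i)⟩
  · intro i j h x
    apply hf.2.2 j
    rw [hlV, f.comm_v i j h, hlV, k.comm_v i j h]
  · intro x
    apply hf.2.2
    rw [hlV, f.comm_hEt, hl', k.comm_hEt]
  · intro x
    apply hf.2.2
    rw [hlV, f.comm_hConn, hlc, k.comm_hConn]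
  · intro i x
    apply MHS.quot_injective f.et hf.1
    rw [← f.comm_π, hlV, ← MHS.quot_comp, hl, k.comm_π]

theorem exists_linear_desc {R M N P : Type*} [Ring R] [AddCommGroup M] [AddCommGroup N]
    [AddCommGroup P] [Module R M] [Module R N] [Module R P] (g : M →ₗ[R] N)
    (hg : Function.Surjective g) (k : M →ₗ[R] P) (hk : ∀ x, g x = 0 → k x = 0) :
    ∃ l : N →ₗ[R] P, ∀ x, l (g x) = k x := by
  refine ⟨(LinearMap.ker g).liftQ k hk ∘ₗ (g.quotKerEquivOfSurjective hg).symm.toLinearMap,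
    fun x => ?_⟩
  have : (g.quotKerEquivOfSurjective hg).symm (g x) = (LinearMap.ker g).mkQ x := by
    rw [LinearEquiv.symm_apply_eq]; rfl
  change (LinearMap.ker g).liftQ k hk ((g.quotKerEquivOfSurjective hg).symm (g x)) = _
  rw [this]; rfl

theorem exists_desc (g : X ⟶ Y) (hg : Surj g) (k : X ⟶ T)
    (h₁ : ∀ x, g.et.toLin x = 0 → k.et.toLin x = 0) (h₂ : ∀ x, g.conn x = 0 → k.conn x = 0)
    (h₃ : ∀ i x, g.V i x = 0 → k.V i x = 0) : ∃ l : Y ⟶ T, g ≫ l = k := by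
  obtain ⟨l, hl⟩ := MHS.exists_desc g.et hg.1 k.et h₁
  obtain ⟨lc, hlc⟩ := exists_linear_desc g.conn hg.2.1 k.conn h₂
  choose lV hlV using fun i => exists_linear_desc (g.V i) (hg.2.2 i) (k.V i) (h₃ i)
  have hl' : ∀ x, l.toLin (g.et.toLin x) = k.et.toLin x := fun x =>
    LinearMap.congr_fun (congrArg MHS.Hom.toLin hl) x
  refine ⟨⟨l, lc, lV, ?_, ?_, ?_, ?_⟩, hom_ext hl (LinearMap.ext hlc) fun i => LinearMap.ext (hlV i)⟩
  · intro i j h x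
    obtain ⟨x, rfl⟩ := hg.2.2 i x
    rw [← g.comm_v i j h, hlV, hlV, k.comm_v i j h]
  · intro x
    obtain ⟨x, rfl⟩ := hg.1 x
    rw [← g.comm_hEt, hlV, hl', k.comm_hEt]
  · intro x
    obtain ⟨x, rfl⟩ := hg.2.1 x
    rw [← g.comm_hConn, hlV, hlc, k.comm_hConn]
  · intro i x
    obtain ⟨x, rfl⟩ := hg.2.2 i x
    rw [hlV, g.comm_π, ← MHS.quot_comp, hl, k.comm_π]

theorem zero_apply {f : X ⟶ Y} (h : f = 0) : (∀ x, f.et.toLin x = 0) ∧ (∀ x, f.conn x = 0) ∧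
    ∀ i x, f.V i x = 0 := by
  subst h; exact ⟨fun _ => rfl, fun _ => rfl, fun _ _ => rfl⟩

/-- A componentwise kernel is a kernel. -/
noncomputable def isKernel (f : X ⟶ Y) (g : Y ⟶ Z) (w : f ≫ g = 0) (hf : Inj f) (hex : Ex f g) :
    IsLimit (KernelFork.ofι f w) :=
  haveI := mono_of_inj f hf
  KernelFork.IsLimit.ofι' f w fun k hk =>
    let h := exists_lift f hf k (fun x => hex.1 _ ((zero_apply hk).1 x))
      (fun x => hex.2.1 _ ((zero_apply hk).2.1 x)) (fun i x => hex.2.2 i _ ((zero_apply hk).2.2 i x))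
    ⟨h.choose, h.choose_spec⟩

/-- A componentwise cokernel is a cokernel. -/
noncomputable def isCokernel (f : X ⟶ Y) (g : Y ⟶ Z) (w : f ≫ g = 0) (hg : Surj g)
    (hex : Ex f g) : IsColimit (CokernelCofork.ofπ g w) :=
  haveI := epi_of_surj g hg
  CokernelCofork.IsColimit.ofπ' g w fun k hk =>
    let h := exists_desc g hg k
      (fun x hx => by obtain ⟨y, rfl⟩ := hex.1 x hx; exact (zero_apply hk).1 y)
      (fun x hx => by obtain ⟨y, rfl⟩ := hex.2.1 x hx; exact (zero_apply hk).2.1 y)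
      (fun i x hx => by obtain ⟨y, rfl⟩ := hex.2.2 i x hx; exact (zero_apply hk).2.2 i y)
    ⟨h.choose, h.choose_spec⟩

instance : HasKernels (FHS.{u} n) where
  has_limit f := ⟨⟨_, isKernel (kernelι f) f (kernelι_comp f) (kernelι_inj f) (kernelι_ex f)⟩⟩

instance : HasCokernels (FHS.{u} n) where
  has_colimit f :=
    ⟨⟨_, isCokernel f (cokernelπ f) (comp_cokernelπ f) (cokernelπ_surj f) (cokernelπ_ex f)⟩⟩

instance : IsNormalMonoCategory (FHS.{u} n) where
  normalMonoOfMono f _ := ⟨⟨_, cokernelπ f, comp_cokernelπ f,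
    isKernel _ _ _ (inj_of_mono f) (cokernelπ_ex f)⟩⟩

instance : IsNormalEpiCategory (FHS.{u} n) where
  normalEpiOfEpi f _ := ⟨⟨_, kernelι f, kernelι_comp f,
    isCokernel _ _ _ (surj_of_epi f) (kernelι_ex f)⟩⟩

variable (n) in
/-- The formal Hodge structure `(U, 0)` attached to a finite dimensional vector space `U`: its
étale part and its spaces `V_i` vanish, and its connected part is `U`. -/
noncomputable def ofConn (U : Type u) [AddCommGroup U] [Module ℂ U] [FiniteDimensional ℂ U] :
    FHS.{u} n where
  et := MHS.zeroObj
  level := MHS.isOfLevel_zeroObj n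
  conn := U
  V _ := PUnit
  v _ _ _ := 0
  hEt := 0
  hConn := 0
  π _ := 0
  π_hEt _ := (map_zero (MHS.zeroObj.toHodgeQuot _)).symm
  π_v i j h x := by simp

instance : HasZeroObject (FHS.{u} n) where
  zero := ⟨ofConn n PUnit, {
    unique_to := fun X => ⟨⟨⟨0⟩, fun f => by
      refine hom_ext (MHS.hom_ext (LinearMap.ext fun x => ?_)) (LinearMap.ext fun x => ?_)
        fun i => LinearMap.ext fun x => ?_
      all_goals rw [show x = 0 from rfl, map_zero, map_zero]⟩⟩
    unique_from := fun X => ⟨⟨⟨0⟩, fun f =>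
      hom_ext (MHS.hom_ext (LinearMap.ext fun x => rfl)) (LinearMap.ext fun x => rfl)
        fun i => LinearMap.ext fun x => rfl⟩⟩ }⟩

/-- The direct sum of two formal Hodge structures. -/
noncomputable def prodObj (X Y : FHS.{u} n) : FHS.{u} n where
  et := MHS.prodObj X.et Y.et
  level := X.level.prodObj Y.level
  conn := X.conn × Y.conn
  V i := X.V i × Y.V i
  v i j h := (X.v i j h).prodMap (Y.v i j h)
  hEt := X.hEt.prodMap Y.hEt
  hConn := X.hConn.prodMap Y.hConn
  π i := (MHS.Hom.quot (MHS.inl X.et Y.et) _ ∘ₗ X.π i).coprod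
    (MHS.Hom.quot (MHS.inr X.et Y.et) _ ∘ₗ Y.π i)
  π_hEt x := by
    change MHS.Hom.quot (MHS.inl X.et Y.et) _ (X.π _ (X.hEt x.1)) +
      MHS.Hom.quot (MHS.inr X.et Y.et) _ (Y.π _ (Y.hEt x.2)) = _
    rw [X.π_hEt, Y.π_hEt, MHS.quot_toHodgeQuot, MHS.quot_toHodgeQuot, ← map_add]
    exact congrArg _ (Prod.ext (add_zero x.1) (zero_add x.2))
  π_v i j h x := by
    change MHS.Hom.quot (MHS.inl X.et Y.et) _ (X.π _ (X.v i j h x.1)) +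
      MHS.Hom.quot (MHS.inr X.et Y.et) _ (Y.π _ (Y.v i j h x.2)) =
      MHS.hodgeProj _ _ (MHS.Hom.quot (MHS.inl X.et Y.et) _ (X.π _ x.1) +
      MHS.Hom.quot (MHS.inr X.et Y.et) _ (Y.π _ x.2))
    rw [X.π_v, Y.π_v, MHS.quot_hodgeProj, MHS.quot_hodgeProj, ← map_add]

/-- The first projection. -/
noncomputable def fst (X Y : FHS.{u} n) : prodObj X Y ⟶ X where
  et := MHS.fst X.et Y.et
  conn := LinearMap.fst ℂ _ _
  V _ := LinearMap.fst ℂ _ _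
  comm_v _ _ _ _ := rfl
  comm_hEt _ := rfl
  comm_hConn _ := rfl
  comm_π i x := by
    change X.π i x.1 = MHS.Hom.quot (MHS.fst X.et Y.et) _
      (MHS.Hom.quot (MHS.inl X.et Y.et) _ (X.π _ x.1) +
      MHS.Hom.quot (MHS.inr X.et Y.et) _ (Y.π _ x.2))
    rw [map_add, ← MHS.quot_comp, ← MHS.quot_comp, MHS.inl_fst, MHS.inr_fst, MHS.quot_id,
      MHS.quot_zero, add_zero]

/-- The second projection. -/
noncomputable def snd (X Y : FHS.{u} n) : prodObj X Y ⟶ Y where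
  et := MHS.snd X.et Y.et
  conn := LinearMap.snd ℂ _ _
  V _ := LinearMap.snd ℂ _ _
  comm_v _ _ _ _ := rfl
  comm_hEt _ := rfl
  comm_hConn _ := rfl
  comm_π i x := by
    change Y.π i x.2 = MHS.Hom.quot (MHS.snd X.et Y.et) _
      (MHS.Hom.quot (MHS.inl X.et Y.et) _ (X.π _ x.1) +
      MHS.Hom.quot (MHS.inr X.et Y.et) _ (Y.π _ x.2))
    rw [map_add, ← MHS.quot_comp, ← MHS.quot_comp, MHS.inl_snd, MHS.inr_snd, MHS.quot_id,
      MHS.quot_zero, zero_add]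

/-- The first inclusion. -/
noncomputable def inl (X Y : FHS.{u} n) : X ⟶ prodObj X Y where
  et := MHS.inl X.et Y.et
  conn := LinearMap.inl ℂ _ _
  V _ := LinearMap.inl ℂ _ _
  comm_v i j h x := Prod.ext rfl (map_zero (Y.v i j h)).symm
  comm_hEt x := Prod.ext rfl (map_zero Y.hEt).symm
  comm_hConn x := Prod.ext rfl (map_zero Y.hConn).symm
  comm_π i x := by
    change MHS.Hom.quot (MHS.inl X.et Y.et) _ (X.π _ x) +
      MHS.Hom.quot (MHS.inr X.et Y.et) _ (Y.π _ 0) = _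
    rw [map_zero, map_zero, add_zero]; rfl

/-- The second inclusion. -/
noncomputable def inr (X Y : FHS.{u} n) : Y ⟶ prodObj X Y where
  et := MHS.inr X.et Y.et
  conn := LinearMap.inr ℂ _ _
  V _ := LinearMap.inr ℂ _ _
  comm_v i j h x := Prod.ext (map_zero (X.v i j h)).symm rfl
  comm_hEt x := Prod.ext (map_zero X.hEt).symm rfl
  comm_hConn x := Prod.ext (map_zero X.hConn).symm rfl
  comm_π i x := by
    change MHS.Hom.quot (MHS.inl X.et Y.et) _ (X.π _ 0) +
      MHS.Hom.quot (MHS.inr X.et Y.et) _ (Y.π _ x) = _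
    rw [map_zero, map_zero, zero_add]; rfl

instance : HasBinaryBiproducts (FHS.{u} n) where
  has_binary_biproduct X Y := hasBinaryBiproduct_of_total
    { pt := prodObj X Y
      fst := fst X Y
      snd := snd X Y
      inl := inl X Y
      inr := inr X Y
      inl_fst := hom_ext (MHS.inl_fst _ _) (LinearMap.fst_comp_inl _ _ _)
        fun _ => LinearMap.fst_comp_inl _ _ _
      inl_snd := hom_ext (MHS.inl_snd _ _) (LinearMap.snd_comp_inl _ _ _)
        fun _ => LinearMap.snd_comp_inl _ _ _
      inr_fst := hom_ext (MHS.inr_fst _ _) (LinearMap.fst_comp_inr _ _ _)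
        fun _ => LinearMap.fst_comp_inr _ _ _
      inr_snd := hom_ext (MHS.inr_snd _ _) (LinearMap.snd_comp_inr _ _ _)
        fun _ => LinearMap.snd_comp_inr _ _ _ }
    (hom_ext (MHS.hom_ext (LinearMap.ext fun x => Prod.ext (add_zero x.1) (zero_add x.2)))
      (LinearMap.ext fun x => Prod.ext (add_zero x.1) (zero_add x.2))
      fun _ => LinearMap.ext fun x => Prod.ext (add_zero x.1) (zero_add x.2))

instance : HasFiniteProducts (FHS.{u} n) :=
  haveI : HasTerminal (FHS.{u} n) := HasZeroObject.hasTerminal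
  hasFiniteProducts_of_has_binary_and_terminal

noncomputable instance : Abelian (FHS.{u} n) where

instance : HasExt.{u + 1} (FHS.{u} n) := HasExt.standard _

/-! ### The functors and objects of the comparison -/

variable (n) in
/-- The forgetful functor `(H, V) ↦ H_et`. -/
def forgetEt : FHS.{u} n ⥤ MHS.{u} where
  obj X := X.et
  map f := f.et

instance : (forgetEt.{u} n).Additive where

theorem forgetEt_shortExact (S : ShortComplex (FHS.{u} n)) (hS : S.ShortExact) :
    (S.map (forgetEt n)).ShortExact := by
  have := hS.mono_f
  have := hS.epi_g
  have h1 := inj_of_mono S.f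
  have h2 := surj_of_epi S.g
  obtain ⟨l, hl⟩ := KernelFork.IsLimit.lift' hS.fIsKernel (kernelι S.g) (kernelι_comp S.g)
  replace hl : l ≫ S.f = kernelι S.g := hl
  have hex : ∀ x, S.g.et.toLin x = 0 → ∃ y, S.f.et.toLin y = x := fun x hx =>
    ⟨l.et.toLin ⟨x, hx⟩,
      LinearMap.congr_fun (congrArg (fun k => MHS.Hom.toLin (Hom.et k)) hl) ⟨x, hx⟩⟩
  exact
    { exact := ShortComplex.exact_of_f_is_kernel _
        (MHS.isKernel S.f.et S.g.et (congrArg Hom.et S.zero) h1.1 hex)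
      mono_f := MHS.mono_of_injective S.f.et h1.1
      epi_g := MHS.epi_of_surjective S.g.et h2.1 }

instance : PreservesFiniteLimits (forgetEt.{u} n) := by
  have h := ((Functor.exact_tfae (forgetEt.{u} n)).out 0 3).mp forgetEt_shortExact
  exact h.1

instance : PreservesFiniteColimits (forgetEt.{u} n) := by
  have h := ((Functor.exact_tfae (forgetEt.{u} n)).out 0 3).mp forgetEt_shortExact
  exact h.2

/-- A mixed Hodge structure `H_et` of level `≤ n` viewed as the étale formal Hodge structure
`(H_et, V_i = H_ℂ / F^i)`. -/
noncomputable def ofMHS (A : MHS.{u}) (hA : A.IsOfLevel n) : FHS.{u} n where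
  et := A
  level := hA
  conn := PUnit
  V i := A.HodgeQuot (i.1 + 1)
  v _ _ h := A.hodgeProj (by omega)
  hEt := A.toHodgeQuot _
  hConn := 0
  π _ := LinearMap.id
  π_hEt _ := rfl
  π_v _ _ _ _ := rfl

/-- The formal Hodge structure `(H, V)_× = (H, V / V^o)` with `V_i^o = ker π_i`. -/
noncomputable def times (X : FHS.{u} n) : FHS.{u} n where
  et := X.et
  level := X.level
  conn := X.conn
  V i := X.V i ⧸ LinearMap.ker (X.π i)
  v i j h := Submodule.mapQ _ _ (X.v i j h) fun x hx => by
    rw [LinearMap.mem_ker] at hx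
    rw [Submodule.mem_comap, LinearMap.mem_ker, X.π_v i j h, hx, map_zero]
  hEt := (LinearMap.ker (X.π (topIdx n))).mkQ.toAddMonoidHom.comp X.hEt
  hConn := (LinearMap.ker (X.π (topIdx n))).mkQ ∘ₗ X.hConn
  π i := (LinearMap.ker (X.π i)).liftQ (X.π i) le_rfl
  π_hEt := X.π_hEt
  π_v i j h x := by
    obtain ⟨x, rfl⟩ := Submodule.mkQ_surjective _ x
    exact X.π_v i j h x

/-- The canonical projection `(H, V / V^o) → (H^o, 0)`. -/
noncomputable def timesProj (X : FHS.{u} n) : times X ⟶ ofConn n X.conn where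
  et := 0
  conn := LinearMap.id
  V _ := 0
  comm_v _ _ _ _ := rfl
  comm_hEt _ := rfl
  comm_hConn _ := rfl
  comm_π _ _ := (MHS.quot_zero _ _).symm

end FHS

end FormalHodge

/-! Two exact endofunctors of formal Hodge structures carry the proof: `etPart`, sending `(H, V)` to
the étale object of `H_et`, and `hodgePart`, which keeps the formal group and replaces each `V_i` by
`H_ℂ / F^i`. Exactness is Deligne's strictness. They are linked by natural maps `id → hodgePart ←
etPart`. The left one is invertible at every object whose `π_i` are bijective, in particular at `(H,
V/V^o)` and at `(H^o, 0)`; at an étale object both are invertible. An exact functor acts on Ext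
naturally in the functor, so a class in `Ext (ofMHS A hA) Y i`, with the `π_i` of `Y` bijective,
vanishes as soon as its image under `etPart` does (`eq_zero_of_etPart_eq_zero`).

The image under `etPart` of every class of degree at least 2 is zero. Such a class is a Yoneda
product starting with two extensions, and the product of an extension of `A` by `C` with an
extension whose quotient map is `B → C` vanishes once the first one lifts to an extension of `A` by
`B`. Extensions of mixed Hodge structures do lift along epimorphisms (`MHS.exists_extension_lift`),
and the lift keeps its level (`MHS.IsOfLevel.extension`). Hence both groups in (ii) are zero and any
homomorphism between them is an isomorphism.

The lifting theorem separates the lattice from the filtrations. On lattices the obstruction would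
lie in `Ext²` over `ℤ`, which is zero. For the filtrations, an extension is described by a rational
splitting compatible with `W`, a complex splitting compatible with `W` and `F`, and their
difference, a map preserving `W`; strictness together with linear algebra over a field
(`exists_bifiltered_lift`) lifts all of these.

For (i), an extension of `A` by `Y.et` in mixed Hodge structures has a middle term of level `≤ n`;
viewing it as an étale extension and pushing out along `ofMHS Y.et → Y` gives a preimage.
Injectivity comes from the vanishing criterion above: a factorization of étale parts that
trivializes a class in mixed Hodge structures also trivializes its image under `etPart`. -/

namespace FormalHodge

/-! ### Yoneda Ext: effaceability, naturality in exact functors, pushouts -/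

section HomologicalAlgebra

open Abelian

universe w v w' v' u'

variable {C : Type u} [Category.{v} C] [Abelian C]

open HomologicalComplex in
/-- A quasi-isomorphism from a complex in nonpositive degrees to an object in degree zero is
represented, on the degree zero term, by an epimorphism. -/
theorem exists_epi_factor_single {X : C} {K : CochainComplex C ℤ}
    (s : K ⟶ (single C (ComplexShape.up ℤ) 0).obj X) [K.IsStrictlyLE 0] [QuasiIsoAt s 0] :
    ∃ (p : K.X 0 ⟶ X) (t : (single C (ComplexShape.up ℤ) 0).obj (K.X 0) ⟶ K),
      Epi p ∧ t ≫ s = (single C (ComplexShape.up ℤ) 0).map p := by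
  -- Since `K` vanishes in degree 1, its whole degree-zero term consists of cycles. The map to `X`
  -- is cycles → homology → `X`: an epimorphism followed by the isomorphism induced by `s`.
  let e := K.iCyclesIso 0 (0 + 1) (by simp)
    ((K.isZero_of_isStrictlyLE 0 (0 + 1) (by simp)).eq_of_tgt _ _)
  let α := e.inv ≫ K.homologyπ 0 ≫ homologyMap s 0 ≫ (singleObjHomologySelfIso _ _ _).hom
  have hα : s.f 0 = α ≫ (singleObjXSelf (ComplexShape.up ℤ) 0 X).inv := by
    rw [← cancel_epi e.hom]
    dsimp only [α, e]
    rw [Category.assoc, Category.assoc, Category.assoc, Iso.hom_inv_id_assoc,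
      homologyπ_naturality_assoc, homologyπ_singleObjHomologySelfIso_hom_assoc,
      ← singleObjCyclesSelfIso_inv_iCycles, Iso.hom_inv_id_assoc, iCyclesIso_hom, ← cyclesMap_i]
  -- The identity in degree 0 is a chain map from `K.X 0` to `K`, again because the term in degree 1
  -- is zero.
  refine ⟨α, mkHomFromSingle (𝟙 _) fun k hk =>
      (K.isZero_of_isStrictlyLE 0 k (by simp at hk; lia)).eq_of_tgt _ _, ?_, ?_⟩
  · dsimp only [α]; infer_instance
  · apply HomologicalComplex.from_single_hom_ext
    rw [comp_f, mkHomFromSingle_f, hα, Category.comp_id]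
    exact (single_map_f_self _ _ _).symm

/-- Classes of positive degree are effaceable. -/
theorem exists_epi_mk₀_comp_eq_zero [HasExt.{w} C] {X Y : C} {n : ℕ} (x : Ext X Y (n + 1)) :
    ∃ (P : C) (p : P ⟶ X), Epi p ∧ (Ext.mk₀ p).comp x (zero_add _) = 0 := by
  let := HasDerivedCategory.standard C
  -- The class is read as a morphism to the complex with `Y` placed in degree `-(n + 1)`, so that
  -- degrees can be compared termwise.
  let φ : DerivedCategory.Q.obj ((CochainComplex.singleFunctor C 0).obj X) ⟶
      DerivedCategory.Q.obj ((CochainComplex.singleFunctor C (-(n + 1))).obj Y) :=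
    x.hom ≫ ((DerivedCategory.singleFunctors C).shiftIso (n + 1) (-(n + 1)) 0
      (by lia)).hom.app _
  -- A right fraction whose denominator `s` has source in nonpositive degrees, so that the previous
  -- lemma applies to it.
  obtain ⟨K, _, s, hs, g, hφ⟩ := DerivedCategory.right_fac_of_isStrictlyLE φ 0
  have hs' := hs
  rw [DerivedCategory.isIso_Q_map_iff_quasiIso] at hs'
  have hq : QuasiIsoAt s 0 := inferInstance
  obtain ⟨p, t, hp, ht⟩ : ∃ (p : K.X 0 ⟶ X)
      (t : (CochainComplex.singleFunctor C 0).obj (K.X 0) ⟶ K),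
      Epi p ∧ t ≫ s = (CochainComplex.singleFunctor C 0).map p :=
    @exists_epi_factor_single _ _ _ _ _ s _ hq
  refine ⟨_, p, hp, ?_⟩
  apply Ext.homEquiv.injective
  change Ext.hom _ = Ext.hom _
  rw [← Ext.singleFunctor_map_comp_hom, Ext.zero_hom]
  rw [← cancel_mono (((DerivedCategory.singleFunctors C).shiftIso (n + 1) (-(n + 1)) 0
    (by lia)).hom.app _), Category.assoc, Limits.zero_comp]
  change DerivedCategory.Q.map ((CochainComplex.singleFunctor C 0).map p) ≫ φ = 0
  -- Positivity of the degree enters here: the source lives in degree 0 and the target in degree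
  -- `-(n + 1)`, so every component vanishes.
  have htg : t ≫ g = 0 := by
    apply HomologicalComplex.from_single_hom_ext
    apply (((CochainComplex.singleFunctor C (-(n + 1))).obj Y).isZero_of_isStrictlyLE
      (-(n + 1)) 0 (by lia)).eq_of_tgt
  rw [hφ, ← ht, Functor.map_comp, Category.assoc, IsIso.hom_inv_id_assoc, ← Functor.map_comp,
    htg, Functor.map_zero]

/-- A class of positive degree is the product of the class of an extension and a class of lower
degree. -/
theorem exists_extClass_comp [HasExt.{w} C] {X Y : C} {n : ℕ} (x : Ext X Y (n + 1)) :
    ∃ (K P : C) (i : K ⟶ P) (p : P ⟶ X) (w : i ≫ p = 0)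
      (hS : (ShortComplex.mk i p w).ShortExact) (y : Ext K Y n),
      hS.extClass.comp y (add_comm 1 n) = x := by
  -- A class killed on `P` comes, by the long exact sequence of `0 → ker p → P → X → 0`, from a
  -- class on `ker p` through the connecting map.
  obtain ⟨P, p, hp, hx⟩ := exists_epi_mk₀_comp_eq_zero x
  have hS : (ShortComplex.mk _ _ (kernel.condition p)).ShortExact :=
    { exact := ShortComplex.exact_of_f_is_kernel _ (kernelIsKernel p) }
  obtain ⟨y, hy⟩ := Ext.contravariant_sequence_exact₃ hS Y x hx (add_comm 1 n)
  exact ⟨_, _, _, _, _, hS, y, hy⟩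

/-- An extension becomes split after pushout along a map that extends to its middle term, because
the class is already killed by `S.f`. -/
theorem extClass_comp_mk₀_eq_zero [HasExt.{w} C] {S : ShortComplex C} (hS : S.ShortExact) {Y : C}
    {f : S.X₁ ⟶ Y} {g : S.X₂ ⟶ Y} (h : f = S.f ≫ g) :
    hS.extClass.comp (Ext.mk₀ f) (add_zero 1) = 0 := by
  rw [h, ← Ext.mk₀_comp_mk₀]
  exact hS.extClass_comp_assoc _

/-- An exact functor acts on extension groups naturally. -/
theorem mapExactFunctor_natTrans {D : Type u'} [Category.{v'} D] [Abelian D] [HasExt.{w} C]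
    [HasExt.{w'} D] {F G : C ⥤ D} [F.Additive] [PreservesFiniteLimits F]
    [PreservesFiniteColimits F] [G.Additive] [PreservesFiniteLimits G]
    [PreservesFiniteColimits G] (τ : F ⟶ G) {X Y : C} {n : ℕ} (x : Ext X Y n) :
    (x.mapExactFunctor F).comp (Ext.mk₀ (τ.app Y)) (add_zero n) =
      (Ext.mk₀ (τ.app X)).comp (x.mapExactFunctor G) (zero_add n) := by
  -- Dimension shifting. Degree 0 is naturality of `τ`; in higher degree one extension class is
  -- split off, and for it the claim is naturality of the class along the morphism that `τ` induces
  -- between the images of the sequence under `F` and `G`.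
  induction n generalizing X with
  | zero =>
    obtain ⟨f, rfl⟩ := (Ext.mk₀_bijective X Y).2 x
    rw [Ext.mapExactFunctor_mk₀, Ext.mapExactFunctor_mk₀, Ext.mk₀_comp_mk₀, Ext.mk₀_comp_mk₀,
      τ.naturality]
  | succ n ih =>
    obtain ⟨K, P, i, p, w, hS, y, rfl⟩ := exists_extClass_comp x
    rw [Ext.mapExactFunctor_comp, Ext.mapExactFunctor_comp, Ext.comp_assoc_of_third_deg_zero, ih,
      ← Ext.comp_assoc_of_second_deg_zero, Ext.mapExactFunctor_extClass,
      Ext.mapExactFunctor_extClass]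
    have := ShortComplex.ShortExact.extClass_naturality (hS.map_of_exact F) (hS.map_of_exact G)
      ((ShortComplex.mk i p w).mapNatTrans τ)
    exact (congrArg (fun z => z.comp (y.mapExactFunctor G) (add_comm 1 n)) this).trans
      (Ext.comp_assoc _ _ _ (zero_add 1) (add_comm 1 n) (by lia))

theorem mapExactFunctor_id [HasExt.{w} C] {X Y : C} {n : ℕ} (x : Ext X Y n) :
    x.mapExactFunctor (𝟭 C) = x := by
  induction n generalizing X with
  | zero =>
    obtain ⟨f, rfl⟩ := (Ext.mk₀_bijective X Y).2 x
    rw [Ext.mapExactFunctor_mk₀]; rfl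
  | succ n ih =>
    obtain ⟨K, P, i, p, w, hS, y, rfl⟩ := exists_extClass_comp x
    rw [Ext.mapExactFunctor_comp, ih, Ext.mapExactFunctor_extClass]
    rfl

/-- The pushout of an extension. -/
theorem exists_pushout_extClass [HasExt.{w} C] {S : ShortComplex C} (hS : S.ShortExact) {Y : C}
    (f : S.X₁ ⟶ Y) :
    ∃ (E : C) (i : Y ⟶ E) (p : E ⟶ S.X₃) (w : i ≫ p = 0)
      (hE : (ShortComplex.mk i p w).ShortExact),
      hE.extClass = hS.extClass.comp (Ext.mk₀ f) (add_zero 1) := by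
  have := hS.mono_f
  have := hS.epi_g
  let p : pushout f S.f ⟶ S.X₃ := pushout.desc 0 S.g (by simp)
  have w : pushout.inl f S.f ≫ p = 0 := pushout.inl_desc _ _ _
  have hp : pushout.inr f S.f ≫ p = S.g := pushout.inr_desc _ _ _
  have : Epi p := epi_of_epi_fac hp
  have hE : (ShortComplex.mk _ _ w).ShortExact :=
    { exact := by
        apply ShortComplex.exact_of_g_is_cokernel
        refine CokernelCofork.IsColimit.ofπ' _ _ fun {A} k hk => ?_
        have hk' : S.f ≫ pushout.inr f S.f ≫ k = 0 := by
          rw [← pushout.condition_assoc]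
          have hk : pushout.inl f S.f ≫ k = 0 := hk
          rw [hk, comp_zero]
        refine ⟨hS.gIsCokernel.desc (CokernelCofork.ofπ _ hk'), ?_⟩
        have hd : S.g ≫ hS.gIsCokernel.desc (CokernelCofork.ofπ _ hk') = pushout.inr f S.f ≫ k :=
          hS.gIsCokernel.fac _ WalkingParallelPair.one
        dsimp
        apply pushout.hom_ext
        · rw [reassoc_of% w, Limits.zero_comp]; exact hk.symm
        · rw [reassoc_of% hp, hd]
      mono_f := inferInstanceAs (Mono (pushout.inl f S.f))
      epi_g := inferInstanceAs (Epi p) }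
  refine ⟨_, _, p, w, hE, ?_⟩
  -- A morphism of extensions that is the identity on the quotient; naturality of the class along it
  -- is the required formula.
  let φ : S ⟶ ShortComplex.mk _ _ w :=
    { τ₁ := f, τ₂ := pushout.inr f S.f, τ₃ := 𝟙 _, comm₁₂ := pushout.condition
      comm₂₃ := by simp [hp] }
  have := ShortComplex.ShortExact.extClass_naturality hS hE φ
  exact (this.trans (Ext.mk₀_id_comp _)).symm

end HomologicalAlgebra

/-! ### Lifting linear maps compatibly with filtrations -/

section LinearAlgebra

variable {K P M N : Type*} [Field K] [AddCommGroup P] [Module K P] [AddCommGroup M] [Module K M]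
  [AddCommGroup N] [Module K N]

/-- A linear map over a field has a generalized inverse. -/
theorem exists_generalized_inverse (h : M →ₗ[K] N) : ∃ h' : N →ₗ[K] M, ∀ x, h (h' (h x)) = h x := by
  obtain ⟨s, hs⟩ := LinearMap.exists_rightInverse_of_surjective h.rangeRestrict
    h.range_rangeRestrict
  obtain ⟨r, hr⟩ := LinearMap.exists_leftInverse_of_injective (LinearMap.range h).subtype
    (Submodule.ker_subtype _)
  refine ⟨s ∘ₗ r, fun x => ?_⟩
  have h1 : r (h x) = h.rangeRestrict x := LinearMap.congr_fun hr (h.rangeRestrict x)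
  have h2 := LinearMap.congr_fun hs (h.rangeRestrict x)
  rw [LinearMap.comp_apply, h1]
  exact congrArg Subtype.val h2

/-- A linear map with values in `N` lifts on a subspace to a map with values in a prescribed
subspace of `M`, as soon as each value does. -/
theorem exists_lift_on (g : M →ₗ[K] N) (f : P →ₗ[K] N) (S : Submodule K P) (U : Submodule K M)
    (h : ∀ x ∈ S, ∃ m ∈ U, g m = f x) :
    ∃ t : P →ₗ[K] M, ∀ x, t x ∈ U ∧ (x ∈ S → g (t x) = f x) := by
  -- Inverting the restriction of `g` to `U` puts all values in `U`, even outside `S`, where nothing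
  -- is asked of the lift; on `S` it inverts because `f x` lies in `g(U)`.
  obtain ⟨h', hh'⟩ := exists_generalized_inverse (g ∘ₗ U.subtype)
  refine ⟨U.subtype ∘ₗ h' ∘ₗ f, fun x => ⟨(h' (f x)).2, fun hx => ?_⟩⟩
  obtain ⟨m, hm, e⟩ := h x hx
  have := hh' ⟨m, hm⟩
  change g (h' (f x)) = f x
  rw [← e]
  exact this

/-- Over a field, maps out of a space with two finite filtrations lift along bistrict
surjections. -/
theorem exists_bifiltered_lift {W F : ℤ → Submodule K P} (hW : Monotone W) (hF : Antitone F)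
    (botW : ∃ a, W a = ⊥) (topW : ∃ a, W a = ⊤) (topF : ∃ a, F a = ⊤) (botF : ∃ a, F a = ⊥)
    {S : ℤ → ℤ → Submodule K M} (hS : ∀ k k' p p', k ≤ k' → p' ≤ p → S k p ≤ S k' p')
    (g : M →ₗ[K] N) (f : P →ₗ[K] N)
    (hf : ∀ k p x, x ∈ W k → x ∈ F p → ∃ m ∈ S k p, g m = f x) :
    ∃ l : P →ₗ[K] M, (∀ x, g (l x) = f x) ∧ ∀ k p x, x ∈ W k → x ∈ F p → l x ∈ S k p := by
  -- A partial solution is a map on all of `P` constrained only on `D`. The subspaces `D` grow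
  -- lexicographically: `k` increases and, for each `k`, `p` decreases, adding `W k ⊓ F p` to what
  -- is already there.
  let Good (D : Submodule K P) (l : P →ₗ[K] M) : Prop :=
    (∀ x ∈ D, g (l x) = f x) ∧ ∀ k p, ∀ x ∈ D, x ∈ W k → x ∈ F p → l x ∈ S k p
  have step : ∀ (k p : ℤ) (D : Submodule K P), W (k - 1) ≤ D → D ≤ W k → W k ⊓ F (p + 1) ≤ D →
      (∃ l, Good D l) → ∃ l, Good (D ⊔ (W k ⊓ F p)) l := by
    rintro k p D h1 h2 h3 ⟨l, hl1, hl2⟩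
    obtain ⟨t, ht⟩ := exists_lift_on g f (W k ⊓ F p) (S k p) fun x hx => hf k p x hx.1 hx.2
    -- The resulting `q` takes values in `W k ⊓ F p`, kills `D`, and is the identity modulo `D` on
    -- the enlarged subspace. The new map uses `l` on `x - q x` and the local lift `t` on `q x`.
    obtain ⟨q', hq'⟩ := exists_generalized_inverse (D.mkQ ∘ₗ (W k ⊓ F p).subtype)
    let q : P →ₗ[K] P := (W k ⊓ F p).subtype ∘ₗ q' ∘ₗ D.mkQ
    have hqS : ∀ x, q x ∈ W k ⊓ F p := fun x => (q' (D.mkQ x)).2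
    have hqD : ∀ x ∈ D, q x = 0 := fun x hx => by
      simp [q, (Submodule.Quotient.mk_eq_zero D).2 hx]
    have hq : ∀ x ∈ D ⊔ (W k ⊓ F p), x - q x ∈ D := by
      intro x hx
      obtain ⟨d, hd, s, hs, rfl⟩ := Submodule.mem_sup.1 hx
      rw [map_add, hqD d hd, zero_add, add_sub_assoc]
      refine add_mem hd ((Submodule.Quotient.eq D).1 ?_)
      exact (hq' ⟨s, hs⟩).symm
    refine ⟨l ∘ₗ (LinearMap.id - q) + t ∘ₗ q, fun x hx => ?_, fun k' p' x hx hxW hxF => ?_⟩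
    · change g (l (x - q x) + t (q x)) = f x
      rw [map_add, hl1 _ (hq x hx), (ht _).2 (hqS x), ← map_add, sub_add_cancel]
    · change l (x - q x) + t (q x) ∈ S k' p'
      -- Elements of `D` keep their old value. A new element is in no earlier step of either
      -- filtration, which forces `k ≤ k'` and `p' ≤ p`; then `q x` stays in `W k' ⊓ F p'`, and
      -- monotonicity of `S` absorbs `t (q x)`.
      by_cases hxD : x ∈ D
      · rw [hqD x hxD, map_zero, add_zero, sub_zero]
        exact hl2 k' p' x hxD hxW hxF
      · have hk : k ≤ k' := by
          by_contra hk
          exact hxD (h1 (hW (by omega) hxW))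
        have hp : p' ≤ p := by
          by_contra hp
          exact hxD (h3 ⟨(sup_le h2 inf_le_left : _ ≤ W k) hx, hF (by omega) hxF⟩)
        exact add_mem (hl2 k' p' _ (hq x hx) (sub_mem hxW (hW hk (hqS x).1))
          (sub_mem hxF (hF hp (hqS x).2))) (hS k k' p p' hk hp (ht _).1)
  have inner : ∀ k, (∃ l, Good (W (k - 1)) l) → ∃ l, Good (W k) l := by
    intro k hk
    have key : ∀ p, ∃ l, Good (W (k - 1) ⊔ (W k ⊓ F p)) l := by
      obtain ⟨b, hb⟩ := botF
      have h0 : ∀ p, b ≤ p → ∃ l, Good (W (k - 1) ⊔ (W k ⊓ F p)) l := by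
        intro p hp
        have : F p = ⊥ := le_bot_iff.1 (hb ▸ hF hp)
        simpa [this] using hk
      intro p
      rcases le_total b p with hp | hp
      · exact h0 p hp
      · induction p, hp using Int.leInductionDown with
        | base => exact h0 b le_rfl
        | pred p _ ih =>
          have := step k (p - 1) _ le_sup_left (sup_le (hW (by omega)) inf_le_left)
            (by rw [sub_add_cancel]; exact le_sup_right) ih
          rwa [sup_assoc, sup_eq_right.2 (inf_le_inf_left (W k) (hF (by omega : p - 1 ≤ p)))]
            at this
    obtain ⟨t, ht⟩ := topF
    have := key t
    rwa [ht, inf_top_eq, sup_eq_right.2 (hW (by omega : k - 1 ≤ k))] at this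
  have all : ∀ k, ∃ l, Good (W k) l := by
    obtain ⟨a, ha⟩ := botW
    have h0 : ∀ k, k ≤ a → ∃ l, Good (W k) l := by
      intro k hk
      have : W k = ⊥ := le_bot_iff.1 (ha ▸ hW hk)
      refine ⟨0, fun x hx => ?_, fun k p x _ _ _ => zero_mem _⟩
      rw [this, Submodule.mem_bot] at hx
      simp [hx]
    intro k
    rcases le_total k a with hk | hk
    · exact h0 k hk
    · induction k, hk using Int.leInduction with
      | base => exact h0 a le_rfl
      | succ k _ ih => exact inner (k + 1) (by simpa using ih)
  obtain ⟨t, ht⟩ := topW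
  obtain ⟨l, hl1, hl2⟩ := all t
  rw [ht] at hl1 hl2
  exact ⟨l, fun x => hl1 x Submodule.mem_top, fun k p x => hl2 k p x Submodule.mem_top⟩

/-- Over a field, maps out of a space with a finite filtration lift along strict surjections. -/
theorem exists_filtered_lift {W : ℤ → Submodule K P} (hW : Monotone W)
    (botW : ∃ a, W a = ⊥) (topW : ∃ a, W a = ⊤) {S : ℤ → Submodule K M} (hS : Monotone S)
    (g : M →ₗ[K] N) (f : P →ₗ[K] N) (hf : ∀ k, ∀ x ∈ W k, ∃ m ∈ S k, g m = f x) :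
    ∃ l : P →ₗ[K] M, (∀ x, g (l x) = f x) ∧ ∀ k, ∀ x ∈ W k, l x ∈ S k := by
  -- The second filtration is taken trivial, everything up to index 0 and zero afterwards.
  obtain ⟨l, h1, h2⟩ := exists_bifiltered_lift (F := fun p => if p ≤ 0 then ⊤ else ⊥)
    (S := fun k p => if p ≤ 0 then S k else ⊥) hW (fun p p' hp => by
      dsimp only
      split_ifs
      exacts [le_rfl, by omega, bot_le, le_rfl]) botW topW ⟨0, by simp⟩ ⟨1, by simp⟩
    (fun k k' p p' hk hp => by
      split_ifs
      exacts [hS hk, by omega, bot_le, le_rfl]) g f (fun k p x hx hx' => by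
      split_ifs at hx' ⊢ with h
      · exact hf k x hx
      · rw [Submodule.mem_bot] at hx'
        exact ⟨0, zero_mem _, by simp [hx']⟩)
  exact ⟨l, h1, fun k x hx => by simpa using h2 k 0 x hx (by simp)⟩

end LinearAlgebra

/-! ### Opposed filtrations on the middle term of an extension -/

/-- A strict extension of opposed filtrations is opposed. -/
theorem Opposed.extension {R M E N : Type*} [Ring R] [AddCommGroup M] [Module R M]
    [AddCommGroup E] [Module R E] [AddCommGroup N] [Module R N]
    {W F G : ℤ → Submodule R M} {W' F' G' : ℤ → Submodule R E} {W'' F'' G'' : ℤ → Submodule R N}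
    (h : Opposed W F G) (h'' : Opposed W'' F'' G'') (i : M →ₗ[R] E) (r : E →ₗ[R] N)
    (hex : ∀ x, r x = 0 ↔ ∃ y, i y = x)
    (monoW : Monotone W') (antiF : Antitone F') (antiG : Antitone G')
    (hW : ∀ k y, i y ∈ W' k ↔ y ∈ W k) (hF : ∀ k y, i y ∈ F' k ↔ y ∈ F k)
    (hG : ∀ k y, i y ∈ G' k ↔ y ∈ G k)
    (rW : ∀ k x, x ∈ W' k → r x ∈ W'' k) (rF : ∀ k x, x ∈ F' k → r x ∈ F'' k)
    (rG : ∀ k x, x ∈ G' k → r x ∈ G'' k)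
    (sF : ∀ k p y, y ∈ W'' k → y ∈ F'' p → ∃ u, u ∈ W' k ∧ u ∈ F' p ∧ r u = y)
    (sG : ∀ k p y, y ∈ W'' k → y ∈ G'' p → ∃ u, u ∈ W' k ∧ u ∈ G' p ∧ r u = y) :
    Opposed W' F' G' := by
  have bot : ∀ {U : ℤ → Submodule R M} {U' : ℤ → Submodule R E} {U'' : ℤ → Submodule R N} (c : ℤ),
      (∀ y, i y ∈ U' c ↔ y ∈ U c) → (∀ x, x ∈ U' c → r x ∈ U'' c) → U c = ⊥ → U'' c = ⊥ →
      U' c = ⊥ := by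
    intro U U' U'' c h1 h2 h3 h4
    refine le_bot_iff.1 fun x hx => ?_
    have hx0 := h2 x hx
    rw [h4, Submodule.mem_bot] at hx0
    obtain ⟨y, rfl⟩ := (hex x).1 hx0
    have hy := (h1 y).1 hx
    rw [h3, Submodule.mem_bot] at hy
    simp [hy]
  have top : ∀ {U : ℤ → Submodule R M} {U' : ℤ → Submodule R E} (c : ℤ),
      (∀ y, i y ∈ U' c ↔ y ∈ U c) → (∀ y, ∃ u ∈ U' c, r u = y) → U c = ⊤ → U' c = ⊤ := by
    intro U U' c h1 h2 h3
    refine top_le_iff.1 fun x _ => ?_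
    obtain ⟨u, hu, e⟩ := h2 (r x)
    obtain ⟨y, hy⟩ := (hex (x - u)).1 (by rw [map_sub, e, sub_self])
    have : x - u ∈ U' c := hy ▸ (h1 y).2 (h3 ▸ Submodule.mem_top)
    simpa using add_mem this hu
  obtain ⟨w0, hw0⟩ := h.botW
  obtain ⟨w0', hw0'⟩ := h''.botW
  obtain ⟨w1, hw1⟩ := h.topW
  obtain ⟨w1', hw1'⟩ := h''.topW
  obtain ⟨f0, hf0⟩ := h.botF
  obtain ⟨f0', hf0'⟩ := h''.botF
  obtain ⟨f1, hf1⟩ := h.topF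
  obtain ⟨f1', hf1'⟩ := h''.topF
  obtain ⟨g0, hg0⟩ := h.botG
  obtain ⟨g0', hg0'⟩ := h''.botG
  obtain ⟨g1, hg1⟩ := h.topG
  obtain ⟨g1', hg1'⟩ := h''.topG
  exact {
    monoW := monoW
    antiF := antiF
    antiG := antiG
    botW := ⟨min w0 w0', bot _ (hW _) (rW _) (le_bot_iff.1 (hw0 ▸ h.monoW (min_le_left _ _)))
      (le_bot_iff.1 (hw0' ▸ h''.monoW (min_le_right _ _)))⟩
    topW := ⟨max w1 w1', top _ (hW _) (fun y => by
      obtain ⟨u, hu, -, e⟩ := sF (max w1 w1') f1' y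
        (h''.monoW (le_max_right _ _) (hw1' ▸ Submodule.mem_top)) (hf1' ▸ Submodule.mem_top)
      exact ⟨u, hu, e⟩) (top_le_iff.1 (hw1 ▸ h.monoW (le_max_left _ _)))⟩
    topF := ⟨min f1 f1', top _ (hF _) (fun y => by
      obtain ⟨u, -, hu, e⟩ := sF w1' (min f1 f1') y (hw1' ▸ Submodule.mem_top)
        (h''.antiF (min_le_right _ _) (hf1' ▸ Submodule.mem_top))
      exact ⟨u, hu, e⟩) (top_le_iff.1 (hf1 ▸ h.antiF (min_le_left _ _)))⟩
    botF := ⟨max f0 f0', bot _ (hF _) (rF _) (le_bot_iff.1 (hf0 ▸ h.antiF (le_max_left _ _)))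
      (le_bot_iff.1 (hf0' ▸ h''.antiF (le_max_right _ _)))⟩
    topG := ⟨min g1 g1', top _ (hG _) (fun y => by
      obtain ⟨u, -, hu, e⟩ := sG w1' (min g1 g1') y (hw1' ▸ Submodule.mem_top)
        (h''.antiG (min_le_right _ _) (hg1' ▸ Submodule.mem_top))
      exact ⟨u, hu, e⟩) (top_le_iff.1 (hg1 ▸ h.antiG (min_le_left _ _)))⟩
    botG := ⟨max g0 g0', bot _ (hG _) (rG _) (le_bot_iff.1 (hg0 ▸ h.antiG (le_max_left _ _)))
      (le_bot_iff.1 (hg0' ▸ h''.antiG (le_max_right _ _)))⟩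
    -- Decompose the image in the quotient, lift the three parts inside the right filtration steps,
    -- and decompose the remaining error in the sub.
    span := fun p q k hpq x hx => by
      obtain ⟨u, v, w, hu, hu', hv, hv', hw, e⟩ := h''.span p q k hpq _ (rW k x hx)
      obtain ⟨u1, a1, a2, rfl⟩ := sF k p u hu' hu
      obtain ⟨v1, b1, b2, rfl⟩ := sG k q v hv' hv
      obtain ⟨w1, c1, -, rfl⟩ := sF (k - 1) f1' w hw (hf1' ▸ Submodule.mem_top)
      obtain ⟨y, hy⟩ := (hex (x - (u1 + v1 + w1))).1 (by
        rw [map_sub, e, map_add, map_add, sub_self])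
      have hyW : y ∈ W k := (hW k y).1 (hy ▸ sub_mem hx
        (add_mem (add_mem a1 b1) (monoW (by omega) c1)))
      obtain ⟨u2, v2, w2, d1, d2, d3, d4, d5, rfl⟩ := h.span p q k hpq y hyW
      refine ⟨u1 + i u2, v1 + i v2, w1 + i w2, add_mem a2 ((hF _ _).2 d1),
        add_mem a1 ((hW _ _).2 d2), add_mem b2 ((hG _ _).2 d3), add_mem b1 ((hW _ _).2 d4),
        add_mem c1 ((hW _ _).2 d5), ?_⟩
      rw [map_add, map_add, eq_sub_iff_add_eq] at hy
      rw [← hy]; abel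
    -- Opposedness of the quotient puts the images of `u` and `v` in weight `k - 1`. Subtracting
    -- lifts taken in `W' (k - 1)` together with `F' p`, respectively `G' q`, moves the question to
    -- the sub without changing it modulo `W' (k - 1)`.
    inter := fun p q k hpq u v hu hu' hv hv' huv => by
      have h1 : r u ∈ W'' (k - 1) := h''.inter p q k hpq (r u) (r v) (rF _ _ hu) (rW _ _ hu')
        (rG _ _ hv) (rW _ _ hv') (by rw [← map_sub]; exact rW _ _ huv)
      have h2 : r v ∈ W'' (k - 1) := by
        have := sub_mem h1 (rW _ _ huv)
        rwa [map_sub, sub_sub_cancel] at this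
      obtain ⟨u1, a1, a2, e1⟩ := sF (k - 1) p _ h1 (rF _ _ hu)
      obtain ⟨v1, b1, b2, e2⟩ := sG (k - 1) q _ h2 (rG _ _ hv)
      obtain ⟨y, hy⟩ := (hex (u - u1)).1 (by rw [map_sub, e1, sub_self])
      obtain ⟨z, hz⟩ := (hex (v - v1)).1 (by rw [map_sub, e2, sub_self])
      have hk : W' (k - 1) ≤ W' k := monoW (by omega)
      have := h.inter p q k hpq y z ((hF _ _).1 (hy ▸ sub_mem hu a2))
        ((hW _ _).1 (hy ▸ sub_mem hu' (hk a1))) ((hG _ _).1 (hz ▸ sub_mem hv b2))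
        ((hW _ _).1 (hz ▸ sub_mem hv' (hk b1))) ((hW _ _).1 (by
          rw [map_sub, hy, hz, sub_sub_sub_comm]
          exact sub_mem huv (sub_mem a1 b1)))
      have h3 := (hW _ _).2 this
      rw [hy] at h3
      simpa using add_mem h3 a1 }

/-! ### Complexification of rational maps and subspaces -/

section Complexification

variable {A B C : Type*} [AddCommGroup A] [AddCommGroup B] [AddCommGroup C]

theorem ratToComplex_smul (q : ℚ) (x : ℚ ⊗[ℤ] A) :
    ratToComplex A (q • x) = (q : ℂ) • ratToComplex A x := by
  induction x with
  | zero => simp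
  | add x y hx hy => simp [hx, hy]
  | tmul z x => simp [TensorProduct.smul_tmul']

theorem conjC_ratToComplex (x : ℚ ⊗[ℤ] A) : conjC A (ratToComplex A x) = ratToComplex A x := by
  induction x with
  | zero => simp
  | add x y hx hy => simp [hx, hy]
  | tmul z x => simp

/-- A complexified subspace is spanned by rational vectors, which conjugation fixes. Conjugating a
map that respects weights therefore gives another such map, which supplies the lifts for the
conjugate Hodge filtration. -/
theorem conjC_mem_complexify {U : Submodule ℚ (ℚ ⊗[ℤ] A)} {x : ℂ ⊗[ℤ] A}
    (hx : x ∈ complexify U) : conjC A x ∈ complexify U := by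
  refine Submodule.span_induction (p := fun x _ => conjC A x ∈ complexify U) ?_ ?_ ?_ ?_ hx
  · rintro _ ⟨y, hy, rfl⟩
    rw [conjC_ratToComplex]
    exact ratToComplex_mem_complexify.2 hy
  · simp
  · intro x y _ _ hx hy
    rw [map_add]; exact add_mem hx hy
  · intro c x _ hx
    rw [conjC_smul]; exact Submodule.smul_mem _ _ hx

/-- The complex linear extension of a rational map. -/
noncomputable def complexifyMap (t : ℚ ⊗[ℤ] A →ₗ[ℚ] ℚ ⊗[ℤ] B) : ℂ ⊗[ℤ] A →ₗ[ℂ] ℂ ⊗[ℤ] B :=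
  (ratToComplex B ∘ₗ t.restrictScalars ℤ ∘ₗ TensorProduct.mk ℤ ℚ A 1).liftBaseChange ℂ

theorem complexifyMap_ratToComplex (t : ℚ ⊗[ℤ] A →ₗ[ℚ] ℚ ⊗[ℤ] B) (x : ℚ ⊗[ℤ] A) :
    complexifyMap t (ratToComplex A x) = ratToComplex B (t x) := by
  induction x with
  | zero => simp
  | add x y hx hy => simp [hx, hy]
  | tmul q x =>
    have : q ⊗ₜ[ℤ] x = q • ((1 : ℚ) ⊗ₜ[ℤ] x) := by simp [TensorProduct.smul_tmul']
    rw [this, ratToComplex_smul, map_smul, map_smul, ratToComplex_smul]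
    simp [complexifyMap]
    rfl

theorem complex_linearMap_ext {V : Type*} [AddCommGroup V] [Module ℂ V]
    {f g : ℂ ⊗[ℤ] A →ₗ[ℂ] V} (h : ∀ x, f (ratToComplex A x) = g (ratToComplex A x)) : f = g := by
  refine LinearMap.ext fun x => ?_
  induction x with
  | zero => simp
  | add x y hx hy => simp [hx, hy]
  | tmul z x =>
    have : z ⊗ₜ[ℤ] x = z • ratToComplex A (1 ⊗ₜ x) := by simp [TensorProduct.smul_tmul']
    rw [this, map_smul, map_smul, h]

theorem baseChange_complexifyMap (f : B →ₗ[ℤ] C) (t : ℚ ⊗[ℤ] A →ₗ[ℚ] ℚ ⊗[ℤ] B)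
    (t' : ℚ ⊗[ℤ] A →ₗ[ℚ] ℚ ⊗[ℤ] C) (h : ∀ x, f.baseChange ℚ (t x) = t' x) (x : ℂ ⊗[ℤ] A) :
    f.baseChange ℂ (complexifyMap t x) = complexifyMap t' x := by
  have : f.baseChange ℂ ∘ₗ complexifyMap t = complexifyMap t' :=
    complex_linearMap_ext fun x => by
      rw [LinearMap.comp_apply, complexifyMap_ratToComplex, complexifyMap_ratToComplex,
        baseChange_ratToComplex, h]
  exact LinearMap.congr_fun this x

theorem complexifyMap_id_of_forall {t : ℚ ⊗[ℤ] A →ₗ[ℚ] ℚ ⊗[ℤ] A} (h : ∀ x, t x = x)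
    (x : ℂ ⊗[ℤ] A) : complexifyMap t x = x := by
  have : complexifyMap t = LinearMap.id := complex_linearMap_ext fun x => by
    rw [complexifyMap_ratToComplex, h]; rfl
  exact LinearMap.congr_fun this x

theorem complexifyMap_mem {t : ℚ ⊗[ℤ] A →ₗ[ℚ] ℚ ⊗[ℤ] B} {U : Submodule ℚ (ℚ ⊗[ℤ] A)}
    {V : Submodule ℚ (ℚ ⊗[ℤ] B)} (h : ∀ x ∈ U, t x ∈ V) {x : ℂ ⊗[ℤ] A} (hx : x ∈ complexify U) :
    complexifyMap t x ∈ complexify V := by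
  have : complexify U ≤ (complexify V).comap (complexifyMap t) := by
    refine Submodule.span_le.2 ?_
    rintro _ ⟨y, hy, rfl⟩
    rw [SetLike.mem_coe, Submodule.mem_comap, complexifyMap_ratToComplex]
    exact ratToComplex_mem_complexify.2 (h y hy)
  exact this hx

end Complexification

/-! ### Lifting extensions of finitely generated abelian groups -/

/-- Extensions of finitely generated abelian groups lift along surjections. -/
theorem exists_int_extension_lift {A B C E : Type u} [AddCommGroup A] [AddCommGroup B]
    [AddCommGroup C] [AddCommGroup E] [Module.Finite ℤ A] [Module.Finite ℤ B]
    (π : B →ₗ[ℤ] C) (hπ : Function.Surjective π) (i : C →ₗ[ℤ] E) (g : E →ₗ[ℤ] A)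
    (hi : Function.Injective i) (hg : Function.Surjective g)
    (hex : ∀ x, g x = 0 ↔ ∃ y, i y = x) :
    ∃ (G : Type u) (_ : AddCommGroup G) (_ : Module.Finite ℤ G) (j : B →ₗ[ℤ] G) (q : G →ₗ[ℤ] E),
      Function.Injective j ∧ Function.Surjective q ∧ q ∘ₗ j = i ∘ₗ π ∧
      ∀ x, g (q x) = 0 ↔ ∃ y, j y = x := by
  -- From a presentation `0 → ker p → ℤ^m → A → 0`, the extension `E` is encoded by a map `φ : ker p
  -- → C`.
  obtain ⟨m, p, hp⟩ := Module.Finite.exists_fin' ℤ A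
  obtain ⟨l, hl⟩ := Module.projective_lifting_property g p hg
  replace hl : ∀ x, g (l x) = p x := fun x => LinearMap.congr_fun hl x
  let φ : LinearMap.ker p →ₗ[ℤ] C :=
    LinearMap.codRestrictOfInjective (l ∘ₗ (LinearMap.ker p).subtype) i hi fun x =>
      (hex _).1 ((hl _).trans x.2)
  have hφ : ∀ x : LinearMap.ker p, i (φ x) = l x.1 := fun x =>
    LinearMap.codRestrictOfInjective_comp_apply _ _ _ _ _
  -- This is the vanishing of `Ext²` over `ℤ`: a subgroup of a free group is free, so `φ` lifts
  -- through `π`.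
  obtain ⟨φ', hφ'⟩ := Module.projective_lifting_property π φ hπ
  replace hφ' : ∀ x, π (φ' x) = φ x := fun x => LinearMap.congr_fun hφ' x
  -- The group `G` is the pushout of `ker p ⊆ ℤ^m` along `φ'`, written as a quotient of `B × ℤ^m`.
  -- The map to `E` is `i ∘ π` on `B` and `l` on `ℤ^m`.
  let ψ : LinearMap.ker p →ₗ[ℤ] B × (Fin m → ℤ) := φ'.prod (-(LinearMap.ker p).subtype)
  have hψ : LinearMap.range ψ ≤ LinearMap.ker ((i ∘ₗ π).coprod l) := by
    rintro _ ⟨x, rfl⟩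
    simp [ψ, hφ', hφ]
  let q : ((B × (Fin m → ℤ)) ⧸ LinearMap.range ψ) →ₗ[ℤ] E :=
    (LinearMap.range ψ).liftQ ((i ∘ₗ π).coprod l) hψ
  have hq : ∀ b f, q ((LinearMap.range ψ).mkQ (b, f)) = i (π b) + l f := fun b f => rfl
  have hgi : ∀ c, g (i c) = 0 := fun c => (hex _).2 ⟨c, rfl⟩
  refine ⟨(B × (Fin m → ℤ)) ⧸ LinearMap.range ψ, inferInstance, inferInstance,
    (LinearMap.range ψ).mkQ ∘ₗ LinearMap.inl ℤ _ _, q, ?_, ?_, ?_, ?_⟩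
  · refine (injective_iff_map_eq_zero _).2 fun b hb => ?_
    obtain ⟨x, hx⟩ := (Submodule.Quotient.mk_eq_zero (LinearMap.range ψ)).1 hb
    have h2 : -x.1 = 0 := congrArg Prod.snd hx
    have h1 : φ' x = b := congrArg Prod.fst hx
    have : x = 0 := Subtype.ext (neg_eq_zero.1 h2)
    rw [← h1, this, map_zero]
  · intro e
    obtain ⟨f, hf⟩ := hp (g e)
    obtain ⟨c, hc⟩ := (hex (e - l f)).1 (by rw [map_sub, hl, hf, sub_self])
    obtain ⟨b, rfl⟩ := hπ c
    exact ⟨(LinearMap.range ψ).mkQ (b, f), by rw [hq, hc, sub_add_cancel]⟩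
  · refine LinearMap.ext fun b => ?_
    change i (π b) + l 0 = i (π b)
    rw [map_zero, add_zero]
  · intro x
    obtain ⟨⟨b, f⟩, rfl⟩ := Submodule.mkQ_surjective _ x
    rw [hq, map_add, hgi, hl, zero_add]
    constructor
    · intro hf
      refine ⟨b + φ' ⟨f, hf⟩, ?_⟩
      refine (Submodule.Quotient.eq (LinearMap.range ψ)).2 ⟨⟨f, hf⟩, ?_⟩
      exact Prod.ext (by simp [ψ]) (by simp [ψ])
    · rintro ⟨y, hy⟩
      obtain ⟨z, hz⟩ := (Submodule.Quotient.eq (LinearMap.range ψ)).1 hy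
      have h2 : -z.1 = 0 - f := congrArg Prod.snd hz
      rw [show f = z.1 by simpa using h2.symm]
      exact z.2

/-! ### Submodules of a split extension -/

section SplitSum

variable {R M E N : Type*} [Ring R] [AddCommGroup M] [Module R M] [AddCommGroup E] [Module R E]
  [AddCommGroup N] [Module R N] {i : M →ₗ[R] E} {r : E →ₗ[R] N} {s : N →ₗ[R] E}

theorem map_mem_of_mem_sup_map (hri : ∀ y, r (i y) = 0) (hs : ∀ y, r (s y) = y)
    {U : Submodule R M} {V : Submodule R N} {x : E} (hx : x ∈ U.map i ⊔ V.map s) : r x ∈ V := by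
  obtain ⟨_, ⟨a, ha, rfl⟩, _, ⟨b, hb, rfl⟩, rfl⟩ := Submodule.mem_sup.1 hx
  rwa [map_add, hri, hs, zero_add]

theorem mem_sup_map_iff (hi : Function.Injective i) (hri : ∀ y, r (i y) = 0)
    (hs : ∀ y, r (s y) = y) {U : Submodule R M} {V : Submodule R N} {y : M} :
    i y ∈ U.map i ⊔ V.map s ↔ y ∈ U := by
  refine ⟨fun hy => ?_, fun hy => Submodule.mem_sup_left ⟨y, hy, rfl⟩⟩
  obtain ⟨_, ⟨a, ha, rfl⟩, _, ⟨b, hb, rfl⟩, e⟩ := Submodule.mem_sup.1 hy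
  have : b = 0 := by rw [← hs b, ← zero_add (r (s b)), ← hri a, ← map_add, e, hri, hri]
  rw [this, map_zero, add_zero] at e
  exact hi e ▸ ha

end SplitSum

/-! ### Extensions of mixed Hodge structures: levels and lifting -/

namespace MHS

variable {A B C E : MHS.{u}}

theorem WC_of_surjective (f : A ⟶ B) (hf : Function.Surjective f.toLin) (k : ℤ)
    (y : ℂ ⊗[ℤ] B.carrier) (hy : y ∈ B.WC k) : ∃ x ∈ A.WC k, Hom.toC f x = y := by
  obtain ⟨y, rfl⟩ := baseChange_surjective ℂ hf y
  exact Opposed.strictW (Hom.toC f) A.opposed B.opposed (map_WC f) f.map_F (map_Fbar f) k _ hy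

/-- Strictness for `F` gives a lift in `F p`; bistrictness then moves it into `WC k` without leaving
`F p`. Strictness for each filtration separately would not suffice. -/
theorem WC_inf_F_of_surjective (f : A ⟶ B) (hf : Function.Surjective f.toLin) (k p : ℤ)
    (y : ℂ ⊗[ℤ] B.carrier) (hy : y ∈ B.WC k) (hy' : y ∈ B.F p) :
    ∃ x ∈ A.WC k ⊓ A.F p, Hom.toC f x = y := by
  obtain ⟨x, hx, rfl⟩ := F_of_surjective f hf p y hy'
  obtain ⟨a, h1, h2, h3⟩ := Opposed.strictFW (Hom.toC f) A.opposed B.opposed (map_WC f) f.map_F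
    (map_Fbar f) k p x hx hy
  exact ⟨a, ⟨h2, h1⟩, h3⟩

theorem WC_inf_Fbar_of_surjective (f : A ⟶ B) (hf : Function.Surjective f.toLin) (k p : ℤ)
    (y : ℂ ⊗[ℤ] B.carrier) (hy : y ∈ B.WC k) (hy' : y ∈ B.Fbar p) :
    ∃ x ∈ A.WC k ⊓ A.Fbar p, Hom.toC f x = y := by
  obtain ⟨y, rfl⟩ := baseChange_surjective ℂ hf y
  obtain ⟨x, hx, e⟩ := Opposed.strictF' (Hom.toC f) A.opposed.swap B.opposed.swap (map_WC f)
    (map_Fbar f) f.map_F p y hy'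
  obtain ⟨a, h1, h2, h3⟩ := Opposed.strictFW (Hom.toC f) A.opposed.swap B.opposed.swap (map_WC f)
    (map_Fbar f) f.map_F k p x hx (e ▸ hy)
  exact ⟨a, ⟨h2, h1⟩, h3.trans e⟩

/-- Mixed Hodge structures of level `≤ n` are closed under extensions. -/
theorem IsOfLevel.extension {n : ℕ} (hB : B.IsOfLevel n) (hA : A.IsOfLevel n) (j : B ⟶ E)
    (r : E ⟶ A) (hj : Function.Injective j.toLin) (hr : Function.Surjective r.toLin)
    (hex : ∀ x, r.toLin x = 0 ↔ ∃ y, j.toLin y = x) : E.IsOfLevel n := by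
  rw [isOfLevel_iff] at hA hB ⊢
  intro p q k hpq hn u v hu hu' hv hv' huv
  have hexC : ∀ x, Hom.toC r x = 0 ↔ ∃ y, Hom.toC j y = x := baseChange_exact ℂ flatC hex
  -- A pair representing a forbidden type is first shown to have lower weight in `A`. Correcting it
  -- by lifts from weight `k - 1` then leaves a pair coming from `B`, where the same type is
  -- forbidden.
  have h1 : Hom.toC r u ∈ A.WC (k - 1) := hA p q k hpq hn _ (Hom.toC r v) (r.map_F _ _ hu)
    (map_WC r _ _ hu') (map_Fbar r _ _ hv) (map_WC r _ _ hv')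
    (by rw [← map_sub]; exact map_WC r _ _ huv)
  have h2 : Hom.toC r v ∈ A.WC (k - 1) := by
    have := sub_mem h1 (map_WC r _ _ huv)
    rwa [map_sub, sub_sub_cancel] at this
  obtain ⟨u1, ⟨a1, a2⟩, e1⟩ := WC_inf_F_of_surjective r hr (k - 1) p _ h1 (r.map_F _ _ hu)
  obtain ⟨v1, ⟨b1, b2⟩, e2⟩ := WC_inf_Fbar_of_surjective r hr (k - 1) q _ h2 (map_Fbar r _ _ hv)
  obtain ⟨y, hy⟩ := (hexC (u - u1)).1 (by rw [map_sub, e1, sub_self])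
  obtain ⟨z, hz⟩ := (hexC (v - v1)).1 (by rw [map_sub, e2, sub_self])
  have hk : E.WC (k - 1) ≤ E.WC k := E.opposed.monoW (by omega)
  have hF : ∀ (p : ℤ) y, Hom.toC j y ∈ E.Fbar p → y ∈ B.Fbar p := by
    intro p y hy
    refine F_of_injective j hj p _ ?_
    rw [Hom.toC, baseChange_conjC]
    exact hy
  have := hB p q k hpq hn y z (F_of_injective j hj _ _ (hy ▸ sub_mem hu a2))
    (WC_of_injective j hj _ _ (hy ▸ sub_mem hu' (hk a1)))
    (hF _ _ (hz ▸ sub_mem hv b2)) (WC_of_injective j hj _ _ (hz ▸ sub_mem hv' (hk b1)))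
    (WC_of_injective j hj _ _ (by
      rw [map_sub, hy, hz, sub_sub_sub_comm]
      exact sub_mem huv (sub_mem a1 b1)))
  have h3 := map_WC j _ _ this
  rw [hy] at h3
  simpa using add_mem h3 a1

/-- Extensions of mixed Hodge structures lift along epimorphisms. -/
theorem exists_extension_lift (π : B ⟶ C) (hπ : Function.Surjective π.toLin) (i : C ⟶ E)
    (g : E ⟶ A) (hi : Function.Injective i.toLin) (hg : Function.Surjective g.toLin)
    (hex : ∀ x, g.toLin x = 0 ↔ ∃ y, i.toLin y = x) :
    ∃ (E' : MHS.{u}) (j : B ⟶ E') (q : E' ⟶ E), Function.Injective j.toLin ∧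
      Function.Surjective q.toLin ∧ j ≫ q = π ≫ i ∧
      ∀ x, g.toLin (q.toLin x) = 0 ↔ ∃ y, j.toLin y = x := by
  -- The underlying groups come first; it remains to put filtrations on `G`, which are built from
  -- splittings of `G → A`.
  obtain ⟨G, _, _, j, q, hj, hq, hqj, hexG⟩ :=
    exists_int_extension_lift π.toLin hπ i.toLin g.toLin hi hg hex
  -- A rational splitting `σ` of `E → A` respecting `W`; `s` lifts it to `G`. Nothing is required of
  -- `s` beyond this, since `W'` is defined from it.
  obtain ⟨σ, hσ, hσW⟩ := exists_filtered_lift A.monotone_W A.exists_W_bot A.exists_W_top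
    E.monotone_W (g.toLin.baseChange ℚ) LinearMap.id (W_of_surjective g hg)
  replace hσ : ∀ x, g.toLin.baseChange ℚ (σ x) = x := hσ
  obtain ⟨s, hs⟩ := Module.projective_lifting_property (q.baseChange ℚ) σ
    (baseChange_surjective ℚ hq)
  replace hs : ∀ x, q.baseChange ℚ (s x) = σ x := fun x => LinearMap.congr_fun hs x
  -- A complex splitting respecting `W` and `F` at once. It need not be the complexification of a
  -- rational one, and the discrepancy records the Hodge filtration of the extension.
  obtain ⟨σF, hσF, hσFW⟩ := exists_bifiltered_lift A.opposed.monoW A.opposed.antiF A.opposed.botW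
    A.opposed.topW A.opposed.topF A.opposed.botF
    (S := fun k p => E.WC k ⊓ E.F p)
    (fun k k' p p' hk hp => inf_le_inf (E.opposed.monoW hk) (E.opposed.antiF hp))
    (Hom.toC g) LinearMap.id (WC_inf_F_of_surjective g hg)
  replace hσF : ∀ x, Hom.toC g (σF x) = x := hσF
  have hσC : ∀ x, Hom.toC g (complexifyMap σ x) = x := fun x =>
    (baseChange_complexifyMap g.toLin σ LinearMap.id hσ x).trans
      (complexifyMap_id_of_forall (fun _ => rfl) x)
  have hexC : ∀ x, Hom.toC g x = 0 ↔ ∃ y, Hom.toC i y = x := baseChange_exact ℂ flatC hex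
  -- Two splittings differ by a map into the sub. Both respect `W`, hence so does `ε`, and
  -- strictness lifts it to a map `δ` into `B` that still respects `W`.
  let ε : ℂ ⊗[ℤ] A.carrier →ₗ[ℂ] ℂ ⊗[ℤ] C.carrier :=
    LinearMap.codRestrictOfInjective (σF - complexifyMap σ) (Hom.toC i) (toC_injective i hi)
      fun x => (hexC _).1 (by rw [LinearMap.sub_apply, map_sub, hσF, hσC, sub_self])
  have hε : ∀ x, Hom.toC i (ε x) = σF x - complexifyMap σ x := fun x =>
    LinearMap.codRestrictOfInjective_comp_apply _ _ _ _ _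
  obtain ⟨t, ht⟩ := A.exists_F_top
  have hεW : ∀ k, ∀ x ∈ A.WC k, ε x ∈ C.WC k := fun k x hx => WC_of_injective i hi k _ (by
    rw [hε]
    exact sub_mem (hσFW k t x hx (ht ▸ Submodule.mem_top)).1 (complexifyMap_mem (hσW k) hx))
  obtain ⟨δ, hδ, hδW⟩ := exists_filtered_lift A.opposed.monoW A.opposed.botW A.opposed.topW
    B.opposed.monoW (Hom.toC π) ε fun k x hx => WC_of_surjective π hπ k _ (hεW k x hx)
  -- Correcting the rational splitting by `δ` makes `sF` a lift of `σF`, so the `F'` built from it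
  -- maps into the filtration of `E`. As `δ` respects `W`, so does `sF`, which gives the
  -- simultaneous lifts in `W'` and `F'`.
  let sF : ℂ ⊗[ℤ] A.carrier →ₗ[ℂ] ℂ ⊗[ℤ] G := complexifyMap s + j.baseChange ℂ ∘ₗ δ
  let W' : ℤ → Submodule ℚ (ℚ ⊗[ℤ] G) := fun k =>
    (B.W k).map (j.baseChange ℚ) ⊔ (A.W k).map s
  let F' : ℤ → Submodule ℂ (ℂ ⊗[ℤ] G) := fun p =>
    (B.F p).map (j.baseChange ℂ) ⊔ (A.F p).map sF
  let r : G →ₗ[ℤ] A.carrier := g.toLin ∘ₗ q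
  have hqjC : ∀ (R : Type) [CommRing R] (x : R ⊗[ℤ] B.carrier),
      q.baseChange R (j.baseChange R x) = i.toLin.baseChange R (π.toLin.baseChange R x) := by
    intro R _ x
    rw [← LinearMap.comp_apply, ← LinearMap.baseChange_comp, hqj, LinearMap.baseChange_comp]
    rfl
  have hr : ∀ (R : Type) [CommRing R] (x : R ⊗[ℤ] G),
      r.baseChange R x = g.toLin.baseChange R (q.baseChange R x) := by
    intro R _ x
    rw [LinearMap.baseChange_comp]; rfl
  have hqsF : ∀ x, q.baseChange ℂ (sF x) = σF x := by
    intro x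
    change q.baseChange ℂ (complexifyMap s x + j.baseChange ℂ (δ x)) = _
    rw [map_add, baseChange_complexifyMap q s σ hs, hqjC]
    change _ + Hom.toC i (Hom.toC π (δ x)) = _
    rw [hδ, hε, add_sub_cancel]
  have hexr : ∀ x, r x = 0 ↔ ∃ y, j y = x := hexG
  have hexrC : ∀ x, r.baseChange ℂ x = 0 ↔ ∃ y, j.baseChange ℂ y = x :=
    baseChange_exact ℂ flatC hexr
  have hexrQ : ∀ x, r.baseChange ℚ x = 0 ↔ ∃ y, j.baseChange ℚ y = x :=
    baseChange_exact ℚ flatQ hexr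
  have hrjC : ∀ y, r.baseChange ℂ (j.baseChange ℂ y) = 0 := fun y => (hexrC _).2 ⟨y, rfl⟩
  have hrjQ : ∀ y, r.baseChange ℚ (j.baseChange ℚ y) = 0 := fun y => (hexrQ _).2 ⟨y, rfl⟩
  have hrsQ : ∀ y, r.baseChange ℚ (s y) = y := fun y => by rw [hr, hs, hσ]
  have hrsF : ∀ y, r.baseChange ℂ (sF y) = y := fun y => by
    rw [hr, hqsF]; exact hσF y
  have hjC : Function.Injective (j.baseChange ℂ) := baseChange_injective ℂ flatC hj
  have hjQ : Function.Injective (j.baseChange ℚ) := baseChange_injective ℚ flatQ hj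
  have monoW : Monotone fun k => complexify (W' k) := fun a b hab => complexify_mono
    (sup_le_sup (Submodule.map_mono (B.monotone_W hab)) (Submodule.map_mono (A.monotone_W hab)))
  have antiF : Antitone F' := fun a b hab =>
    sup_le_sup (Submodule.map_mono (B.antitone_F hab)) (Submodule.map_mono (A.antitone_F hab))
  have hjW : ∀ k, (W' k).comap (j.baseChange ℚ) = B.W k := fun k =>
    Submodule.ext fun y => mem_sup_map_iff hjQ hrjQ hrsQ
  have hrW : ∀ k x, x ∈ complexify (W' k) → r.baseChange ℂ x ∈ A.WC k := by
    intro k x hx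
    have : W' k ≤ (A.W k).comap (r.baseChange ℚ) := fun y hy => map_mem_of_mem_sup_map hrjQ hrsQ hy
    have := complexify_mono this hx
    rwa [complexify_comap] at this
  have hjF : ∀ p y, j.baseChange ℂ y ∈ F' p ↔ y ∈ B.F p := fun p y =>
    mem_sup_map_iff hjC hrjC hrsF
  have hrF : ∀ p x, x ∈ F' p → r.baseChange ℂ x ∈ A.F p := fun p x hx =>
    map_mem_of_mem_sup_map hrjC hrsF hx
  have hsFW : ∀ k y, y ∈ A.WC k → sF y ∈ complexify (W' k) := by
    intro k y hy
    have hsW : ∀ x ∈ A.W k, s x ∈ W' k := fun x hx =>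
      Submodule.mem_sup_right (Submodule.mem_map_of_mem hx)
    refine add_mem (complexifyMap_mem hsW hy) ?_
    have := hδW k y hy
    rw [WC, ← hjW, complexify_comap] at this
    exact this
  have opp : Opposed (fun k => complexify (W' k)) F' (fun k => conjSub (F' k)) := by
    refine Opposed.extension B.opposed A.opposed (j.baseChange ℂ) (r.baseChange ℂ) hexrC monoW
      antiF (fun a b hab x hx => antiF hab hx) ?_ hjF ?_ hrW hrF ?_ ?_ ?_
    · intro k y
      rw [WC, ← hjW, complexify_comap]; rfl
    · intro k y
      rw [mem_conjSub, ← baseChange_conjC, hjF]; rfl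
    · intro k x hx
      have := hrF k _ hx
      rwa [baseChange_conjC] at this
    · intro k p y hy hy'
      exact ⟨sF y, hsFW k y hy, Submodule.mem_sup_right ⟨y, hy', rfl⟩, hrsF y⟩
    · intro k p y hy hy'
      -- The conjugate of the splitting `sF` respects the same weights and the conjugate Hodge
      -- filtration.
      refine ⟨conjC G (sF (conjC _ y)), conjC_mem_complexify (hsFW k _ (conjC_mem_complexify hy)),
        ?_, ?_⟩
      · rw [mem_conjSub, conjC_conjC]
        exact Submodule.mem_sup_right ⟨_, hy', rfl⟩
      · rw [baseChange_conjC, hrsF, conjC_conjC]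
  have hqW : ∀ k x, x ∈ W' k → q.baseChange ℚ x ∈ E.W k := by
    intro k x hx
    obtain ⟨_, ⟨a, ha, rfl⟩, _, ⟨b, hb, rfl⟩, rfl⟩ := Submodule.mem_sup.1 hx
    rw [map_add, hqjC, hs]
    exact add_mem (i.map_W _ _ (π.map_W _ _ ha)) (hσW _ _ hb)
  have hqF : ∀ p x, x ∈ F' p → q.baseChange ℂ x ∈ E.F p := by
    intro p x hx
    obtain ⟨_, ⟨a, ha, rfl⟩, _, ⟨b, hb, rfl⟩, rfl⟩ := Submodule.mem_sup.1 hx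
    obtain ⟨w, hw⟩ := A.opposed.topW
    rw [map_add, hqjC, hqsF]
    exact add_mem (i.map_F _ _ (π.map_F _ _ ha)) (hσFW w _ b (hw ▸ Submodule.mem_top) hb).2
  have hjW' : ∀ k x, x ∈ B.W k → j.baseChange ℚ x ∈ W' k := fun k x hx =>
    (mem_sup_map_iff hjQ hrjQ hrsQ).2 hx
  exact ⟨mk' G W' F' opp, ⟨j, hjW', fun p x hx => (hjF p x).2 hx⟩, ⟨q, hqW, hqF⟩, hj, hq,
    hom_ext hqj, hexG⟩

end MHS

/-! ### Short exact sequences of mixed Hodge structures -/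

namespace MHS

variable {A B C : MHS.{u}}

theorem shortExact_iff {f : A ⟶ B} {g : B ⟶ C} {w : f ≫ g = 0} :
    (ShortComplex.mk f g w).ShortExact ↔ Function.Injective f.toLin ∧
      Function.Surjective g.toLin ∧ ∀ x, g.toLin x = 0 ↔ ∃ y, f.toLin y = x := by
  have hw : ∀ y, g.toLin (f.toLin y) = 0 := LinearMap.congr_fun (congrArg Hom.toLin w)
  constructor
  · intro hS
    have : Mono f := hS.mono_f
    have : Epi g := hS.epi_g
    obtain ⟨l, hl⟩ := KernelFork.IsLimit.lift' hS.fIsKernel (kernelι g) (kernelι_comp g)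
    refine ⟨injective_of_mono f, surjective_of_epi g, fun x => ⟨fun hx => ⟨l.toLin ⟨x, hx⟩,
      LinearMap.congr_fun (congrArg Hom.toLin hl) ⟨x, hx⟩⟩, ?_⟩⟩
    rintro ⟨y, rfl⟩
    exact hw y
  · rintro ⟨h1, h2, h3⟩
    exact
      { exact := ShortComplex.exact_of_f_is_kernel _ (isKernel f g w h1 fun x => (h3 x).1)
        mono_f := mono_of_injective f h1
        epi_g := epi_of_surjective g h2 }

theorem quot_exact_of_exact (f : A ⟶ B) (g : B ⟶ C) (hf : Function.Injective f.toLin)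
    (hex : ∀ x, g.toLin x = 0 → ∃ y, f.toLin y = x) (p : ℤ) (x : B.HodgeQuot p)
    (hx : Hom.quot g p x = 0) : ∃ y, Hom.quot f p y = x := by
  obtain ⟨y, rfl⟩ := quot_exact g p x hx
  obtain ⟨l, hl⟩ := exists_lift f hf (kernelι g) fun y => hex _ y.2
  exact ⟨Hom.quot l p y, by rw [← quot_comp, hl]⟩

end MHS

/-! ### Exact endofunctors of formal Hodge structures and their comparison -/

namespace FHS

variable {n : ℕ} [NeZero n] {X Y Z : FHS.{u} n}

theorem shortExact_of_components {f : X ⟶ Y} {g : Y ⟶ Z} (w : f ≫ g = 0) (hf : Inj f)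
    (hg : Surj g) (hex : Ex f g) : (ShortComplex.mk f g w).ShortExact where
  exact := ShortComplex.exact_of_f_is_kernel _ (isKernel f g w hf hex)
  mono_f := mono_of_inj f hf
  epi_g := epi_of_surj g hg

theorem components_of_shortExact {S : ShortComplex (FHS.{u} n)} (hS : S.ShortExact) :
    Inj S.f ∧ Surj S.g ∧ Ex S.f S.g := by
  have := hS.mono_f
  have := hS.epi_g
  obtain ⟨l, hl⟩ := KernelFork.IsLimit.lift' hS.fIsKernel (kernelι S.g) (kernelι_comp S.g)
  replace hl : l ≫ S.f = kernelι S.g := hl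
  exact ⟨inj_of_mono S.f, surj_of_epi S.g,
    fun x hx => ⟨l.et.toLin ⟨x, hx⟩,
      LinearMap.congr_fun (congrArg (fun k => MHS.Hom.toLin (Hom.et k)) hl) ⟨x, hx⟩⟩,
    fun x hx => ⟨l.conn ⟨x, hx⟩, LinearMap.congr_fun (congrArg Hom.conn hl) ⟨x, hx⟩⟩,
    fun i x hx => ⟨l.V i ⟨x, hx⟩, LinearMap.congr_fun (congrArg (fun k => Hom.V k i) hl) ⟨x, hx⟩⟩⟩

theorem isIso_of_inj_of_surj (f : X ⟶ Y) (hf : Inj f) (hf' : Surj f) : IsIso f :=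
  haveI := mono_of_inj f hf
  haveI := epi_of_surj f hf'
  isIso_of_mono_of_epi f

section Etale

variable {A B C : MHS.{u}} {hA : A.IsOfLevel n} {hB : B.IsOfLevel n} {hC : C.IsOfLevel n}

/-- The morphism of étale formal Hodge structures attached to a morphism of mixed Hodge
structures. -/
noncomputable def ofMHSMap (f : A ⟶ B) (hA : A.IsOfLevel n) (hB : B.IsOfLevel n) :
    ofMHS A hA ⟶ ofMHS B hB where
  et := f
  conn := 0
  V _ := MHS.Hom.quot f _
  comm_v _ _ h x := MHS.quot_hodgeProj f (by omega) x
  comm_hEt x := MHS.quot_toHodgeQuot f _ x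
  comm_hConn _ := map_zero (MHS.Hom.quot f _)
  comm_π _ _ := rfl

/-- The maps `π_i` of an étale object are identities, so compatibility with `π` recovers the
components on `V` from the étale one, and the connected part of the target is trivial. Commutativity
of diagrams ending in étale objects is thus checked on mixed Hodge structures. -/
theorem ofMHS_hom_ext {f g : X ⟶ ofMHS B hB} (h : f.et = g.et) : f = g := by
  refine hom_ext h (LinearMap.ext fun _ => rfl) fun i => LinearMap.ext fun x => ?_
  refine (f.comm_π i x).trans (Eq.trans ?_ (g.comm_π i x).symm)
  rw [h]

/-- Strictness for the Hodge filtration makes each `H ↦ H_ℂ / F^p` exact. -/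
theorem ofMHSMap_shortExact {f : A ⟶ B} {g : B ⟶ C} {w : f ≫ g = 0}
    (h : (ShortComplex.mk f g w).ShortExact)
    (w' : ofMHSMap f hA hB ≫ ofMHSMap g hB hC = 0) :
    (ShortComplex.mk (ofMHSMap f hA hB) (ofMHSMap g hB hC) w').ShortExact := by
  obtain ⟨h1, h2, h3⟩ := MHS.shortExact_iff.1 h
  exact shortExact_of_components w'
    ⟨h1, fun _ _ _ => rfl, fun i => MHS.quot_injective f h1 _⟩
    ⟨h2, fun x => ⟨x, rfl⟩, fun i => MHS.quot_surjective g h2 _⟩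
    ⟨fun x => (h3 x).1, fun x _ => ⟨x, rfl⟩,
      fun i x hx => MHS.quot_exact_of_exact f g h1 (fun x => (h3 x).1) _ x hx⟩

end Etale

theorem forgetEt_map_shortExact {f : X ⟶ Y} {g : Y ⟶ Z} {w : f ≫ g = 0}
    (h : (ShortComplex.mk f g w).ShortExact) :
    (ShortComplex.mk f.et g.et (congrArg Hom.et w)).ShortExact :=
  forgetEt_shortExact _ h

variable (n) in
/-- The étale part `(H, V) ↦ (H_et, H_ℂ / F)` of a formal Hodge structure. -/
noncomputable def etPart : FHS.{u} n ⥤ FHS.{u} n where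
  obj X := ofMHS X.et X.level
  map f := ofMHSMap f.et _ _
  map_id _ := ofMHS_hom_ext rfl
  map_comp _ _ := ofMHS_hom_ext rfl

instance : (etPart.{u} n).Additive where
  map_add := ofMHS_hom_ext rfl

theorem etPart_shortExact (S : ShortComplex (FHS.{u} n)) (hS : S.ShortExact) :
    (S.map (etPart n)).ShortExact :=
  ofMHSMap_shortExact (forgetEt_map_shortExact hS) _

instance : PreservesFiniteLimits (etPart.{u} n) := by
  have h := ((Functor.exact_tfae (etPart.{u} n)).out 0 3).mp etPart_shortExact
  exact h.1

instance : PreservesFiniteColimits (etPart.{u} n) := by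
  have h := ((Functor.exact_tfae (etPart.{u} n)).out 0 3).mp etPart_shortExact
  exact h.2

/-- The formal Hodge structure with the same formal group as `X` and with `V_i = H_ℂ / F^i`. -/
noncomputable def hodgeObj (X : FHS.{u} n) : FHS.{u} n where
  et := X.et
  level := X.level
  conn := X.conn
  V i := X.et.HodgeQuot (i.1 + 1)
  v _ _ h := X.et.hodgeProj (by omega)
  hEt := X.et.toHodgeQuot _
  hConn := X.π (topIdx n) ∘ₗ X.hConn
  π _ := LinearMap.id
  π_hEt _ := rfl
  π_v _ _ _ _ := rfl

variable (n) in
/-- The functor replacing the spaces `V_i` by `H_ℂ / F^i`. -/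
noncomputable def hodgePart : FHS.{u} n ⥤ FHS.{u} n where
  obj X := hodgeObj X
  map {X Y} f :=
    { et := f.et
      conn := f.conn
      V := fun _ => MHS.Hom.quot f.et _
      comm_v := fun _ _ h x => MHS.quot_hodgeProj f.et (by omega) x
      comm_hEt := fun x => MHS.quot_toHodgeQuot f.et _ x
      comm_hConn := fun x => (f.comm_π _ _).symm.trans (congrArg (Y.π _) (f.comm_hConn x))
      comm_π := fun _ _ => rfl }
  map_id _ := hom_ext rfl rfl fun _ => LinearMap.ext (MHS.quot_id _)
  map_comp _ _ := hom_ext rfl rfl fun _ => LinearMap.ext (MHS.quot_comp _ _ _)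

instance : (hodgePart.{u} n).Additive where
  map_add := hom_ext rfl rfl fun _ => LinearMap.ext (MHS.quot_add _ _ _)

/-- The formal group is untouched, and on the spaces the claim is exactness of `H ↦ H_ℂ / F^p`. -/
theorem hodgePart_shortExact (S : ShortComplex (FHS.{u} n)) (hS : S.ShortExact) :
    (S.map (hodgePart n)).ShortExact := by
  obtain ⟨h1, h2, h3⟩ := components_of_shortExact hS
  exact shortExact_of_components _
    ⟨h1.1, h1.2.1, fun i => MHS.quot_injective S.f.et h1.1 _⟩
    ⟨h2.1, h2.2.1, fun i => MHS.quot_surjective S.g.et h2.1 _⟩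
    ⟨h3.1, h3.2.1, fun i x hx => MHS.quot_exact_of_exact S.f.et S.g.et h1.1 h3.1 _ x hx⟩

instance : PreservesFiniteLimits (hodgePart.{u} n) := by
  have h := ((Functor.exact_tfae (hodgePart.{u} n)).out 0 3).mp hodgePart_shortExact
  exact h.1

instance : PreservesFiniteColimits (hodgePart.{u} n) := by
  have h := ((Functor.exact_tfae (hodgePart.{u} n)).out 0 3).mp hodgePart_shortExact
  exact h.2

variable (n) in
/-- The canonical map `(H, V) → (H, H_ℂ / F)`. -/
noncomputable def toHodgePart : 𝟭 (FHS.{u} n) ⟶ hodgePart n where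
  app X :=
    { et := 𝟙 _
      conn := LinearMap.id
      V := X.π
      comm_v := X.π_v
      comm_hEt := X.π_hEt
      comm_hConn := fun _ => rfl
      comm_π := fun _ _ => (MHS.quot_id _ _).symm }
  naturality _ _ f := hom_ext ((Category.comp_id _).trans (Category.id_comp _).symm) rfl
    fun i => LinearMap.ext fun x => f.comm_π i x

variable (n) in
/-- The inclusion `(H_et, H_ℂ / F) → (H, H_ℂ / F)` of the étale part. -/
noncomputable def etPartToHodgePart : etPart.{u} n ⟶ hodgePart n where
  app X :=
    { et := 𝟙 _
      conn := 0
      V := fun _ => LinearMap.id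
      comm_v := fun _ _ _ _ => rfl
      comm_hEt := fun _ => rfl
      comm_hConn := fun _ => (map_zero (X.π (topIdx n) ∘ₗ X.hConn)).symm
      comm_π := fun _ _ => (MHS.quot_id _ _).symm }
  naturality _ _ f := hom_ext ((Category.comp_id _).trans (Category.id_comp _).symm)
    (LinearMap.ext fun _ => (map_zero f.conn).symm) fun _ => rfl

/-- The components of `toHodgePart` are two identities and the maps `π_i`. -/
theorem isIso_toHodgePart_app (h : ∀ i, Function.Bijective (X.π i)) :
    IsIso ((toHodgePart n).app X) :=
  isIso_of_inj_of_surj _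
    ⟨Function.injective_id, Function.injective_id, fun i => (h i).1⟩
    ⟨Function.surjective_id, Function.surjective_id, fun i => (h i).2⟩

instance (A : MHS.{u}) (hA : A.IsOfLevel n) : IsIso ((toHodgePart n).app (ofMHS A hA)) :=
  isIso_toHodgePart_app fun _ => Function.bijective_id

/-- The étale and hodge parts differ only in the connected part, which is trivial for an étale
object. -/
instance (A : MHS.{u}) (hA : A.IsOfLevel n) : IsIso ((etPartToHodgePart n).app (ofMHS A hA)) :=
  isIso_of_inj_of_surj _
    ⟨Function.injective_id, fun _ _ _ => rfl, fun _ => Function.injective_id⟩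
    ⟨Function.surjective_id, fun _ => ⟨PUnit.unit, rfl⟩, fun _ => Function.surjective_id⟩

/-- The maps `π_i` are surjective. -/
theorem π_surjective (X : FHS.{u} n) (i : Fin n) : Function.Surjective (X.π i) := by
  -- The composite of `π_n` with `h_et` is the canonical map, and the image of `H_et` spans `H_ℂ`
  -- over `ℂ`.
  have htop : Function.Surjective (X.π (topIdx n)) := by
    intro y
    obtain ⟨y, rfl⟩ := Submodule.mkQ_surjective _ y
    change ((X.et.F _).mkQ y) ∈ LinearMap.range (X.π (topIdx n))
    induction y with
    | zero => simp
    | add x y hx hy => rw [map_add]; exact add_mem hx hy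
    | tmul z x =>
      have : z ⊗ₜ[ℤ] x = z • ((1 : ℂ) ⊗ₜ[ℤ] x) := by simp [TensorProduct.smul_tmul']
      rw [this, map_smul]
      exact Submodule.smul_mem _ _ ⟨X.hEt x, X.π_hEt x⟩
  -- Descending from the top index, since the projections between the Hodge quotients are
  -- surjective; `d` is the distance to the top.
  have key : ∀ (d : ℕ) (i : Fin n), i.1 + d = n - 1 → Function.Surjective (X.π i) := by
    intro d
    induction d with
    | zero =>
      intro i hi
      obtain rfl : i = topIdx n := Fin.ext hi
      exact htop
    | succ d ih =>
      intro i hi y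
      obtain ⟨y, rfl⟩ := Submodule.mkQ_surjective _ y
      have hlt : i.1 + 1 < n := by omega
      obtain ⟨x, hx⟩ := ih ⟨i.1 + 1, hlt⟩ (by simp only; omega) ((X.et.F _).mkQ y)
      exact ⟨X.v ⟨i.1 + 1, hlt⟩ i rfl x, by rw [X.π_v, hx]; rfl⟩
  exact key (n - 1 - i.1) i (by have := i.2; omega)

/-- Dividing by `ker π_i` forces injectivity, while surjectivity holds for every formal Hodge
structure. -/
instance (X : FHS.{u} n) : IsIso ((toHodgePart n).app X.times) :=
  isIso_toHodgePart_app fun i =>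
    ⟨LinearMap.ker_eq_bot.1 (Submodule.ker_liftQ_eq_bot _ _ _ le_rfl), π_surjective X.times i⟩

instance (U : Type u) [AddCommGroup U] [Module ℂ U] [FiniteDimensional ℂ U] :
    IsIso ((toHodgePart n).app (ofConn n U)) :=
  isIso_toHodgePart_app fun i => ⟨fun _ _ _ => rfl, π_surjective _ i⟩

/-! ### Vanishing in degree at least 2 and comparison in degree 1 -/

open Abelian

/-- Classes of extensions of an étale object by an object with bijective maps `π_i` are determined
by their étale part. -/
theorem eq_zero_of_etPart_eq_zero {A : MHS.{u}} {hA : A.IsOfLevel n} [IsIso ((toHodgePart n).app Y)]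
    {i : ℕ} (x : Ext (ofMHS A hA) Y i) (hx : x.mapExactFunctor (etPart n) = 0) : x = 0 := by
  -- Naturality along `etPart → hodgePart`, invertible at the source, shows that the image under
  -- `hodgePart` vanishes.
  have h1 := mapExactFunctor_natTrans (etPartToHodgePart n) x
  rw [hx, Ext.zero_comp] at h1
  have h2 : x.mapExactFunctor (hodgePart n) = 0 := by
    rw [← Ext.mk₀_id_comp (x.mapExactFunctor (hodgePart n)),
      ← IsIso.inv_hom_id ((etPartToHodgePart n).app (ofMHS A hA)), ← Ext.mk₀_comp_mk₀_assoc,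
      ← h1, Ext.comp_zero]
  -- Naturality along `id → hodgePart` gives that `x` pushed to the hodge part of `Y` is zero, and
  -- this push is invertible at `Y`.
  have h3 := mapExactFunctor_natTrans (toHodgePart n) x
  rw [mapExactFunctor_id, h2, Ext.comp_zero] at h3
  rw [← Ext.comp_mk₀_id x]
  change x.comp (Ext.mk₀ (𝟙 ((𝟭 (FHS.{u} n)).obj Y))) (add_zero i) = 0
  rw [← IsIso.hom_inv_id ((toHodgePart n).app Y), ← Ext.mk₀_comp_mk₀,
    ← Ext.comp_assoc_of_third_deg_zero]
  exact (congrArg (fun z => z.comp (Ext.mk₀ (inv ((toHodgePart n).app Y))) (add_zero i)) h3).trans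
    (Ext.zero_comp _ _ _ _ _)

/-- The product of the étale parts of two extensions vanishes. -/
theorem etPart_extClass_comp_extClass {K P L Q : FHS.{u} n} {i : K ⟶ P} {p : P ⟶ X} {w : i ≫ p = 0}
    (hS : (ShortComplex.mk i p w).ShortExact) {j : L ⟶ Q} {q : Q ⟶ K} {w' : j ≫ q = 0}
    (hT : (ShortComplex.mk j q w').ShortExact) :
    (hS.extClass.mapExactFunctor (etPart n)).comp (hT.extClass.mapExactFunctor (etPart n))
      (rfl : 1 + 1 = 2) = 0 := by
  obtain ⟨a1, a2, a3⟩ := MHS.shortExact_iff.1 (forgetEt_map_shortExact hS)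
  obtain ⟨-, b2, -⟩ := MHS.shortExact_iff.1 (forgetEt_map_shortExact hT)
  -- The first extension is lifted along the quotient map `q` of the second.
  obtain ⟨E, k, r, hk, hr, e, hex⟩ := MHS.exists_extension_lift q.et b2 i.et p.et a1 a2 a3
  have hexr : ∀ x, (r ≫ p.et).toLin x = 0 ↔ ∃ y, k.toLin y = x := hex
  have hrp : Function.Surjective (r ≫ p.et).toLin := a2.comp hr
  -- Stability of the level under extensions lets the lift be read as an extension of étale formal
  -- Hodge structures.
  have hE : E.IsOfLevel n := MHS.IsOfLevel.extension Q.level X.level k (r ≫ p.et) hk hrp hexr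
  have w0 : k ≫ r ≫ p.et = 0 := MHS.hom_ext (LinearMap.ext fun y => (hex _).2 ⟨y, rfl⟩)
  have hR : (ShortComplex.mk (ofMHSMap k Q.level hE) (ofMHSMap (r ≫ p.et) hE X.level)
      (ofMHS_hom_ext w0)).ShortExact :=
    ofMHSMap_shortExact (w := w0) (MHS.shortExact_iff.2 ⟨hk, hrp, hexr⟩) _
  -- By `φ` the étale part of the first class is the lifted class followed by `q`, while `q`
  -- followed by the class of the second extension is zero (`hz`).
  let φ : ShortComplex.mk (ofMHSMap k Q.level hE) (ofMHSMap (r ≫ p.et) hE X.level)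
      (ofMHS_hom_ext w0) ⟶ (ShortComplex.mk i p w).map (etPart n) :=
    { τ₁ := (etPart n).map q
      τ₂ := ofMHSMap r hE P.level
      τ₃ := 𝟙 _
      comm₁₂ := ofMHS_hom_ext e.symm
      comm₂₃ := ofMHS_hom_ext (Category.comp_id _).symm }
  have hφ := (ShortComplex.ShortExact.extClass_naturality hR (hS.map_of_exact (etPart n)) φ).trans
    (Ext.mk₀_id_comp _)
  have hz := (hT.map_of_exact (etPart n)).comp_extClass
  rw [Ext.mapExactFunctor_extClass, Ext.mapExactFunctor_extClass]
  refine (congrArg (fun z => z.comp (hT.map_of_exact (etPart n)).extClass (rfl : 1 + 1 = 2))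
    hφ.symm).trans ?_
  refine (Ext.comp_assoc_of_second_deg_zero _ _ _ _).trans ?_
  exact (congrArg (fun z => hR.extClass.comp z (rfl : 1 + 1 = 2)) hz).trans (Ext.comp_zero _ _ _ _ _)

/-- Two extension classes are split off the front of `x`; their product already dies under `etPart`.
-/
theorem etPart_ext_eq_zero {i : ℕ} (x : Ext X Y (i + 2)) : x.mapExactFunctor (etPart n) = 0 := by
  obtain ⟨K, P, f, g, w, hS, y, rfl⟩ := exists_extClass_comp x
  obtain ⟨K', P', f', g', w', hS', y', rfl⟩ := exists_extClass_comp y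
  rw [← Ext.comp_assoc _ _ _ (rfl : 1 + 1 = 2) (add_comm 1 i) (by omega), Ext.mapExactFunctor_comp,
    Ext.mapExactFunctor_comp, etPart_extClass_comp_extClass, Ext.zero_comp]

/-- The higher extension groups of an étale object by an object with bijective maps `π_i`
vanish. -/
theorem ext_eq_zero {A : MHS.{u}} {hA : A.IsOfLevel n} [IsIso ((toHodgePart n).app Y)] {i : ℕ}
    (hi : 2 ≤ i) (x : Ext (ofMHS A hA) Y i) : x = 0 := by
  obtain ⟨i, rfl⟩ := Nat.exists_eq_add_of_le' hi
  exact eq_zero_of_etPart_eq_zero x (etPart_ext_eq_zero x)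

/-- Write the class as an extension pushed out along `f`. If it dies in mixed Hodge structures,
`f.et` extends to the étale part of the middle term. `etPart` sees only étale parts, so it kills the
class, which suffices when the `π_i` of `Y` are bijective. -/
theorem forgetEt_ext_injective (A : MHS.{u}) (hA : A.IsOfLevel n) [IsIso ((toHodgePart n).app Y)] :
    Function.Injective ((forgetEt n).mapExtAddHom (ofMHS A hA) Y 1) := by
  refine (injective_iff_map_eq_zero _).2 fun x hx => ?_
  apply eq_zero_of_etPart_eq_zero
  obtain ⟨K, P, i, p, w, hS, y, rfl⟩ := exists_extClass_comp x
  obtain ⟨f, rfl⟩ := (Ext.mk₀_bijective _ _).2 y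
  rw [Functor.mapExtAddHom_apply, Ext.mapExactFunctor_comp, Ext.mapExactFunctor_extClass,
    Ext.mapExactFunctor_mk₀] at hx
  obtain ⟨h, hh⟩ := Ext.contravariant_sequence_exact₁ (hS.map_of_exact (forgetEt n)) _ _ _ hx
  obtain ⟨h, rfl⟩ := (Ext.mk₀_bijective _ _).2 h
  rw [Ext.mk₀_comp_mk₀] at hh
  have hf : i.et ≫ h = f.et := (Ext.mk₀_bijective _ _).1 hh
  have hf' : (etPart n).map f = (etPart n).map i ≫ ofMHSMap h P.level Y.level :=
    ofMHS_hom_ext hf.symm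
  rw [Ext.mapExactFunctor_comp, Ext.mapExactFunctor_extClass, Ext.mapExactFunctor_mk₀]
  exact extClass_comp_mk₀_eq_zero (hS.map_of_exact (etPart n)) hf'

/-- The class is that of an actual extension of `A` by `Y.et`. Its étale version pushed out along
`f` is a preimage, as `f` is the identity on étale parts. -/
theorem forgetEt_ext_surjective (A : MHS.{u}) (hA : A.IsOfLevel n) (f : ofMHS Y.et Y.level ⟶ Y)
    (hf : f.et = 𝟙 _) :
    Function.Surjective ((forgetEt n).mapExtAddHom (ofMHS A hA) Y 1) := by
  intro y
  change Ext A Y.et 1 at y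
  obtain ⟨K, P, i, p, w, hS, z, rfl⟩ := exists_extClass_comp y
  obtain ⟨z, rfl⟩ := (Ext.mk₀_bijective _ _).2 z
  obtain ⟨E, j, q, w', hE, e⟩ := exists_pushout_extClass hS z
  obtain ⟨a1, a2, a3⟩ := MHS.shortExact_iff.1 hE
  -- Without this the middle term, which is an arbitrary mixed Hodge structure, could not be viewed
  -- as a formal Hodge structure of level `≤ n`.
  have hEl : E.IsOfLevel n := MHS.IsOfLevel.extension Y.level hA j q a1 a2 a3
  have hR : (ShortComplex.mk (ofMHSMap j Y.level hEl) (ofMHSMap q hEl hA)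
      (ofMHS_hom_ext w')).ShortExact := ofMHSMap_shortExact hE _
  refine ⟨hR.extClass.comp (Ext.mk₀ f) (add_zero 1), ?_⟩
  rw [Functor.mapExtAddHom_apply, Ext.mapExactFunctor_comp, Ext.mapExactFunctor_extClass,
    Ext.mapExactFunctor_mk₀]
  refine Eq.trans ?_ e
  change hE.extClass.comp (Ext.mk₀ f.et) (add_zero 1) = _
  rw [hf]
  exact Ext.comp_mk₀_id _

/-- The étale part of `(H, V / V^o)` as a subobject. -/
noncomputable def etToTimes (X : FHS.{u} n) : ofMHS X.et X.level ⟶ X.times :=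
  (etPartToHodgePart n).app X.times ≫ inv ((toHodgePart n).app X.times)

theorem etToTimes_et (X : FHS.{u} n) : (etToTimes X).et = 𝟙 _ := by
  have h : etToTimes X ≫ (toHodgePart n).app X.times = (etPartToHodgePart n).app X.times := by
    exact (Category.assoc _ _ _).trans
      ((congrArg _ (IsIso.inv_hom_id _)).trans (Category.comp_id _))
  have := congrArg Hom.et h
  exact (Category.comp_id _).symm.trans this

end FHS

end FormalHodge

theorem mainTheorem7 (n : ℕ) [NeZero n] (A : FormalHodge.MHS.{u}) (hA : A.IsOfLevel n)
    (X : FormalHodge.FHS.{u} n) :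
    (∃ e : Abelian.Ext A X.et 1 ≃+ Abelian.Ext (FormalHodge.FHS.ofMHS A hA) X.times 1,
      ∀ x : Abelian.Ext (FormalHodge.FHS.ofMHS A hA) X.times 1,
        e.symm x = (FormalHodge.FHS.forgetEt n).mapExtAddHom
          (FormalHodge.FHS.ofMHS A hA) X.times 1 x) ∧
    (∀ i : ℕ, 2 ≤ i →
      ∃ e : Abelian.Ext (FormalHodge.FHS.ofMHS A hA) X.times i ≃+
          Abelian.Ext (FormalHodge.FHS.ofMHS A hA) (FormalHodge.FHS.ofConn n X.conn) i,
        ∀ x : Abelian.Ext (FormalHodge.FHS.ofMHS A hA) X.times i,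
          e x = x.comp (Abelian.Ext.mk₀ X.timesProj) (add_zero i)) := by
  refine ⟨⟨(AddEquiv.ofBijective ((FormalHodge.FHS.forgetEt n).mapExtAddHom _ X.times 1)
    ⟨FormalHodge.FHS.forgetEt_ext_injective A hA,
      FormalHodge.FHS.forgetEt_ext_surjective A hA _ X.etToTimes_et⟩).symm, fun x => rfl⟩, ?_⟩
  intro i hi
  -- Both groups are zero, because the `π_i` of `X.times` and of `(H^o, 0)` are bijective, so
  -- composition with the projection is trivially bijective.
  refine ⟨AddEquiv.ofBijective ((Abelian.Ext.mk₀ X.timesProj).postcomp _ (add_zero i))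
    ⟨fun x y _ => ?_, fun y => ⟨0, ?_⟩⟩, fun x => rfl⟩
  · rw [FormalHodge.FHS.ext_eq_zero hi x, FormalHodge.FHS.ext_eq_zero hi y]
  · rw [map_zero, FormalHodge.FHS.ext_eq_zero hi y]
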